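/- Let $\mu,\lambda\in\mathbb R$ satisfy $\mu>0$, $3\lambda+2\mu\ge 0$ and $\lambda<7\mu$. Then there is $r\in(3,6)$ such that the following holds. Let $\Omega$ be either $\mathbb R^3$ or a bounded open subset of $\mathbb R^3$, let $a>0$, $\gamma>1$, $T\in(0,\infty)$ and $q\in(3,6]$, and let $(\rho,u)$, with $\rho\ge 0$, be a strong solution on $[0,T)$ of the isentropic compressible Navier–Stokes system $$\partial_t\rho+\operatorname{div}(\rho u)=0,\qquad \partial_t(\rho u)+\operatorname{div}(\rho u\otimes u)-\mu\Delta u-(\mu+\lambda)\nabla\operatorname{div}u+\nabla(a\rho^\gamma)=0\quad\text{in }(0,T)\times\Omega,$$ with $(\rho,u)|_{t=0}=(\rho_0,u_0)$ and $u=0$ on $(0,T)\times\partial\Omega$. That is, $\rho_0\in L^1(\Omega)$, $$\rho\in C([0,T);H^1(\Omega)\cap W^{1,q}(\Omega)),\qquad u\in C([0,T);D^1_0(\Omega)\cap D^2(\Omega))\cap L^2_{loc}([0,T);D^{2,q}(\Omega)),$$ and the equations hold in the sense of distributions. Here $\|v\|_{D^{k,p}}=\|\nabla^k v\|_{L^p(\Omega)}$,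 $D^k=D^{k,2}$, and $D^1_0(\Omega)$ is the space of $v\in L^6(\Omega)$ with $\nabla v\in L^2(\Omega)$ that vanish on $\partial\Omega$, i.e. are limits of fields in $C_c^\infty(\Omega)$ with respect to $\|v\|_{L^6}+\|\nabla v\|_{L^2}$. Assume that $\|\rho\|_{L^\infty(0,T;L^\infty(\Omega))}\le M$. Then $\rho|u|^r\in L^\infty(0,T;L^1(\Omega))$ and $$\big\|\rho|u|^r\big\|_{L^\infty(0,T;L^1(\Omega))}\le C,$$ where $C$ depends only on $\mu,\lambda,a,\gamma,\Omega$, on $T$ and $M$, on upper bounds for $\|\rho_0\|_{L^\infty(\Omega)}$ and $\|\nabla u_0\|_{L^2(\Omega)}$ and, only in the case $\Omega=\mathbb R^3$, on an upper bound for $\|\rho_0\|_{L^1(\mathbb R^3)}$. -/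

import Mathlib

open MeasureTheory Set Filter Topology
open scoped ENNReal ContDiff

/-- Three-dimensional Euclidean space. -/
abbrev E3 : Type := EuclideanSpace ℝ (Fin 3)

/-- `3 × 3` matrices with the Frobenius norm. -/
abbrev Mat3 : Type := EuclideanSpace ℝ (Fin 3 × Fin 3)

/-- Tensors with three indices, with the Euclidean norm. -/
abbrev Tens3 : Type := EuclideanSpace ℝ (Fin 3 × Fin 3 × Fin 3)

/-- Lebesgue measure on `Ω`. -/
noncomputable abbrev vol (Ω : Set E3) : Measure E3 := volume.restrict Ω

/-- The classical partial derivative `∂ᵢ f`. -/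
noncomputable def pd (i : Fin 3) (f : E3 → ℝ) (x : E3) : ℝ :=
  fderiv ℝ f x (EuclideanSpace.single i 1)

/-- The classical Jacobian: the entry `(i, j)` is `∂ⱼ φᵢ`. -/
noncomputable def jac (φ : E3 → E3) (x : E3) : Mat3 :=
  WithLp.toLp 2 fun ij => pd ij.2 (fun y => φ y ij.1) x

/-- `φ ∈ C_c^∞(Ω; F)`. -/
def IsTest {F : Type*} [NormedAddCommGroup F] [NormedSpace ℝ F]
    (Ω : Set E3) (φ : E3 → F) : Prop :=
  ContDiff ℝ ∞ φ ∧ HasCompactSupport φ ∧ tsupport φ ⊆ Ω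

/-- `φ ∈ C_c^∞((0,T) × Ω)`. -/
def IsSpaceTimeTest (T : ℝ) (Ω : Set E3) (φ : ℝ → E3 → ℝ) : Prop :=
  ContDiff ℝ ∞ (Function.uncurry φ) ∧ HasCompactSupport (Function.uncurry φ) ∧
    tsupport (Function.uncurry φ) ⊆ Ioo 0 T ×ˢ Ω

/-- `g` is the weak partial derivative `∂ᵢ f` in the open set `Ω`. -/
def HasWeakPartial (Ω : Set E3) (i : Fin 3) (f g : E3 → ℝ) : Prop :=
  LocallyIntegrableOn f Ω ∧ LocallyIntegrableOn g Ω ∧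
    ∀ φ : E3 → ℝ, IsTest Ω φ →
      ∫ x in Ω, f x * pd i φ x = -∫ x in Ω, g x * φ x

/-- `G` is the weak gradient of the scalar function `f`. -/
def HasWeakGrad (Ω : Set E3) (f : E3 → ℝ) (G : E3 → E3) : Prop :=
  ∀ i, HasWeakPartial Ω i f fun x => G x i

/-- `G` is the weak Jacobian of the vector field `v`: the entry `(i, j)` is `∂ⱼ vᵢ`. -/
def HasWeakJac (Ω : Set E3) (v : E3 → E3) (G : E3 → Mat3) : Prop :=
  ∀ i j, HasWeakPartial Ω j (fun x => v x i) fun x => G x (i, j)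

/-- `H` is the weak derivative of the matrix field `G`: the entry `(i, j, k)` is `∂ₖ Gᵢⱼ`. If `G`
is the weak Jacobian of `v`, this entry is `∂ₖ ∂ⱼ vᵢ`. -/
def HasWeakMatDeriv (Ω : Set E3) (G : E3 → Mat3) (H : E3 → Tens3) : Prop :=
  ∀ i j k, HasWeakPartial Ω k (fun x => G x (i, j)) fun x => H x (i, j, k)

/-- `v ∈ D¹₀(Ω)`, where `G = ∇v`: `v ∈ L⁶`, `∇v ∈ L²`, and `v` vanishes on the boundary, that is,
`v` is a limit of test fields in the norm `‖v‖_{L⁶} + ‖∇v‖_{L²}`. -/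
def MemD10 (Ω : Set E3) (v : E3 → E3) (G : E3 → Mat3) : Prop :=
  HasWeakJac Ω v G ∧ MemLp v 6 (vol Ω) ∧ MemLp G 2 (vol Ω) ∧
    ∃ φ : ℕ → E3 → E3, (∀ n, IsTest Ω (φ n)) ∧
      Tendsto (fun n => eLpNorm (fun x => v x - φ n x) 6 (vol Ω)) atTop (𝓝 0) ∧
      Tendsto (fun n => eLpNorm (fun x => G x - jac (φ n) x) 2 (vol Ω)) atTop (𝓝 0)

/-- `f ∈ C([0,T); L^p(Ω))`. -/
def ContInLp {F : Type*} [NormedAddCommGroup F]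
    (T : ℝ) (Ω : Set E3) (p : ℝ≥0∞) (f : ℝ → E3 → F) : Prop :=
  (∀ t ∈ Ico 0 T, MemLp (f t) p (vol Ω)) ∧
    ∀ s ∈ Ico 0 T,
      Tendsto (fun t => eLpNorm (fun x => f t x - f s x) p (vol Ω)) (𝓝[Ico 0 T] s) (𝓝 0)

/-- The `i`-th component of `Lu = μ Δu + (μ + lam) ∇ div u`, in terms of `H = ∇²u`. -/
noncomputable def lame (μ lam : ℝ) (H : Tens3) (i : Fin 3) : ℝ :=
  μ * ∑ j, H (i, j, j) + (μ + lam) * ∑ j, H (j, j, i)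

/-- `(ρ, u)` is a strong solution on `[0,T)` of the isentropic compressible Navier–Stokes system
with pressure `a ρ^γ` and no-slip boundary condition. Here `Dρ`, `Du`, `D2u` are the weak
derivatives `∇ρ`, `∇u`, `∇²u`; the initial data are `ρ 0` and `u 0`. In this regularity class
every term in the equations other than the time derivative is a function, and the equations are
understood in the sense of distributions on `(0,T) × Ω`. -/
structure IsStrongSolution (Ω : Set E3) (μ lam a γ q T : ℝ)
    (ρ : ℝ → E3 → ℝ) (u : ℝ → E3 → E3)
    (Dρ : ℝ → E3 → E3) (Du : ℝ → E3 → Mat3) (D2u : ℝ → E3 → Tens3) : Prop where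
  /-- The density is nonnegative; vacuum is allowed. -/
  nonneg : ∀ t ∈ Ico 0 T, ∀ᵐ x ∂(vol Ω), 0 ≤ ρ t x
  /-- The initial mass is finite. -/
  mass : MemLp (ρ 0) 1 (vol Ω)
  gradρ : ∀ t ∈ Ico 0 T, HasWeakGrad Ω (ρ t) (Dρ t)
  /-- `ρ ∈ C([0,T); H¹ ∩ W^{1,q})`. -/
  contρ_two : ContInLp T Ω 2 ρ
  contDρ_two : ContInLp T Ω 2 Dρ
  contρ_q : ContInLp T Ω (ENNReal.ofReal q) ρ
  contDρ_q : ContInLp T Ω (ENNReal.ofReal q) Dρ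
  /-- `u(t) ∈ D¹₀`; this contains the boundary condition. -/
  memD10 : ∀ t ∈ Ico 0 T, MemD10 Ω (u t) (Du t)
  hessu : ∀ t ∈ Ico 0 T, HasWeakMatDeriv Ω (Du t) (D2u t)
  /-- `u ∈ C([0,T); D¹₀ ∩ D²)`, where `‖v‖_{D^k} = ‖∇^k v‖_{L²}`. -/
  contDu : ContInLp T Ω 2 Du
  contD2u : ContInLp T Ω 2 D2u
  /-- `u ∈ L²_loc([0,T); D^{2,q})`. -/
  sqIntD2u : ∀ τ ∈ Ioo 0 T,
    ∫⁻ t in Ioo 0 τ, eLpNorm (D2u t) (ENNReal.ofReal q) (vol Ω) ^ 2 < ⊤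
  /-- `∂ₜρ + div(ρu) = 0`. -/
  continuity : ∀ φ : ℝ → E3 → ℝ, IsSpaceTimeTest T Ω φ →
    ∫ t in Ioo 0 T, ∫ x in Ω,
      (ρ t x * deriv (fun s => φ s x) t + ∑ j, ρ t x * u t x j * pd j (φ t) x) = 0
  /-- `∂ₜ(ρuᵢ) + div(ρuᵢu) - (Lu)ᵢ + ∂ᵢp = 0` with `p = a ρ^γ`. -/
  momentum : ∀ i, ∀ φ : ℝ → E3 → ℝ, IsSpaceTimeTest T Ω φ →
    ∫ t in Ioo 0 T, ∫ x in Ω,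
      (ρ t x * u t x i * deriv (fun s => φ s x) t
        + ∑ j, ρ t x * u t x i * u t x j * pd j (φ t) x
        + lame μ lam (D2u t x) i * φ t x
        + a * ρ t x ^ γ * pd i (φ t) x) = 0

/-- The norm of `L^∞(0,T; L^p(Ω))`. -/
noncomputable def normLinfLp (T : ℝ) (Ω : Set E3) (p : ℝ≥0∞) (f : ℝ → E3 → ℝ) : ℝ≥0∞ :=
  essSup (fun t => eLpNorm (f t) p (vol Ω)) (volume.restrict (Ioo 0 T))

/-- `f ∈ L^∞(0,T; L¹(Ω))` in the sense of Bochner: `t ↦ f t` is strongly measurable with values in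
`L¹(Ω)` and essentially bounded. -/
def MemLinfL1 (T : ℝ) (Ω : Set E3) (f : ℝ → E3 → ℝ) : Prop :=
  (∃ F : ℝ → Lp ℝ 1 (vol Ω), AEStronglyMeasurable F (volume.restrict (Ioo 0 T)) ∧
    ∀ᵐ t ∂(volume.restrict (Ioo 0 T)), F t =ᵐ[vol Ω] f t) ∧
  normLinfLp T Ω 1 f < ⊤

/-! The estimate comes from testing the momentum equation with `|u|^(r-2) u`, where `r = 2 + 2β`.
Convection cancels against the mass equation, and a viscous quadratic form in `∇u` is left against
the pressure. Put `κ = r - 2`. Completing the square in `div u` shows that, up to the weight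
`|u|^κ`, the form dominates a positive multiple of `|∇u|²` as soon as `μ(1 + κ) > (μ + λ)κ²/4`. At
`κ = 1`, that is `r = 3`, this condition is exactly `λ < 7μ`; being open, it persists for some `r >
3` (`exists_exponent`, `viscous_form_le`, `flux_pairing_le`). Young's inequality absorbs the
pressure up to a multiple of `p² |u|^κ`, which the density bound turns into a multiple of `ρ |u|^κ`,
and Grönwall's inequality closes the argument.

Two obstacles shape the proof. First, `|u|^(r-2) u` need not be an admissible test field. The power
is replaced by the bounded weight `g(z) = ((1 + z)/(1 + εz))^β` at `z = |u|²`. It satisfies `z g' ≤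
β g`, the only structural property that coercivity needs, so the bounds do not depend on `ε` and
Fatou's lemma removes it.

Second, vacuum is allowed and no time derivative of `u` is available. With `Φ' = g`, the energy
density `ρ Φ(|u|²)/2` is a convex function of the pair `(ρ, ρu)`. Its supporting hyperplane at time
`t` pairs `ρ(s)` and `(ρu)(s)` linearly with functions frozen at time `t`; the pairing equals the
energy at `s = t` and lies below it at every other `s`. Once the frozen functions are approximated
by test functions, the weak equations differentiate the pairing in `s`. This bounds the slopes of
the energy from the left (`IsStrongSolution.energy_slope_le`), which suffices for Grönwall
(`le_mul_exp_of_left_slope`).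

A uniform mass bound, trivial on bounded domains and given by `IsStrongSolution.mass_le` on the
whole space, makes `ρ` continuous in time with values in `L^{3/2}`, the dual of the space `L³` that
contains `|u|²`. -/

/-! ### Calculus of convergence in `L^p` along a filter -/

section LpTendsto

variable {α ι κ F E : Type*} [MeasurableSpace α] [NormedAddCommGroup F] [NormedAddCommGroup E]
  {ν : Measure α} {l : Filter ι} {p q r : ℝ≥0∞}

/-- `f i` converges to `g` in `L^p` along the filter `l`. -/
structure LpTendsto (p : ℝ≥0∞) (ν : Measure α) (l : Filter ι) (f : ι → α → F) (g : α → F) :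
    Prop where
  ev : ∀ᶠ i in l, MemLp (f i) p ν
  lim_mem : MemLp g p ν
  lim : Tendsto (fun i => eLpNorm (fun x => f i x - g x) p ν) l (𝓝 0)

theorem LpTendsto.const {g : α → F} (hg : MemLp g p ν) : LpTendsto p ν l (fun _ => g) g :=
  ⟨Eventually.of_forall fun _ => hg, hg, by simp [tendsto_const_nhds]⟩

theorem LpTendsto.comp_tendsto {f : ι → α → F} {g : α → F} {m : Filter κ} {k : κ → ι}
    (h : LpTendsto p ν l f g) (hk : Tendsto k m l) : LpTendsto p ν m (fun i => f (k i)) g :=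
  ⟨hk.eventually h.ev, h.lim_mem, h.lim.comp hk⟩

theorem LpTendsto.congr {f f' : ι → α → F} {g g' : α → F}
    (h : LpTendsto p ν l f g) (hf : ∀ᶠ i in l, f i =ᵐ[ν] f' i) (hg : g =ᵐ[ν] g') :
    LpTendsto p ν l f' g' := by
  refine ⟨?_, h.lim_mem.ae_eq hg, ?_⟩
  · filter_upwards [h.ev, hf] with i h1 h2 using h1.ae_eq h2
  · refine h.lim.congr' ?_
    filter_upwards [hf] with i h2
    exact eLpNorm_congr_ae (h2.sub hg)

/-- Convergence is inherited by images under pointwise Lipschitz operations. -/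
theorem LpTendsto.of_le {f : ι → α → F} {g : α → F} {f' : ι → α → E} {g' : α → E}
    (h : LpTendsto p ν l f g) (hg' : MemLp g' p ν)
    (hm : ∀ᶠ i in l, AEStronglyMeasurable (f' i) ν) (C : ℝ)
    (hle : ∀ᶠ i in l, ∀ᵐ x ∂ν, ‖f' i x - g' x‖ ≤ C * ‖f i x - g x‖) :
    LpTendsto p ν l f' g' := by
  have key : ∀ᶠ i in l, eLpNorm (fun x => f' i x - g' x) p ν
      ≤ ENNReal.ofReal C * eLpNorm (fun x => f i x - g x) p ν := by
    filter_upwards [hle] with i hi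
    exact eLpNorm_le_mul_eLpNorm_of_ae_le_mul hi p
  have hz : Tendsto (fun i => ENNReal.ofReal C * eLpNorm (fun x => f i x - g x) p ν) l (𝓝 0) := by
    simpa using ENNReal.Tendsto.const_mul h.lim (Or.inr ENNReal.ofReal_ne_top)
  refine ⟨?_, hg', tendsto_of_tendsto_of_tendsto_of_le_of_le' tendsto_const_nhds hz
    (Eventually.of_forall fun _ => zero_le) key⟩
  filter_upwards [h.ev, hm, hle] with i h1 h2 h3
  have : MemLp (fun x => f' i x - g' x) p ν :=
    (h1.sub h.lim_mem).of_le_mul (h2.sub hg'.1) h3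
  have h4 := this.add hg'
  refine h4.ae_eq (Eventually.of_forall fun x => ?_)
  simp

theorem LpTendsto.add {f f' : ι → α → F} {g g' : α → F} (hp : 1 ≤ p)
    (h : LpTendsto p ν l f g) (h' : LpTendsto p ν l f' g') :
    LpTendsto p ν l (fun i x => f i x + f' i x) (fun x => g x + g' x) := by
  refine ⟨?_, h.lim_mem.add h'.lim_mem, ?_⟩
  · filter_upwards [h.ev, h'.ev] with i h1 h2 using h1.add h2
  · have hz := h.lim.add h'.lim
    rw [add_zero] at hz
    refine tendsto_of_tendsto_of_tendsto_of_le_of_le' tendsto_const_nhds hz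
      (Eventually.of_forall fun _ => zero_le) ?_
    filter_upwards [h.ev, h'.ev] with i h1 h2
    have := eLpNorm_add_le (h1.sub h.lim_mem).1 (h2.sub h'.lim_mem).1 hp
    refine le_trans (le_of_eq ?_) this
    congr 1
    ext x
    simp only [Pi.add_apply, Pi.sub_apply]
    abel

theorem LpTendsto.const_mul {f : ι → α → ℝ} {g : α → ℝ} (c : ℝ) (h : LpTendsto p ν l f g) :
    LpTendsto p ν l (fun i x => c * f i x) (fun x => c * g x) := by
  refine h.of_le (h.lim_mem.const_mul c) (h.ev.mono fun i hi => (hi.const_mul c).1) |c| ?_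
  refine Eventually.of_forall fun i => Eventually.of_forall fun x => ?_
  rw [← mul_sub, norm_mul, Real.norm_eq_abs]

theorem LpTendsto.neg {f : ι → α → ℝ} {g : α → ℝ} (h : LpTendsto p ν l f g) :
    LpTendsto p ν l (fun i x => - f i x) (fun x => - g x) := by
  simpa using h.const_mul (-1)

theorem LpTendsto.sub {f f' : ι → α → ℝ} {g g' : α → ℝ} (hp : 1 ≤ p)
    (h : LpTendsto p ν l f g) (h' : LpTendsto p ν l f' g') :
    LpTendsto p ν l (fun i x => f i x - f' i x) (fun x => g x - g' x) := by
  simpa [sub_eq_add_neg] using h.add hp h'.neg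

theorem LpTendsto.sum {β : Type*} (s : Finset β) {f : β → ι → α → ℝ} {g : β → α → ℝ} (hp : 1 ≤ p)
    (h : ∀ b ∈ s, LpTendsto p ν l (f b) (g b)) :
    LpTendsto p ν l (fun i x => ∑ b ∈ s, f b i x) (fun x => ∑ b ∈ s, g b x) := by
  classical
  induction s using Finset.induction_on with
  | empty =>
    simpa using LpTendsto.const (l := l) (g := fun _ : α => (0 : ℝ)) (p := p) (ν := ν) MemLp.zero
  | insert b s hb ih =>
    simp only [Finset.sum_insert hb]
    exact (h b (by simp)).add hp (ih fun c hc => h c (by simp [hc]))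

theorem LpTendsto.mul {f f' : ι → α → ℝ} {g g' : α → ℝ} [hpqr : ENNReal.HolderTriple p q r]
    (hr : 1 ≤ r) (h : LpTendsto p ν l f g) (h' : LpTendsto q ν l f' g') :
    LpTendsto r ν l (fun i x => f i x * f' i x) (fun x => g x * g' x) := by
  have hol : ∀ {a b : α → ℝ}, AEStronglyMeasurable a ν → AEStronglyMeasurable b ν →
      eLpNorm (fun x => a x * b x) r ν ≤ eLpNorm a p ν * eLpNorm b q ν := fun {a b} ha hb =>
    eLpNorm_smul_le_mul_eLpNorm (r := r) (p := p) (q := q) (φ := a) (f := b) hb ha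
  refine ⟨?_, h'.lim_mem.mul' h.lim_mem, ?_⟩
  · filter_upwards [h.ev, h'.ev] with i h1 h2 using h2.mul' h1
  have hz : Tendsto (fun i => eLpNorm (fun x => f i x - g x) p ν *
      eLpNorm (fun x => f' i x - g' x) q ν + (eLpNorm (fun x => f i x - g x) p ν * eLpNorm g' q ν
      + eLpNorm g p ν * eLpNorm (fun x => f' i x - g' x) q ν)) l (𝓝 0) := by
    have h1 := ENNReal.Tendsto.mul h.lim (Or.inr ENNReal.zero_ne_top) h'.lim
      (Or.inr ENNReal.zero_ne_top)
    have h2 := ENNReal.Tendsto.mul_const (b := eLpNorm g' q ν) h.lim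
      (Or.inr h'.lim_mem.eLpNorm_ne_top)
    have h3 := ENNReal.Tendsto.const_mul (a := eLpNorm g p ν) h'.lim
      (Or.inr h.lim_mem.eLpNorm_ne_top)
    simpa using h1.add (h2.add h3)
  refine tendsto_of_tendsto_of_tendsto_of_le_of_le' tendsto_const_nhds hz
      (Eventually.of_forall fun _ => zero_le) ?_
  filter_upwards [h.ev, h'.ev] with i h1 h2
  have e1 := (h1.sub h.lim_mem).1
  have e2 := (h2.sub h'.lim_mem).1
  have heq : (fun x => f i x * f' i x - g x * g' x) =
      (fun x => (f i x - g x) * (f' i x - g' x)) +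
      ((fun x => (f i x - g x) * g' x) + (fun x => g x * (f' i x - g' x))) := by
    ext x; simp only [Pi.add_apply]; ring
  rw [heq]
  refine (eLpNorm_add_le (e1.mul e2) ((e1.mul h'.lim_mem.1).add (h.lim_mem.1.mul e2)) hr).trans ?_
  refine add_le_add (hol e1 e2) ?_
  refine (eLpNorm_add_le (e1.mul h'.lim_mem.1) (h.lim_mem.1.mul e2) hr).trans ?_
  exact add_le_add (hol e1 h'.lim_mem.1) (hol h.lim_mem.1 e2)

theorem LpTendsto.integral {f : ι → α → ℝ} {g : α → ℝ} (h : LpTendsto 1 ν l f g) :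
    Tendsto (fun i => ∫ x, f i x ∂ν) l (𝓝 (∫ x, g x ∂ν)) := by
  refine tendsto_integral_of_L1' g h.lim_mem.1
    (h.ev.mono fun i hi => memLp_one_iff_integrable.1 hi) h.lim

theorem LpTendsto.integral_mul {f f' : ι → α → ℝ} {g g' : α → ℝ}
    [hpqr : ENNReal.HolderTriple p q 1]
    (h : LpTendsto p ν l f g) (h' : LpTendsto q ν l f' g') :
    Tendsto (fun i => ∫ x, f i x * f' i x ∂ν) l (𝓝 (∫ x, g x * g' x ∂ν)) :=
  (h.mul (r := 1) le_rfl h').integral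

theorem LpTendsto.toReal {f : ι → α → F} {g : α → F} (hp : 1 ≤ p) (h : LpTendsto p ν l f g) :
    Tendsto (fun i => (eLpNorm (f i) p ν).toReal) l (𝓝 (eLpNorm g p ν).toReal) := by
  have h0 : Tendsto (fun i => (eLpNorm (fun x => f i x - g x) p ν).toReal) l (𝓝 0) := by
    have := (ENNReal.tendsto_toReal ENNReal.zero_ne_top).comp h.lim
    rwa [ENNReal.toReal_zero] at this
  refine tendsto_iff_dist_tendsto_zero.2
    (tendsto_of_tendsto_of_tendsto_of_le_of_le' tendsto_const_nhds h0
      (Eventually.of_forall fun _ => dist_nonneg) ?_)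
  filter_upwards [h.ev] with i hi
  have hd := hi.sub h.lim_mem
  have h1 : eLpNorm (f i) p ν ≤ eLpNorm (f i - g) p ν + eLpNorm g p ν := by
    have := eLpNorm_add_le hd.1 h.lim_mem.1 hp
    simpa using this
  have h2 : eLpNorm g p ν ≤ eLpNorm (f i) p ν + eLpNorm (f i - g) p ν := by
    have := eLpNorm_sub_le hi.1 hd.1 hp
    simpa using this
  have h1' := ENNReal.toReal_mono (ENNReal.add_ne_top.2 ⟨hd.2.ne, h.lim_mem.2.ne⟩) h1
  have h2' := ENNReal.toReal_mono (ENNReal.add_ne_top.2 ⟨hi.2.ne, hd.2.ne⟩) h2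
  rw [ENNReal.toReal_add hd.2.ne h.lim_mem.2.ne] at h1'
  rw [ENNReal.toReal_add hi.2.ne hd.2.ne] at h2'
  rw [Real.dist_eq, abs_le]
  change _ ≤ _ ∧ _ ≤ (eLpNorm (f i - g) p ν).toReal
  change -(eLpNorm (f i - g) p ν).toReal ≤ _ ∧ _
  constructor <;> linarith

/-- Dominated convergence in `L^p` for a multiplier. -/
theorem tendsto_eLpNorm_mul_of_bdd {b : ℕ → α → ℝ} {g : α → ℝ} (C : ℝ) (hp0 : p ≠ 0) (hp : p ≠ ⊤)
    (hg : MemLp g p ν) (hbm : ∀ n, AEStronglyMeasurable (b n) ν)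
    (hb : ∀ n, ∀ᵐ x ∂ν, |b n x| ≤ C)
    (hlim : ∀ᵐ x ∂ν, Tendsto (fun n => b n x) atTop (𝓝 0)) :
    Tendsto (fun n => eLpNorm (fun x => b n x * g x) p ν) atTop (𝓝 0) := by
  have hp' := ENNReal.toReal_pos hp0 hp
  simp only [eLpNorm_eq_lintegral_rpow_enorm_toReal hp0 hp]
  have h0 : Tendsto (fun n => ∫⁻ x, ‖b n x * g x‖ₑ ^ p.toReal ∂ν) atTop (𝓝 (∫⁻ _, 0 ∂ν)) := by
    refine tendsto_lintegral_of_dominated_convergence'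
      (fun x => (ENNReal.ofReal C * ‖g x‖ₑ) ^ p.toReal) ?_ ?_ ?_ ?_
    · intro n
      exact (((hbm n).mul hg.1).enorm).pow_const _
    · intro n
      filter_upwards [hb n] with x hx
      refine ENNReal.rpow_le_rpow ?_ hp'.le
      rw [enorm_mul]
      gcongr
      rw [← ofReal_norm, Real.norm_eq_abs]
      exact ENNReal.ofReal_le_ofReal hx
    · have := (hg.const_mul C)
      have h2 := lintegral_rpow_enorm_lt_top_of_eLpNorm_lt_top hp0 hp hg.2
      simp_rw [ENNReal.mul_rpow_of_nonneg _ _ hp'.le]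
      rw [lintegral_const_mul' _ _ (ENNReal.rpow_ne_top_of_nonneg hp'.le ENNReal.ofReal_ne_top)]
      exact ENNReal.mul_ne_top (ENNReal.rpow_ne_top_of_nonneg hp'.le ENNReal.ofReal_ne_top) h2.ne
    · filter_upwards [hlim] with x hx
      have h1 : Tendsto (fun n => b n x * g x) atTop (𝓝 0) := by simpa using hx.mul_const (g x)
      have h2 : Tendsto (fun n => ‖b n x * g x‖ₑ) atTop (𝓝 0) := by
        simpa using h1.enorm
      have h3 := (ENNReal.continuous_rpow_const (y := p.toReal)).tendsto 0
      rw [ENNReal.zero_rpow_of_pos hp'] at h3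
      exact h3.comp h2
  rw [lintegral_zero] at h0
  have h3 := (ENNReal.continuous_rpow_const (y := 1 / p.toReal)).tendsto 0
  rw [ENNReal.zero_rpow_of_pos (by positivity)] at h3
  exact h3.comp h0

/-- A bounded, almost everywhere convergent multiplier preserves `L^p` convergence. -/
theorem LpTendsto.bdd_mul {b : ℕ → α → ℝ} {b0 : α → ℝ} {f : ℕ → α → ℝ} {g : α → ℝ} (C : ℝ)
    (hp1 : 1 ≤ p) (hp : p ≠ ⊤) (h : LpTendsto p ν atTop f g)
    (hbm : ∀ n, AEStronglyMeasurable (b n) ν)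
    (hb : ∀ n, ∀ᵐ x ∂ν, |b n x| ≤ C)
    (hlim : ∀ᵐ x ∂ν, Tendsto (fun n => b n x) atTop (𝓝 (b0 x))) :
    LpTendsto p ν atTop (fun n x => b n x * f n x) (fun x => b0 x * g x) := by
  have hp0 : p ≠ 0 := (zero_lt_one.trans_le hp1).ne'
  have hb0m : AEStronglyMeasurable b0 ν := aestronglyMeasurable_of_tendsto_ae _ hbm hlim
  have hb0 : ∀ᵐ x ∂ν, |b0 x| ≤ C := by
    filter_upwards [hlim, ae_all_iff.2 hb] with x hx hbx
    exact le_of_tendsto hx.abs (Eventually.of_forall hbx)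
  -- Split `bₙfₙ - b₀g = bₙ(fₙ - g) + (bₙ - b₀)g`: the first term is small by boundedness of `bₙ`,
  -- the second by dominated convergence.
  have h1 : LpTendsto p ν atTop (fun n x => b n x * (f n x - g x)) (fun _ => 0) := by
    have hd : LpTendsto p ν atTop (fun n x => f n x - g x) (fun _ => 0) := by
      simpa using h.sub hp1 (LpTendsto.const (l := atTop) h.lim_mem)
    refine hd.of_le MemLp.zero ?_ C ?_
    · filter_upwards [hd.ev] with n hn using (hbm n).mul hn.1
    · refine Eventually.of_forall fun n => ?_
      filter_upwards [hb n] with x hx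
      rw [sub_zero, sub_zero, norm_mul]
      exact mul_le_mul_of_nonneg_right hx (norm_nonneg _)
  have hmem : ∀ {c : α → ℝ}, AEStronglyMeasurable c ν → (∀ᵐ x ∂ν, |c x| ≤ C) →
      MemLp (fun x => c x * g x) p ν := fun {c} hc hcb => by
    refine h.lim_mem.of_le_mul (c := C) (hc.mul h.lim_mem.1) ?_
    filter_upwards [hcb] with x hx
    rw [norm_mul]
    exact mul_le_mul_of_nonneg_right hx (norm_nonneg _)
  have h2 : LpTendsto p ν atTop (fun n x => b n x * g x) (fun x => b0 x * g x) := by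
    refine ⟨Eventually.of_forall fun n => hmem (hbm n) (hb n), hmem hb0m hb0, ?_⟩
    have := tendsto_eLpNorm_mul_of_bdd (b := fun n x => b n x - b0 x) (C + C) hp0 hp h.lim_mem
      (fun n => (hbm n).sub hb0m) (fun n => by
        filter_upwards [hb n, hb0] with x h1 h2
        exact (abs_sub _ _).trans (add_le_add h1 h2)) (by
        filter_upwards [hlim] with x hx
        simpa using hx.sub_const (b0 x))
    simpa [sub_mul] using this
  refine (h1.add hp1 h2).congr (Eventually.of_forall fun n => Eventually.of_forall fun x => ?_)
    (Eventually.of_forall fun x => ?_)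
  · simp only []; ring
  · simp

/-- On bounded sets `L²` convergence implies `L⁶` convergence. -/
theorem LpTendsto.six_of_two {f : ι → α → ℝ} {g : α → ℝ} (C : ℝ) (h : LpTendsto 2 ν l f g)
    (hb : ∀ᶠ i in l, ∀ᵐ x ∂ν, |f i x| ≤ C) (hg : ∀ᵐ x ∂ν, |g x| ≤ C) : LpTendsto 6 ν l f g := by
  have key : ∀ {a : α → ℝ} {D : ℝ}, (∀ᵐ x ∂ν, |a x| ≤ D) →
      eLpNorm a 6 ν ≤ (ENNReal.ofReal D ^ (4 : ℝ) * (eLpNorm a 2 ν) ^ (2 : ℝ)) ^ (1 / 6 : ℝ) := by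
    intro a D hD
    rw [eLpNorm_eq_lintegral_rpow_enorm_toReal (by simp) (by simp),
      eLpNorm_eq_lintegral_rpow_enorm_toReal (p := 2) (by simp) (by simp)]
    rw [← ENNReal.rpow_mul]
    simp only [ENNReal.toReal_ofNat, one_div]
    refine ENNReal.rpow_le_rpow ?_ (by norm_num)
    norm_num
    rw [← lintegral_const_mul' _ _ (ENNReal.pow_ne_top ENNReal.ofReal_ne_top)]
    refine lintegral_mono_ae ?_
    filter_upwards [hD] with x hx
    have : ‖a x‖ₑ ≤ ENNReal.ofReal D := by
      rw [← ofReal_norm, Real.norm_eq_abs]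
      exact ENNReal.ofReal_le_ofReal hx
    rw [show (6 : ℕ) = 4 + 2 from rfl, pow_add]
    gcongr
  have mem : ∀ {a : α → ℝ} {D : ℝ}, MemLp a 2 ν → (∀ᵐ x ∂ν, |a x| ≤ D) → MemLp a 6 ν := by
    intro a D ha hD
    refine ⟨ha.1, (key hD).trans_lt ?_⟩
    refine ENNReal.rpow_lt_top_of_nonneg (by norm_num) (ENNReal.mul_ne_top ?_ ?_)
    · exact ENNReal.rpow_ne_top_of_nonneg (by norm_num) ENNReal.ofReal_ne_top
    · exact ENNReal.rpow_ne_top_of_nonneg (by norm_num) ha.2.ne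
  refine ⟨?_, mem h.lim_mem hg, ?_⟩
  · filter_upwards [h.ev, hb] with i h1 h2 using mem h1 h2
  have hz : Tendsto (fun i => (ENNReal.ofReal (C + C) ^ (4 : ℝ) *
      (eLpNorm (fun x => f i x - g x) 2 ν) ^ (2 : ℝ)) ^ (1 / 6 : ℝ)) l (𝓝 0) := by
    have h2 := (ENNReal.continuous_rpow_const (y := (2 : ℝ))).tendsto 0
    rw [ENNReal.zero_rpow_of_pos (by norm_num)] at h2
    have h3 := ENNReal.Tendsto.const_mul (a := ENNReal.ofReal (C + C) ^ (4 : ℝ)) (h2.comp h.lim)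
      (Or.inr (ENNReal.rpow_ne_top_of_nonneg (by norm_num) ENNReal.ofReal_ne_top))
    rw [mul_zero] at h3
    have h4 := (ENNReal.continuous_rpow_const (y := (1 / 6 : ℝ))).tendsto 0
    rw [ENNReal.zero_rpow_of_pos (by norm_num)] at h4
    exact h4.comp h3
  refine tendsto_of_tendsto_of_tendsto_of_le_of_le' tendsto_const_nhds hz
      (Eventually.of_forall fun _ => zero_le) ?_
  filter_upwards [hb] with i hi
  refine key ?_
  filter_upwards [hi, hg] with x h1 h2
  exact (abs_sub _ _).trans (add_le_add h1 h2)

/-- Boundedness in `L¹` and convergence in `L²` imply convergence in `L^{3/2}`. -/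
theorem LpTendsto.three_halves_of_two {f : ι → α → ℝ} {g : α → ℝ} (C : ℝ≥0∞) (hC : C ≠ ⊤)
    (h : LpTendsto 2 ν l f g) (hb : ∀ᶠ i in l, eLpNorm (f i) 1 ν ≤ C) (hg : eLpNorm g 1 ν ≤ C) :
    LpTendsto (3 / 2) ν l f g := by
  have h32 : ((3 : ℝ≥0∞) / 2).toReal = 3 / 2 := by simp
  have h0 : ((3 : ℝ≥0∞) / 2) ≠ 0 := by simp
  have ht : ((3 : ℝ≥0∞) / 2) ≠ ⊤ := ENNReal.div_ne_top (by simp) (by simp)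
  -- Cauchy–Schwarz applied to `|a|^{3/2} = |a|^{1/2} |a|`.
  have key : ∀ {a : α → ℝ}, AEStronglyMeasurable a ν →
      eLpNorm a (3 / 2) ν ≤
        ((eLpNorm a 1 ν) ^ (1 / 2 : ℝ) * eLpNorm a 2 ν) ^ (2 / 3 : ℝ) := by
    intro a ha
    rw [eLpNorm_eq_lintegral_rpow_enorm_toReal h0 ht,
      eLpNorm_eq_lintegral_rpow_enorm_toReal (p := 2) (by simp) (by simp),
      eLpNorm_one_eq_lintegral_enorm, h32]
    rw [show (1 / (3 / 2) : ℝ) = 2 / 3 by norm_num]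
    refine ENNReal.rpow_le_rpow ?_ (by norm_num)
    have := ENNReal.lintegral_mul_le_Lp_mul_Lq ν (p := 2) (q := 2)
      (by constructor <;> norm_num) (f := fun x => ‖a x‖ₑ ^ (1 / 2 : ℝ))
      (g := fun x => ‖a x‖ₑ) (ha.enorm.pow_const _) ha.enorm
    refine le_trans (le_of_eq ?_) (this.trans (le_of_eq ?_))
    · refine lintegral_congr fun x => ?_
      simp only [Pi.mul_apply]
      conv_rhs => rw [← ENNReal.rpow_one (‖a x‖ₑ), ← ENNReal.rpow_mul]
      rw [← ENNReal.rpow_add_of_nonneg _ _ (by norm_num) (by norm_num)]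
      norm_num
    · simp only [← ENNReal.rpow_mul]
      norm_num
  have mem : ∀ {a : α → ℝ}, MemLp a 2 ν → eLpNorm a 1 ν ≤ C → MemLp a (3 / 2) ν := by
    intro a ha haC
    refine ⟨ha.1, (key ha.1).trans_lt ?_⟩
    refine ENNReal.rpow_lt_top_of_nonneg (by norm_num) (ENNReal.mul_ne_top ?_ ha.2.ne)
    exact ENNReal.rpow_ne_top_of_nonneg (by norm_num) (haC.trans_lt hC.lt_top).ne
  refine ⟨?_, mem h.lim_mem hg, ?_⟩
  · filter_upwards [h.ev, hb] with i h1 h2 using mem h1 h2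
  have hz : Tendsto (fun i => ((C + C) ^ (1 / 2 : ℝ) *
      (eLpNorm (fun x => f i x - g x) 2 ν)) ^ (2 / 3 : ℝ)) l (𝓝 0) := by
    have h3 := ENNReal.Tendsto.const_mul (a := (C + C) ^ (1 / 2 : ℝ)) h.lim
      (Or.inr (ENNReal.rpow_ne_top_of_nonneg (by norm_num) (ENNReal.add_ne_top.2 ⟨hC, hC⟩)))
    rw [mul_zero] at h3
    have h4 := (ENNReal.continuous_rpow_const (y := (2 / 3 : ℝ))).tendsto 0
    rw [ENNReal.zero_rpow_of_pos (by norm_num)] at h4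
    exact h4.comp h3
  refine tendsto_of_tendsto_of_tendsto_of_le_of_le' tendsto_const_nhds hz
      (Eventually.of_forall fun _ => zero_le) ?_
  filter_upwards [h.ev, hb] with i h1 h2
  refine (key (h1.sub h.lim_mem).1).trans ?_
  have : eLpNorm (f i - g) 1 ν ≤ C + C :=
    (eLpNorm_sub_le h1.1 h.lim_mem.1 le_rfl).trans (add_le_add h2 hg)
  change (_ * eLpNorm (f i - g) 2 ν) ^ _ ≤ (_ * eLpNorm (f i - g) 2 ν) ^ _
  gcongr

theorem LpTendsto.exists_seq_ae {f : ℕ → α → F} {g : α → F} (hp : p ≠ 0)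
    (h : LpTendsto p ν atTop f g) (hm : ∀ n, AEStronglyMeasurable (f n) ν) :
    ∃ ns : ℕ → ℕ, StrictMono ns ∧ ∀ᵐ x ∂ν, Tendsto (fun n => f (ns n) x) atTop (𝓝 (g x)) :=
  (tendstoInMeasure_of_tendsto_eLpNorm hp hm h.lim_mem.1 h.lim).exists_seq_tendsto_ae

/-- `L^p` limits inherit almost everywhere upper bounds. -/
theorem LpTendsto.ae_le {f : ℕ → α → ℝ} {g : α → ℝ} (hp : p ≠ 0)
    (h : LpTendsto p ν atTop f g) (hm : ∀ n, AEStronglyMeasurable (f n) ν) (C : ℝ)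
    (hle : ∀ n, ∀ᵐ x ∂ν, f n x ≤ C) : ∀ᵐ x ∂ν, g x ≤ C := by
  obtain ⟨ns, -, hns⟩ := h.exists_seq_ae hp hm
  filter_upwards [hns, ae_all_iff.2 hle] with x hx hl
  exact le_of_tendsto hx (Eventually.of_forall fun n => hl _)

end LpTendsto

/-! ### Hölder triples for the exponents 6, 3, 2, 3/2 -/

instance holder_six_six : ENNReal.HolderTriple 6 6 3 := ⟨by
  rw [← ENNReal.toReal_eq_toReal_iff' (by simp) (by simp), ENNReal.toReal_add (by simp) (by simp)]
  simp; norm_num⟩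

instance holder_six_three : ENNReal.HolderTriple 6 3 2 := ⟨by
  rw [← ENNReal.toReal_eq_toReal_iff' (by simp) (by simp), ENNReal.toReal_add (by simp) (by simp)]
  simp; norm_num⟩

instance holder_six_two : ENNReal.HolderTriple 6 2 (3 / 2) := ⟨by
  rw [← ENNReal.toReal_eq_toReal_iff' (by simp) (by simp), ENNReal.toReal_add (by simp) (by simp)]
  simp; norm_num⟩

instance holder_three_threeHalves : ENNReal.HolderTriple 3 (3 / 2) 1 := ⟨by
  rw [← ENNReal.toReal_eq_toReal_iff' (by simp) (by simp), ENNReal.toReal_add (by simp) (by simp)]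
  simp; norm_num⟩

instance holder_threeHalves_three : ENNReal.HolderTriple (3 / 2) 3 1 := ⟨by
  rw [← ENNReal.toReal_eq_toReal_iff' (by simp) (by simp), ENNReal.toReal_add (by simp) (by simp)]
  simp; norm_num⟩

/-! ### Sobolev's inequality on `D¹₀` -/

section Sobolev

theorem norm_fderiv_le_jac {φ : E3 → E3} {x : E3} (h : DifferentiableAt ℝ φ x) :
    ‖fderiv ℝ φ x‖ ≤ 3 * ‖jac φ x‖ := by
  have hc : ∀ i j, jac φ x (i, j) = (fderiv ℝ φ x (EuclideanSpace.single j 1)) i := by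
    intro i j
    have := ((EuclideanSpace.proj (𝕜 := ℝ) i).hasFDerivAt.comp x h.hasFDerivAt).fderiv
    change fderiv ℝ (fun y => φ y i) x _ = _
    change fderiv ℝ (fun y => φ y i) x = _ at this
    rw [this]; rfl
  refine ContinuousLinearMap.opNorm_le_bound _ (by positivity) fun v => ?_
  have hv : v = ∑ j, v j • EuclideanSpace.single j (1 : ℝ) := by
    ext i; simp [Finset.sum_apply, Pi.single_apply]
  have hcol : ∀ j, ‖fderiv ℝ φ x (EuclideanSpace.single j 1)‖ ≤ ‖jac φ x‖ := by
    intro j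
    rw [EuclideanSpace.norm_eq, EuclideanSpace.norm_eq]
    refine Real.sqrt_le_sqrt ?_
    rw [Fintype.sum_prod_type]
    refine Finset.sum_le_sum fun i _ => ?_
    rw [← hc]
    exact Finset.single_le_sum (f := fun k => ‖jac φ x (i, k)‖ ^ 2) (fun _ _ => by positivity)
      (Finset.mem_univ j)
  conv_lhs => rw [hv]
  rw [map_sum]
  refine (norm_sum_le _ _).trans ?_
  have : ∀ j ∈ Finset.univ, ‖fderiv ℝ φ x (v j • EuclideanSpace.single j (1 : ℝ))‖
      ≤ ‖jac φ x‖ * ‖v‖ := by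
    intro j _
    rw [map_smul, norm_smul, mul_comm]
    exact mul_le_mul (hcol j) (PiLp.norm_apply_le v j) (norm_nonneg _) (norm_nonneg _)
  refine (Finset.sum_le_sum this).trans (le_of_eq ?_)
  simp; ring

theorem eLpNorm_restrict_eq_of_forall_notMem {α F : Type*} [MeasurableSpace α]
    [NormedAddCommGroup F] {ν : Measure α} {s : Set α} {f : α → F} {p : ℝ≥0∞}
    (h : ∀ x, x ∉ s → f x = 0) : eLpNorm f p (ν.restrict s) = eLpNorm f p ν :=
  eLpNorm_restrict_eq_of_support_subset fun x hx => by
    by_contra hs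
    exact hx (h x hs)

/-- The Sobolev constant for `‖φ‖₆ ≤ C ‖∇φ‖₂`. -/
theorem exists_sobolev_test : ∃ C : ℝ, 0 ≤ C ∧ ∀ (Ω : Set E3) (φ : E3 → E3), IsTest Ω φ →
    eLpNorm φ 6 (vol Ω) ≤ ENNReal.ofReal C * eLpNorm (jac φ) 2 (vol Ω) := by
  obtain ⟨c, hc⟩ : ∃ c : NNReal, ∀ φ : E3 → E3, ContDiff ℝ 1 φ → HasCompactSupport φ →
      eLpNorm φ 6 (volume : Measure E3) ≤ c * eLpNorm (fderiv ℝ φ) 2 volume :=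
    ⟨_, fun φ h1 h2 => by
      simpa using eLpNorm_le_eLpNorm_fderiv_of_eq (μ := (volume : Measure E3)) (F := E3) (u := φ)
        h1 h2 (p := 2) (p' := 6) (by norm_num) (by simp) (by simp; norm_num)⟩
  refine ⟨c * 3, by positivity, fun Ω φ hφ => ?_⟩
  obtain ⟨h1, h2, h3⟩ := hφ
  have hsub : eLpNorm (fderiv ℝ φ) 2 (volume : Measure E3) = eLpNorm (fderiv ℝ φ) 2 (vol Ω) := by
    have hs : tsupport (fderiv ℝ φ) ⊆ Ω := (tsupport_fderiv_subset ℝ).trans h3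
    have hs' : Function.support (fderiv ℝ φ) ⊆ Ω := fun x hx => hs (subset_closure hx)
    exact (eLpNorm_restrict_eq_of_forall_notMem fun x hx => by
      by_contra h; exact hx (hs' h)).symm
  have hle : eLpNorm (fderiv ℝ φ) 2 (vol Ω) ≤ ENNReal.ofReal 3 * eLpNorm (jac φ) 2 (vol Ω) :=
    eLpNorm_le_mul_eLpNorm_of_ae_le_mul (Eventually.of_forall fun x =>
      norm_fderiv_le_jac (h1.differentiable (by simp) x)) 2
  calc eLpNorm φ 6 (vol Ω) ≤ eLpNorm φ 6 volume := eLpNorm_mono_measure _ Measure.restrict_le_self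
    _ ≤ c * eLpNorm (fderiv ℝ φ) 2 volume := hc φ (h1.of_le (by norm_cast)) h2
    _ ≤ c * (ENNReal.ofReal 3 * eLpNorm (jac φ) 2 (vol Ω)) := by rw [hsub]; gcongr
    _ = _ := by
      rw [ENNReal.ofReal_mul (by positivity), ENNReal.ofReal_coe_nnreal, mul_assoc]

theorem IsTest.sub {F : Type*} [NormedAddCommGroup F] [NormedSpace ℝ F] {Ω : Set E3}
    {φ ψ : E3 → F} (h : IsTest Ω φ) (h' : IsTest Ω ψ) : IsTest Ω fun x => φ x - ψ x :=
  ⟨h.1.sub h'.1, h.2.1.sub h'.2.1, (tsupport_sub φ ψ).trans (union_subset h.2.2 h'.2.2)⟩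

theorem IsTest.aestronglyMeasurable {F : Type*} [NormedAddCommGroup F] [NormedSpace ℝ F]
    {Ω : Set E3} {φ : E3 → F} (h : IsTest Ω φ) (ν : Measure E3) : AEStronglyMeasurable φ ν :=
  h.1.continuous.aestronglyMeasurable

theorem differentiable_coord {φ : E3 → E3} (h : Differentiable ℝ φ) (i : Fin 3) :
    Differentiable ℝ fun y => φ y i := by
  fun_prop

theorem IsTest.pd {Ω : Set E3} {φ : E3 → ℝ} (h : IsTest Ω φ) (j : Fin 3) :
    IsTest Ω (pd j φ) := by
  refine ⟨?_, h.2.1.fderiv_apply ℝ _, (tsupport_fderiv_apply_subset ℝ _).trans h.2.2⟩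
  have : ContDiff ℝ ∞ (fderiv ℝ φ) := h.1.fderiv_right (by simp)
  exact this.clm_apply contDiff_const

theorem IsTest.memLp {F : Type*} [NormedAddCommGroup F] [NormedSpace ℝ F]
    {Ω : Set E3} {φ : E3 → F} (h : IsTest Ω φ) (p : ℝ≥0∞) (ν : Measure E3)
    [IsFiniteMeasureOnCompacts ν] : MemLp φ p ν :=
  h.1.continuous.memLp_of_hasCompactSupport h.2.1

theorem IsTest.coord {Ω : Set E3} {φ : E3 → E3} (h : IsTest Ω φ) (i : Fin 3) :
    IsTest Ω fun x => φ x i := by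
  refine ⟨?_, ?_, ?_⟩
  · have := h.1; fun_prop
  · exact h.2.1.comp_left (g := fun v : E3 => v i) rfl
  · exact (closure_mono (Function.support_comp_subset (g := fun v : E3 => v i) rfl φ)).trans h.2.2

theorem jac_sub {φ ψ : E3 → E3} (h : Differentiable ℝ φ) (h' : Differentiable ℝ ψ) (x : E3) :
    jac (fun y => φ y - ψ y) x = jac φ x - jac ψ x := by
  ext ⟨i, j⟩
  change fderiv ℝ (fun y => φ y i - ψ y i) x _ = fderiv ℝ (fun y => φ y i) x _ - fderiv ℝ (fun y => ψ y i) x _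
  rw [fderiv_fun_sub (differentiable_coord h i x) (differentiable_coord h' i x)]
  rfl

theorem IsTest.memLp_jac {Ω : Set E3} {φ : E3 → E3} (h : IsTest Ω φ) (p : ℝ≥0∞) (ν : Measure E3)
    [IsFiniteMeasureOnCompacts ν] : MemLp (jac φ) p ν := by
  have := fun ij : Fin 3 × Fin 3 => (((h.coord ij.1).pd ij.2).memLp p ν)
  exact MemLp.of_eval_piLp this

/-- The limits of test fields in `L⁶` whose Jacobians converge in `L²`. -/
theorem memD10_lpTendsto {Ω : Set E3} {v : E3 → E3} {G : E3 → Mat3} (h : MemD10 Ω v G) :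
    ∃ φ : ℕ → E3 → E3, (∀ n, IsTest Ω (φ n)) ∧ LpTendsto 6 (vol Ω) atTop φ v ∧
      LpTendsto 2 (vol Ω) atTop (fun n => jac (φ n)) G := by
  obtain ⟨-, h6, h2, φ, ht, hl6, hl2⟩ := h
  refine ⟨φ, ht, ⟨Eventually.of_forall fun n => (ht n).memLp _ _, h6, hl6.congr fun n => ?_⟩,
    ⟨Eventually.of_forall fun n => (ht n).memLp_jac _ _, h2, hl2.congr fun n => ?_⟩⟩
  · exact eLpNorm_sub_comm v (φ n) 6 _
  · exact eLpNorm_sub_comm G (jac (φ n)) 2 _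

/-- Both bounds pass to the limit from test fields. The bound for differences is stated separately
because it turns time continuity of `∇u` in `L²` into time continuity of `u` in `L⁶`; it follows
from the linearity of the approximation. -/
theorem exists_sobolev : ∃ C : ℝ, 0 ≤ C ∧ ∀ (Ω : Set E3) (v v' : E3 → E3) (G G' : E3 → Mat3),
    MemD10 Ω v G → MemD10 Ω v' G' →
    eLpNorm v 6 (vol Ω) ≤ ENNReal.ofReal C * eLpNorm G 2 (vol Ω) ∧
    eLpNorm (fun x => v x - v' x) 6 (vol Ω)
      ≤ ENNReal.ofReal C * eLpNorm (fun x => G x - G' x) 2 (vol Ω) := by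
  obtain ⟨C, hC0, hC⟩ := exists_sobolev_test
  have lim : ∀ {Ω : Set E3} {v : E3 → E3} {G : E3 → Mat3} {φ : ℕ → E3 → E3},
      (∀ n, IsTest Ω (φ n)) → LpTendsto 6 (vol Ω) atTop φ v →
      LpTendsto 2 (vol Ω) atTop (fun n => jac (φ n)) G →
      eLpNorm v 6 (vol Ω) ≤ ENNReal.ofReal C * eLpNorm G 2 (vol Ω) := by
    intro Ω v G φ ht h6 h2
    have e6 := h6.toReal (by norm_num)
    have e2 := (h2.toReal (by norm_num)).const_mul C
    have : (eLpNorm v 6 (vol Ω)).toReal ≤ C * (eLpNorm G 2 (vol Ω)).toReal := by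
      refine le_of_tendsto_of_tendsto' e6 e2 fun n => ?_
      have := ENNReal.toReal_mono (ENNReal.mul_ne_top ENNReal.ofReal_ne_top
        ((ht n).memLp_jac 2 (vol Ω)).2.ne) (hC Ω _ (ht n))
      rwa [ENNReal.toReal_mul, ENNReal.toReal_ofReal hC0] at this
    rw [← ENNReal.ofReal_toReal h6.lim_mem.2.ne, ← ENNReal.ofReal_toReal h2.lim_mem.2.ne,
      ← ENNReal.ofReal_mul hC0]
    exact ENNReal.ofReal_le_ofReal this
  refine ⟨C, hC0, fun Ω v v' G G' h h' => ?_⟩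
  obtain ⟨φ, ht, h6, h2⟩ := memD10_lpTendsto h
  obtain ⟨φ', ht', h6', h2'⟩ := memD10_lpTendsto h'
  refine ⟨lim ht h6 h2, lim (φ := fun n x => φ n x - φ' n x) (fun n => (ht n).sub (ht' n)) ?_ ?_⟩
  · have := h6.add (by norm_num) (h6'.of_le (f' := fun n x => - φ' n x) (g' := fun x => - v' x)
      h6'.lim_mem.neg (h6'.ev.mono fun n hn => hn.1.neg) 1 (Eventually.of_forall fun n =>
        Eventually.of_forall fun x => by rw [one_mul, ← neg_sub', norm_neg]))
    simpa [sub_eq_add_neg] using this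
  · have := h2.add (by norm_num) (h2'.of_le (f' := fun n x => - jac (φ' n) x)
      (g' := fun x => - G' x)
      h2'.lim_mem.neg (h2'.ev.mono fun n hn => hn.1.neg) 1 (Eventually.of_forall fun n =>
        Eventually.of_forall fun x => by rw [one_mul, ← neg_sub', norm_neg]))
    refine this.congr (Eventually.of_forall fun n => Eventually.of_forall fun x => ?_)
      (Eventually.of_forall fun x => ?_)
    · simp only []
      rw [jac_sub ((ht n).1.differentiable (by simp)) ((ht' n).1.differentiable (by simp)),
        sub_eq_add_neg]
    · simp [sub_eq_add_neg]

end Sobolev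

/-! ### Continuity in time with values in `L^p` -/

section Continuity

variable {F : Type*} [NormedAddCommGroup F] {T : ℝ} {Ω : Set E3} {p : ℝ≥0∞}

theorem ContInLp.lpTendsto {f : ℝ → E3 → F} (h : ContInLp T Ω p f) {s : ℝ} (hs : s ∈ Ico 0 T) :
    LpTendsto p (vol Ω) (𝓝[Ico 0 T] s) f (f s) :=
  ⟨by filter_upwards [self_mem_nhdsWithin] with t ht using h.1 t ht, h.1 s hs, h.2 s hs⟩

theorem contInLp_of_lpTendsto {f : ℝ → E3 → F}
    (h : ∀ s ∈ Ico 0 T, LpTendsto p (vol Ω) (𝓝[Ico 0 T] s) f (f s)) : ContInLp T Ω p f :=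
  ⟨fun t ht => (h t ht).lim_mem, fun s hs => (h s hs).lim⟩

theorem eventually_ico {P : ℝ → Prop} {s : ℝ} (h : ∀ t ∈ Ico 0 T, P t) :
    ∀ᶠ t in 𝓝[Ico 0 T] s, P t := by
  filter_upwards [self_mem_nhdsWithin] with t ht using h t ht

theorem ContInLp.of_le {E : Type*} [NormedAddCommGroup E] {f : ℝ → E3 → F} {f' : ℝ → E3 → E}
    (h : ContInLp T Ω p f) (hm : ∀ t ∈ Ico 0 T, MemLp (f' t) p (vol Ω)) (C : ℝ)
    (hle : ∀ t ∈ Ico 0 T, ∀ s ∈ Ico 0 T, ∀ᵐ x ∂(vol Ω), ‖f' t x - f' s x‖ ≤ C * ‖f t x - f s x‖) :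
    ContInLp T Ω p f' :=
  contInLp_of_lpTendsto fun s hs => (h.lpTendsto hs).of_le (hm s hs)
    (eventually_ico fun t ht => (hm t ht).1) C (eventually_ico fun t ht => hle t ht s hs)

theorem ContInLp.coord {ι : Type*} [Fintype ι] {f : ℝ → E3 → EuclideanSpace ℝ ι}
    (h : ContInLp T Ω p f) (i : ι) : ContInLp T Ω p fun t x => f t x i := by
  refine h.of_le (fun t ht => ?_) 1 fun t _ s _ => Eventually.of_forall fun x => ?_
  · exact (h.1 t ht).eval_piLp i
  · rw [one_mul]
    exact PiLp.norm_apply_le (f t x - f s x) i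

theorem LpTendsto.coord {β ι κ : Type*} [MeasurableSpace β] {ν : Measure β} {l : Filter κ}
    [Fintype ι] {f : κ → β → EuclideanSpace ℝ ι} {g : β → EuclideanSpace ℝ ι}
    (h : LpTendsto p ν l f g) (i : ι) : LpTendsto p ν l (fun n x => f n x i) fun x => g x i := by
  refine h.of_le (h.lim_mem.eval_piLp i) (h.ev.mono fun n hn => (hn.eval_piLp i).1) 1
    (Eventually.of_forall fun n => Eventually.of_forall fun x => ?_)
  rw [one_mul]
  exact PiLp.norm_apply_le (f n x - g x) i

theorem ContInLp.mul {q r : ℝ≥0∞} [ENNReal.HolderTriple p q r] (hr : 1 ≤ r) {f g : ℝ → E3 → ℝ}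
    (hf : ContInLp T Ω p f) (hg : ContInLp T Ω q g) : ContInLp T Ω r fun t x => f t x * g t x :=
  contInLp_of_lpTendsto fun _ hs => (hf.lpTendsto hs).mul hr (hg.lpTendsto hs)

theorem ContInLp.add (hp : 1 ≤ p) {f g : ℝ → E3 → ℝ}
    (hf : ContInLp T Ω p f) (hg : ContInLp T Ω p g) : ContInLp T Ω p fun t x => f t x + g t x :=
  contInLp_of_lpTendsto fun _ hs => (hf.lpTendsto hs).add hp (hg.lpTendsto hs)

theorem ContInLp.sub (hp : 1 ≤ p) {f g : ℝ → E3 → ℝ}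
    (hf : ContInLp T Ω p f) (hg : ContInLp T Ω p g) : ContInLp T Ω p fun t x => f t x - g t x :=
  contInLp_of_lpTendsto fun _ hs => (hf.lpTendsto hs).sub hp (hg.lpTendsto hs)

theorem ContInLp.const_mul {f : ℝ → E3 → ℝ} (c : ℝ)
    (hf : ContInLp T Ω p f) : ContInLp T Ω p fun t x => c * f t x :=
  contInLp_of_lpTendsto fun _ hs => (hf.lpTendsto hs).const_mul c

theorem ContInLp.sum {β : Type*} (s : Finset β) (hp : 1 ≤ p) {f : β → ℝ → E3 → ℝ}
    (hf : ∀ b ∈ s, ContInLp T Ω p (f b)) : ContInLp T Ω p fun t x => ∑ b ∈ s, f b t x :=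
  contInLp_of_lpTendsto fun _ hs => LpTendsto.sum s hp fun b hb => (hf b hb).lpTendsto hs

theorem ContInLp.continuousOn_integral_mul {q : ℝ≥0∞} [ENNReal.HolderTriple p q 1]
    {f : ℝ → E3 → ℝ} (hf : ContInLp T Ω p f) {g : E3 → ℝ} (hg : MemLp g q (vol Ω)) :
    ContinuousOn (fun t => ∫ x in Ω, f t x * g x) (Ico 0 T) :=
  fun _ hs => (hf.lpTendsto hs).integral_mul (LpTendsto.const hg)

theorem contInLp_velocity {u : ℝ → E3 → E3} {Du : ℝ → E3 → Mat3}
    (h : ∀ t ∈ Ico 0 T, MemD10 Ω (u t) (Du t)) (hc : ContInLp T Ω 2 Du) : ContInLp T Ω 6 u := by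
  obtain ⟨C, hC0, hC⟩ := exists_sobolev
  refine ⟨fun t ht => (h t ht).2.1, fun s hs => ?_⟩
  have hz : Tendsto (fun t => ENNReal.ofReal C * eLpNorm (fun x => Du t x - Du s x) 2 (vol Ω))
      (𝓝[Ico 0 T] s) (𝓝 0) := by
    simpa using ENNReal.Tendsto.const_mul (hc.2 s hs) (Or.inr ENNReal.ofReal_ne_top)
  exact tendsto_of_tendsto_of_tendsto_of_le_of_le' tendsto_const_nhds hz
    (Eventually.of_forall fun _ => zero_le) (eventually_ico fun t ht =>
      (hC Ω _ _ _ _ (h t ht) (h s hs)).2)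

/-- An essential bound in time holds at every time, by continuity in `L²`. -/
theorem ContInLp.ae_le_of_normLinfLp {ρ : ℝ → E3 → ℝ} (h : ContInLp T Ω 2 ρ) {M : ℝ} (hM : 0 ≤ M)
    (hb : normLinfLp T Ω ⊤ ρ ≤ ENNReal.ofReal M) {t : ℝ} (ht : t ∈ Ico 0 T) :
    ∀ᵐ x ∂(vol Ω), ρ t x ≤ M := by
  have hae : ∀ᵐ s ∂(volume.restrict (Ioo 0 T)), eLpNorm (ρ s) ⊤ (vol Ω) ≤ ENNReal.ofReal M := by
    filter_upwards [ENNReal.ae_le_essSup (fun s => eLpNorm (ρ s) ⊤ (vol Ω))] with s hs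
    exact hs.trans hb
  -- Every right neighbourhood of `t` has positive measure, so it meets the full-measure set of good
  -- times. This gives good times `sₙ → t`, along which the bound passes to the limit.
  rw [ae_restrict_iff' measurableSet_Ioo] at hae
  have hex : ∀ n : ℕ, ∃ s ∈ Ico 0 T, |s - t| < 1 / (n + 1) ∧
      eLpNorm (ρ s) ⊤ (vol Ω) ≤ ENNReal.ofReal M := by
    intro n
    have hlt : t < min T (t + 1 / (n + 1)) := lt_min ht.2 (by
      have : (0 : ℝ) < 1 / (n + 1) := by positivity
      linarith)
    have hpos : 0 < volume (Ioo t (min T (t + 1 / (n + 1)))) := by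
      rw [Real.volume_Ioo, ENNReal.ofReal_pos]; linarith
    obtain ⟨s, hs, hs'⟩ := ((frequently_ae_mem_iff.2 hpos.ne').and_eventually hae).exists
    have h1 := hs.2.trans_le (min_le_left _ _)
    have h2 := hs.2.trans_le (min_le_right _ _)
    refine ⟨s, ⟨ht.1.trans hs.1.le, h1⟩, ?_, hs' ⟨ht.1.trans_lt hs.1, h1⟩⟩
    rw [abs_of_pos (by linarith [hs.1])]
    linarith
  choose s hs1 hs2 hs3 using hex
  have hs : Tendsto s atTop (𝓝[Ico 0 T] t) := by
    refine tendsto_nhdsWithin_iff.2 ⟨?_, Eventually.of_forall hs1⟩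
    refine tendsto_iff_dist_tendsto_zero.2 (squeeze_zero (fun _ => dist_nonneg)
      (fun n => (hs2 n).le) tendsto_one_div_add_atTop_nhds_zero_nat)
  refine ((h.lpTendsto ht).comp_tendsto hs).ae_le (by norm_num) (fun n => (h.1 _ (hs1 n)).1) M
    fun n => ?_
  have hess : ∀ᵐ x ∂(vol Ω), ‖ρ (s n) x‖ₑ ≤ ENNReal.ofReal M := by
    filter_upwards [ae_le_eLpNormEssSup (f := ρ (s n)) (μ := vol Ω)] with x hx
    exact hx.trans (eLpNorm_exponent_top (f := ρ (s n)) (μ := vol Ω) ▸ hs3 n)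
  filter_upwards [hess] with x hx
  rw [← ofReal_norm, ENNReal.ofReal_le_ofReal_iff hM] at hx
  exact (le_abs_self _).trans hx

/-- Boundedness of `ρ` upgrades `L²` to `L⁶`, so that `ρu` lies in `L³` and `ρuᵢuⱼ` in `L²`, the
integrability of `∇u`. -/
theorem ContInLp.density_six {ρ : ℝ → E3 → ℝ} (h : ContInLp T Ω 2 ρ) {M : ℝ}
    (hb : ∀ t ∈ Ico 0 T, ∀ᵐ x ∂(vol Ω), 0 ≤ ρ t x ∧ ρ t x ≤ M) : ContInLp T Ω 6 ρ := by
  have hb' : ∀ t ∈ Ico 0 T, ∀ᵐ x ∂(vol Ω), |ρ t x| ≤ M := fun t ht => by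
    filter_upwards [hb t ht] with x hx
    rw [abs_of_nonneg hx.1]; exact hx.2
  exact contInLp_of_lpTendsto fun s hs =>
    (h.lpTendsto hs).six_of_two M (eventually_ico hb') (hb' s hs)

theorem abs_rpow_sub_rpow_le {γ M x y : ℝ} (hγ : 1 ≤ γ) (hx : 0 ≤ x ∧ x ≤ M)
    (hy : 0 ≤ y ∧ y ≤ M) : |x ^ γ - y ^ γ| ≤ γ * M ^ (γ - 1) * |x - y| := by
  have hd : ∀ z ∈ Icc 0 M, HasDerivWithinAt (fun z : ℝ => z ^ γ) (γ * z ^ (γ - 1)) (Icc 0 M) z :=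
    fun z _ => (Real.hasDerivAt_rpow_const (Or.inr hγ)).hasDerivWithinAt
  have := Convex.norm_image_sub_le_of_norm_hasDerivWithin_le hd (C := γ * M ^ (γ - 1))
    (fun z hz => by
      rw [Real.norm_eq_abs, abs_of_nonneg (mul_nonneg (by linarith) (Real.rpow_nonneg hz.1 _))]
      exact mul_le_mul_of_nonneg_left (Real.rpow_le_rpow hz.1 hz.2 (by linarith)) (by linarith))
    (convex_Icc 0 M) hy hx
  simpa using this

/-- On `[0, M]` the map `z ↦ z^γ` is Lipschitz because `γ > 1`, so the pressure inherits continuity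
in `L²` from the density. -/
theorem ContInLp.density_rpow {ρ : ℝ → E3 → ℝ} (h : ContInLp T Ω 2 ρ) {M γ : ℝ} (hγ : 1 < γ)
    (hb : ∀ t ∈ Ico 0 T, ∀ᵐ x ∂(vol Ω), 0 ≤ ρ t x ∧ ρ t x ≤ M) :
    ContInLp T Ω 2 fun t x => ρ t x ^ γ := by
  refine h.of_le (fun t ht => ?_) (γ * M ^ (γ - 1)) fun t ht s hs => ?_
  · refine (h.1 t ht).of_le_mul (c := γ * M ^ (γ - 1))
      ((Real.continuous_rpow_const (by linarith)).comp_aestronglyMeasurable (h.1 t ht).1) ?_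
    filter_upwards [hb t ht] with x hx
    have := abs_rpow_sub_rpow_le hγ.le hx ⟨le_rfl, hx.1.trans hx.2⟩
    simpa [Real.zero_rpow (by linarith : γ ≠ 0)] using this
  · filter_upwards [hb t ht, hb s hs] with x h1 h2
    exact abs_rpow_sub_rpow_le hγ.le h1 h2

end Continuity

/-! ### From distributional to classical time derivatives -/

section DuBoisReymond

/-- A test function on the line with vanishing integral is the derivative of a test function. -/
theorem exists_primitive_test {c d : ℝ} {h : ℝ → ℝ} (h1 : ContDiff ℝ ∞ h)
    (h2 : HasCompactSupport h) (h3 : tsupport h ⊆ Ioo c d) (h0 : ∫ t in c..d, h t = 0) :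
    ∃ η : ℝ → ℝ, ContDiff ℝ ∞ η ∧ HasCompactSupport η ∧ tsupport η ⊆ Ioo c d ∧
      ∀ t, HasDerivAt η (h t) t := by
  obtain ⟨c', d', hc, hd, hK⟩ : ∃ c' d', c < c' ∧ d' < d ∧ tsupport h ⊆ Icc c' d' := by
    rcases (tsupport h).eq_empty_or_nonempty with he | hne
    · exact ⟨c + 1, d - 1, by linarith, by linarith, by simp [he]⟩
    · obtain ⟨a, ha, hmin⟩ := IsCompact.exists_isMinOn h2 hne continuousOn_id
      obtain ⟨b, hb, hmax⟩ := IsCompact.exists_isMaxOn h2 hne continuousOn_id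
      exact ⟨a, b, (h3 ha).1, (h3 hb).2, fun x hx => ⟨hmin hx, hmax hx⟩⟩
  -- The primitive vanishes to the left of the support trivially, and to the right because the total
  -- integral is zero.
  have hz : ∀ t, t ∉ Icc c' d' → h t = 0 := fun t ht =>
    image_eq_zero_of_notMem_tsupport fun hk => ht (hK hk)
  have hcont := h1.continuous
  have hder : ∀ t, HasDerivAt (fun t => ∫ s in c..t, h s) (h t) t := fun t =>
    intervalIntegral.integral_hasDerivAt_right (hcont.intervalIntegrable _ _)
      (hcont.stronglyMeasurableAtFilter _ _) hcont.continuousAt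
  have hsupp : Function.support (fun t => ∫ s in c..t, h s) ⊆ Icc c' d' := by
    intro t ht
    by_contra hn
    refine ht ?_
    rw [mem_Icc, not_and_or, not_le, not_le] at hn
    rcases hn with hn | hn
    · refine (intervalIntegral.integral_congr (g := fun _ => (0 : ℝ)) fun s hs => ?_).trans (by simp)
      refine hz s fun hs' => ?_
      rcases le_total c t with hct | hct
      · rw [uIcc_of_le hct] at hs; linarith [hs.2, hs'.1]
      · rw [uIcc_of_ge hct] at hs; linarith [hs.2, hs'.1]
    · have := intervalIntegral.integral_add_adjacent_intervals
        (hcont.intervalIntegrable (μ := volume) c t) (hcont.intervalIntegrable t d)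
      rw [h0] at this
      have hz' : ∫ s in t..d, h s = 0 := by
        refine (intervalIntegral.integral_congr (g := fun _ => (0 : ℝ)) fun s hs => ?_).trans
          (by simp)
        refine hz s fun hs' => ?_
        rcases le_total t d with hct | hct
        · rw [uIcc_of_le hct] at hs; linarith [hs.1, hs'.2]
        · rw [uIcc_of_ge hct] at hs; linarith [hs.1, hs'.2]
      simpa [hz'] using this
  have hts : tsupport (fun t => ∫ s in c..t, h s) ⊆ Icc c' d' :=
    closure_minimal hsupp isClosed_Icc
  refine ⟨fun t => ∫ s in c..t, h s, ?_, HasCompactSupport.of_support_subset_isCompact isCompact_Icc hsupp, ?_, hder⟩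
  · rw [contDiff_infty_iff_deriv]
    refine ⟨fun t => (hder t).differentiableAt, ?_⟩
    rwa [show deriv (fun t => ∫ s in c..t, h s) = h from funext fun t => (hder t).deriv]
  · exact hts.trans fun t ht => ⟨hc.trans_le ht.1, ht.2.trans_lt hd⟩

/-- The lemma of du Bois-Reymond for continuous functions. -/
theorem exists_const_of_integral_deriv_eq_zero {c d : ℝ} (hcd : c < d) {D : ℝ → ℝ}
    (hD : ContinuousOn D (Icc c d))
    (h : ∀ η : ℝ → ℝ, ContDiff ℝ ∞ η → HasCompactSupport η → tsupport η ⊆ Ioo c d →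
      ∫ t in c..d, D t * deriv η t = 0) : ∃ k, ∀ t ∈ Ioo c d, D t = k := by
  -- Subtracting the multiple of this unit-mass bump given by its integral from any test function
  -- leaves one of zero mean, hence the derivative of a test function. The constant sought is
  -- therefore the pairing of `D` with `θ`.
  obtain ⟨θ, hθ1, hθ2, hθ3, hθ4⟩ : ∃ θ : ℝ → ℝ, ContDiff ℝ ∞ θ ∧ HasCompactSupport θ ∧
      tsupport θ ⊆ Ioo c d ∧ ∫ t in c..d, θ t = 1 := by
    let b : ContDiffBump ((c + d) / 2) := ⟨(d - c) / 8, (d - c) / 4, by linarith, by linarith⟩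
    have hts : tsupport (b.normed volume) ⊆ Ioo c d := by
      rw [b.tsupport_normed_eq, Real.closedBall_eq_Icc]
      intro t ht
      change _ - (d - c) / 4 ≤ t ∧ t ≤ _ + (d - c) / 4 at ht
      constructor <;> linarith [ht.1, ht.2]
    refine ⟨b.normed volume, b.contDiff_normed, b.hasCompactSupport_normed, hts, ?_⟩
    rw [intervalIntegral.integral_of_le hcd.le, ← b.integral_normed (μ := volume)]
    refine setIntegral_eq_integral_of_forall_compl_eq_zero fun t ht => ?_
    exact image_eq_zero_of_notMem_tsupport fun hk => ht (Ioo_subset_Ioc_self (hts hk))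
  set k := ∫ t in c..d, D t * θ t
  have hDi : IntervalIntegrable D volume c d := hD.intervalIntegrable_of_Icc hcd.le
  have key : ∀ g : ℝ → ℝ, ContDiff ℝ ∞ g → HasCompactSupport g → tsupport g ⊆ Ioo c d →
      ∫ t, g t • (Ioo c d).indicator (fun t => D t - k) t = 0 := by
    intro g hg1 hg2 hg3
    set m := ∫ t in c..d, g t
    have hi : ∀ f : ℝ → ℝ, ContDiff ℝ ∞ f → IntervalIntegrable f volume c d :=
      fun f hf => hf.continuous.intervalIntegrable _ _
    have hi' : ∀ f : ℝ → ℝ, ContDiff ℝ ∞ f → IntervalIntegrable (fun t => D t * f t) volume c d :=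
      fun f hf => hDi.mul_continuousOn hf.continuous.continuousOn
    have hmθ : ContDiff ℝ ∞ fun t => m * θ t := contDiff_const.mul hθ1
    obtain ⟨η, e1, e2, e3, e4⟩ := exists_primitive_test (h := fun t => g t - m * θ t)
      (hg1.sub hmθ) (hg2.sub hθ2.mul_left)
      ((tsupport_sub g _).trans (union_subset hg3
        ((closure_mono (Function.support_mul_subset_right (fun _ => m) θ)).trans hθ3)))
      (by rw [intervalIntegral.integral_sub (hi _ hg1) (hi _ hmθ),
            intervalIntegral.integral_const_mul, hθ4]; simp [m])
    have h5 := h η e1 e2 e3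
    have h6 : ∀ t, D t * deriv η t = D t * g t - m * (D t * θ t) := fun t => by
      rw [(e4 t).deriv]; ring
    simp_rw [h6] at h5
    rw [intervalIntegral.integral_sub (hi' g hg1) ((hi' θ hθ1).const_mul m),
      intervalIntegral.integral_const_mul] at h5
    have h7 : ∫ t, g t • (Ioo c d).indicator (fun t => D t - k) t
        = ∫ t in c..d, (D t * g t - k * g t) := by
      rw [intervalIntegral.integral_of_le hcd.le, integral_Ioc_eq_integral_Ioo,
        ← integral_indicator measurableSet_Ioo]
      refine integral_congr_ae (Eventually.of_forall fun t => ?_)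
      by_cases ht : t ∈ Ioo c d <;> simp [ht]
      ring
    rw [h7, intervalIntegral.integral_sub (hi' g hg1) ((hi g hg1).const_mul k),
      intervalIntegral.integral_const_mul]
    linarith
  have hloc : LocallyIntegrableOn ((Ioo c d).indicator fun t => D t - k) (Ioo c d) := by
    refine IntegrableOn.locallyIntegrableOn ?_
    refine IntegrableOn.congr_fun (f := fun t => D t - k) ?_ (fun t ht => by simp [ht])
      measurableSet_Ioo
    exact ((hD.sub continuousOn_const).integrableOn_Icc).mono_set Ioo_subset_Icc_self
  have hae := isOpen_Ioo.ae_eq_zero_of_integral_contDiff_smul_eq_zero hloc key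
  have hae' : D =ᵐ[volume.restrict (Ioo c d)] fun _ => k := by
    rw [EventuallyEq, ae_restrict_iff' measurableSet_Ioo]
    filter_upwards [hae] with t ht htm
    have := ht htm
    simp only [htm, indicator_of_mem] at this
    linarith
  refine ⟨k, fun t ht => ?_⟩
  exact Measure.eqOn_open_of_ae_eq hae' isOpen_Ioo (hD.mono Ioo_subset_Icc_self)
    continuousOn_const ht

/-- A continuous distributional derivative of a continuous function is a classical one. -/
theorem hasDerivAt_of_weak {T : ℝ} {A B : ℝ → ℝ} (hA : ContinuousOn A (Ioo 0 T))
    (hB : ContinuousOn B (Ioo 0 T))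
    (h : ∀ η : ℝ → ℝ, ContDiff ℝ ∞ η → HasCompactSupport η → tsupport η ⊆ Ioo 0 T →
      ∫ t in Ioo 0 T, (A t * deriv η t + B t * η t) = 0) {t : ℝ} (ht : t ∈ Ioo 0 T) :
    HasDerivAt A (B t) t := by
  obtain ⟨c, hc0, hct⟩ := exists_between ht.1
  obtain ⟨d, htd, hdT⟩ := exists_between ht.2
  have hcd := hct.trans htd
  have hsub : Icc c d ⊆ Ioo 0 T := fun x hx => ⟨hc0.trans_le hx.1, hx.2.trans_lt hdT⟩
  have hB' := hB.mono hsub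
  have hA' := hA.mono hsub
  have hBi : IntervalIntegrable B volume c d := hB'.intervalIntegrable_of_Icc hcd.le
  set P : ℝ → ℝ := fun x => ∫ s in c..x, B s
  have hP : ∀ x ∈ Ioo c d, HasDerivAt P (B x) x := by
    intro x hx
    have hnx : Icc c d ∈ 𝓝 x := Icc_mem_nhds hx.1 hx.2
    refine intervalIntegral.integral_hasDerivAt_right (hBi.mono_set ?_) ?_ (hB'.continuousAt hnx)
    · rw [uIcc_of_le hx.1.le, uIcc_of_le hcd.le]; exact Icc_subset_Icc_right hx.2.le
    · exact (hB'.mono Ioo_subset_Icc_self).stronglyMeasurableAtFilter isOpen_Ioo x hx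
  have hPc : ContinuousOn P (Icc c d) := by
    have := intervalIntegral.continuousOn_primitive_interval' hBi (a := c) (by simp)
    rwa [uIcc_of_le hcd.le] at this
  -- On a compact subinterval around `t`, the difference of `A` and the primitive `P` of `B` has
  -- vanishing distributional derivative; integration by parts for `P` is classical.
  obtain ⟨k, hk⟩ := exists_const_of_integral_deriv_eq_zero hcd (D := fun x => A x - P x)
    (hA'.sub hPc) fun η h1 h2 h3 => by
      have hz : ∀ x, x ∉ Ioo c d → η x = 0 := fun x hx =>
        image_eq_zero_of_notMem_tsupport fun hk => hx (h3 hk)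
      have hz' : ∀ x, x ∉ Ioo c d → deriv η x = 0 := fun x hx => by
        by_contra hne
        exact hx (h3 (support_deriv_subset hne))
      have hηc := h1.continuous
      have hηc' : Continuous (deriv η) := h1.continuous_deriv (by simp)
      have hηd : ∀ x, HasDerivAt η (deriv η x) x := fun x =>
        (h1.differentiable (by simp) x).hasDerivAt
      have e1 : ∫ x in c..d, (A x * deriv η x + B x * η x) = 0 := by
        rw [← h η h1 h2 (h3.trans (Ioo_subset_Icc_self.trans hsub)),
          intervalIntegral.integral_of_le hcd.le]
        rw [integral_Ioc_eq_integral_Ioo]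
        refine (setIntegral_eq_of_subset_of_forall_sdiff_eq_zero measurableSet_Ioo
          (Ioo_subset_Icc_self.trans hsub) fun x hx => ?_).symm
        rw [hz x hx.2, hz' x hx.2]; simp
      have e2 : ∫ x in c..d, (B x * η x + P x * deriv η x) = 0 := by
        rw [intervalIntegral.integral_eq_sub_of_hasDeriv_right_of_le hcd.le
          (f := fun x => P x * η x) (hPc.mul hηc.continuousOn)
          (fun x hx => ((hP x hx).mul (hηd x)).hasDerivWithinAt)]
        · rw [hz c (by simp), hz d (by simp)]; simp
        · exact ((hB'.mul hηc.continuousOn).add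
            (hPc.mul hηc'.continuousOn)).intervalIntegrable_of_Icc hcd.le
      have i1 : IntervalIntegrable (fun x => A x * deriv η x + B x * η x) volume c d :=
        ((hA'.mul hηc'.continuousOn).add (hB'.mul hηc.continuousOn)).intervalIntegrable_of_Icc
          hcd.le
      have i2 : IntervalIntegrable (fun x => B x * η x + P x * deriv η x) volume c d :=
        ((hB'.mul hηc.continuousOn).add (hPc.mul hηc'.continuousOn)).intervalIntegrable_of_Icc
          hcd.le
      have e3 := intervalIntegral.integral_sub i1 i2
      rw [e1, e2, sub_zero] at e3
      rw [← e3]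
      refine intervalIntegral.integral_congr fun x _ => ?_
      ring
  have : A =ᶠ[𝓝 t] fun x => P x + k := by
    filter_upwards [Ioo_mem_nhds hct htd] with x hx
    linarith [hk x hx]
  exact ((hP t ⟨hct, htd⟩).add_const k).congr_of_eventuallyEq this

end DuBoisReymond

/-! ### Time derivatives of spatial pairings -/

section WeakTimeDerivative

theorem isSpaceTimeTest_mul {T : ℝ} {Ω : Set E3} {η : ℝ → ℝ} {ψ : E3 → ℝ} (h1 : ContDiff ℝ ∞ η)
    (h2 : HasCompactSupport η) (h3 : tsupport η ⊆ Ioo 0 T) (hψ : IsTest Ω ψ) :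
    IsSpaceTimeTest T Ω fun t x => η t * ψ x := by
  have hs : Function.support (Function.uncurry fun t x => η t * ψ x) ⊆ tsupport η ×ˢ tsupport ψ := by
    rintro ⟨t, x⟩ h
    have h' : η t * ψ x ≠ 0 := h
    exact ⟨subset_tsupport _ (left_ne_zero_of_mul h'), subset_tsupport _ (right_ne_zero_of_mul h')⟩
  have hK : IsCompact (tsupport η ×ˢ tsupport ψ) := IsCompact.prod h2 hψ.2.1
  refine ⟨?_, HasCompactSupport.of_support_subset_isCompact hK hs,
    (closure_minimal hs hK.isClosed).trans (prod_mono h3 hψ.2.2)⟩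
  exact (h1.comp contDiff_fst).mul (hψ.1.comp contDiff_snd)

theorem pd_const_mul {ψ : E3 → ℝ} (h : Differentiable ℝ ψ) (c : ℝ) (j : Fin 3) (x : E3) :
    pd j (fun y => c * ψ y) x = c * pd j ψ x := by
  unfold pd
  rw [fderiv_const_mul (h x)]
  rfl

variable {Ω : Set E3} {μ lam a γ q T M : ℝ} {ρ : ℝ → E3 → ℝ} {u : ℝ → E3 → E3}
  {Dρ : ℝ → E3 → E3} {Du : ℝ → E3 → Mat3} {D2u : ℝ → E3 → Tens3}

/-- The momentum flux `ρuᵢuⱼ - μ∂ⱼuᵢ - (μ + lam) div u δᵢⱼ + p δᵢⱼ`. -/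
noncomputable def flux (μ lam a γ : ℝ) (ρ : ℝ → E3 → ℝ) (u : ℝ → E3 → E3) (Du : ℝ → E3 → Mat3)
    (i j : Fin 3) (t : ℝ) (x : E3) : ℝ :=
  ρ t x * u t x i * u t x j - μ * Du t x (i, j) +
    if i = j then a * ρ t x ^ γ - (μ + lam) * ∑ k, Du t x (k, k) else 0

theorem IsStrongSolution.contInLp_u (h : IsStrongSolution Ω μ lam a γ q T ρ u Dρ Du D2u) :
    ContInLp T Ω 6 u :=
  contInLp_velocity h.memD10 h.contDu

theorem IsStrongSolution.contInLp_momentum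
    (h : IsStrongSolution Ω μ lam a γ q T ρ u Dρ Du D2u)
    (hb : ∀ t ∈ Ico 0 T, ∀ᵐ x ∂(vol Ω), 0 ≤ ρ t x ∧ ρ t x ≤ M) (i : Fin 3) :
    ContInLp T Ω 3 fun t x => ρ t x * u t x i :=
  (h.contρ_two.density_six hb).mul (by norm_num) (h.contInLp_u.coord i)

theorem IsStrongSolution.contInLp_convection
    (h : IsStrongSolution Ω μ lam a γ q T ρ u Dρ Du D2u)
    (hb : ∀ t ∈ Ico 0 T, ∀ᵐ x ∂(vol Ω), 0 ≤ ρ t x ∧ ρ t x ≤ M) (i j : Fin 3) :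
    ContInLp T Ω 2 fun t x => ρ t x * u t x i * u t x j := by
  have := (h.contInLp_u.coord j).mul (r := 2) (by norm_num) (h.contInLp_momentum hb i)
  simpa only [mul_comm] using this

theorem IsStrongSolution.contInLp_flux (hγ : 1 < γ)
    (h : IsStrongSolution Ω μ lam a γ q T ρ u Dρ Du D2u)
    (hb : ∀ t ∈ Ico 0 T, ∀ᵐ x ∂(vol Ω), 0 ≤ ρ t x ∧ ρ t x ≤ M) (i j : Fin 3) :
    ContInLp T Ω 2 (flux μ lam a γ ρ u Du i j) := by
  have h1 := (h.contInLp_convection hb i j).sub (by norm_num) ((h.contDu.coord (i, j)).const_mul μ)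
  unfold flux
  by_cases hij : i = j
  · simp only [hij, if_true] at h1 ⊢
    refine h1.add (by norm_num) (((h.contρ_two.density_rpow hγ hb).const_mul a).sub (by norm_num) ?_)
    exact (ContInLp.sum _ (by norm_num) fun k _ => h.contDu.coord (k, k)).const_mul (μ + lam)
  · simpa [hij] using h1

theorem MemLp.integrable_mul_test {p : ℝ≥0∞} (hp : 1 ≤ p) {ν : Measure E3}
    [IsFiniteMeasureOnCompacts ν] {f ψ : E3 → ℝ}
    (hf : MemLp f p ν) (hψ : IsTest Ω ψ) : Integrable (fun x => f x * ψ x) ν := by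
  have : ENNReal.HolderConjugate p (ENNReal.conjExponent p) := .conjExponent hp
  exact hf.integrable_mul (q := ENNReal.conjExponent p) (hψ.memLp _ _)

/-- Test functions `η(t)ψ(x)` reduce the continuity equation to a scalar distributional identity in
time. Both sides are continuous in `t`, so the identity holds classically. -/
theorem IsStrongSolution.hasDerivAt_mass
    (h : IsStrongSolution Ω μ lam a γ q T ρ u Dρ Du D2u)
    (hb : ∀ t ∈ Ico 0 T, ∀ᵐ x ∂(vol Ω), 0 ≤ ρ t x ∧ ρ t x ≤ M) {ψ : E3 → ℝ} (hψ : IsTest Ω ψ)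
    {t : ℝ} (ht : t ∈ Ioo 0 T) :
    HasDerivAt (fun s => ∫ x in Ω, ρ s x * ψ x) (∑ j, ∫ x in Ω, (ρ t x * u t x j) * pd j ψ x) t := by
  have hA : ContinuousOn (fun s => ∫ x in Ω, ρ s x * ψ x) (Ioo 0 T) :=
    (h.contρ_two.continuousOn_integral_mul (hψ.memLp 2 _)).mono Ioo_subset_Ico_self
  have hB : ContinuousOn (fun s => ∑ j, ∫ x in Ω, (ρ s x * u s x j) * pd j ψ x) (Ioo 0 T) :=
    continuousOn_finsetSum _ fun j _ => ((h.contInLp_momentum hb j).continuousOn_integral_mul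
      ((hψ.pd j).memLp (3 / 2) _)).mono Ioo_subset_Ico_self
  refine hasDerivAt_of_weak hA hB (fun η h1 h2 h3 => ?_) ht
  refine Eq.trans ?_ (h.continuity _ (isSpaceTimeTest_mul h1 h2 h3 hψ))
  refine setIntegral_congr_fun measurableSet_Ioo fun s hs => ?_
  have hs' := Ioo_subset_Ico_self hs
  have hd : ∀ x, deriv (fun r => η r * ψ x) s = deriv η s * ψ x := fun x =>
    deriv_mul_const (h1.differentiable (by simp) s) _
  simp only [hd, pd_const_mul (hψ.1.differentiable (by simp))]
  have i1 := MemLp.integrable_mul_test (p := 2) (by norm_num) (h.contρ_two.1 s hs') hψ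
  have i2 := fun j => MemLp.integrable_mul_test (p := 3) (by norm_num)
    ((h.contInLp_momentum hb j).1 s hs') (hψ.pd j)
  have : ∀ x, ρ s x * (deriv η s * ψ x) + ∑ j, ρ s x * u s x j * (η s * pd j ψ x)
      = deriv η s * (ρ s x * ψ x) + ∑ j, η s * (ρ s x * u s x j * pd j ψ x) := by
    intro x
    congr 1
    · ring
    · exact Finset.sum_congr rfl fun j _ => by ring
  simp_rw [this]
  rw [integral_add (i1.const_mul _) (integrable_finsetSum _ fun j _ => (i2 j).const_mul _),
    integral_finsetSum _ fun j _ => (i2 j).const_mul _]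
  simp_rw [integral_const_mul]
  rw [← Finset.mul_sum]
  ring

/-- As for the mass, after one integration by parts puts the viscous term in divergence form. The
rate then involves only first derivatives of `ψ`, so `ψ` may later approach fields whose gradients
are merely in `L²`. -/
theorem IsStrongSolution.hasDerivAt_momentum (hγ : 1 < γ)
    (h : IsStrongSolution Ω μ lam a γ q T ρ u Dρ Du D2u)
    (hb : ∀ t ∈ Ico 0 T, ∀ᵐ x ∂(vol Ω), 0 ≤ ρ t x ∧ ρ t x ≤ M) (i : Fin 3) {ψ : E3 → ℝ}
    (hψ : IsTest Ω ψ) {t : ℝ} (ht : t ∈ Ioo 0 T) :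
    HasDerivAt (fun s => ∫ x in Ω, (ρ s x * u s x i) * ψ x)
      (∑ j, ∫ x in Ω, flux μ lam a γ ρ u Du i j t x * pd j ψ x) t := by
  have hA : ContinuousOn (fun s => ∫ x in Ω, (ρ s x * u s x i) * ψ x) (Ioo 0 T) :=
    ((h.contInLp_momentum hb i).continuousOn_integral_mul (hψ.memLp (3 / 2) _)).mono
      Ioo_subset_Ico_self
  have hB : ContinuousOn (fun s => ∑ j, ∫ x in Ω, flux μ lam a γ ρ u Du i j s x * pd j ψ x)
      (Ioo 0 T) :=
    continuousOn_finsetSum _ fun j _ => ((h.contInLp_flux hγ hb i j).continuousOn_integral_mul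
      ((hψ.pd j).memLp 2 _)).mono Ioo_subset_Ico_self
  refine hasDerivAt_of_weak hA hB (fun η h1 h2 h3 => ?_) ht
  refine Eq.trans ?_ (h.momentum i _ (isSpaceTimeTest_mul h1 h2 h3 hψ))
  refine setIntegral_congr_fun measurableSet_Ioo fun s hs => ?_
  have hs' := Ioo_subset_Ico_self hs
  have hd : ∀ x, deriv (fun r => η r * ψ x) s = deriv η s * ψ x := fun x =>
    deriv_mul_const (h1.differentiable (by simp) s) _
  simp only [hd, pd_const_mul (hψ.1.differentiable (by simp))]
  have two : (1 : ℝ≥0∞) ≤ 2 := by norm_num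
  have i1 : Integrable (fun x => ρ s x * u s x i * ψ x) (vol Ω) :=
    MemLp.integrable_mul_test (p := 3) (by norm_num) ((h.contInLp_momentum hb i).1 s hs') hψ
  have i2 : ∀ j, Integrable (fun x => ρ s x * u s x i * u s x j * pd j ψ x) (vol Ω) := fun j => MemLp.integrable_mul_test two ((h.contInLp_convection hb i j).1 s hs')
    (hψ.pd j)
  have i3 := fun k l m => MemLp.integrable_mul_test two ((h.contD2u.1 s hs').eval_piLp (k, l, m)) hψ
  have i4 := fun k l m => MemLp.integrable_mul_test two ((h.contDu.1 s hs').eval_piLp (k, l))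
    (hψ.pd m)
  have i5 : Integrable (fun x => ρ s x ^ γ * pd i ψ x) (vol Ω) := MemLp.integrable_mul_test two ((h.contρ_two.density_rpow hγ hb).1 s hs') (hψ.pd i)
  -- The only use of the second derivatives: they are moved onto the test function, so that no bound
  -- for them enters the estimate.
  have parts : ∀ k l m, ∫ x in Ω, D2u s x (k, l, m) * ψ x = - ∫ x in Ω, Du s x (k, l) * pd m ψ x :=
    fun k l m => by rw [(h.hessu s hs' k l m).2.2 ψ hψ, neg_neg]
  have hl : ∀ x, ρ s x * u s x i * (deriv η s * ψ x)
      + ∑ j, ρ s x * u s x i * u s x j * (η s * pd j ψ x)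
      + lame μ lam (D2u s x) i * (η s * ψ x) + a * ρ s x ^ γ * (η s * pd i ψ x)
      = deriv η s * (ρ s x * u s x i * ψ x)
      + η s * (∑ j, ρ s x * u s x i * u s x j * pd j ψ x
        + (μ * (∑ j, D2u s x (i, j, j) * ψ x) + (μ + lam) * ∑ j, D2u s x (j, j, i) * ψ x)
        + a * (ρ s x ^ γ * pd i ψ x)) := by
    intro x
    simp only [lame, Fin.sum_univ_three]
    ring
  have hr : ∀ j x, flux μ lam a γ ρ u Du i j s x * pd j ψ x =
      (ρ s x * u s x i * u s x j * pd j ψ x - μ * (Du s x (i, j) * pd j ψ x)) +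
      if i = j then a * (ρ s x ^ γ * pd i ψ x) - (μ + lam) * ∑ k, Du s x (k, k) * pd i ψ x
        else 0 := by
    intro j x
    unfold flux
    by_cases hij : i = j
    · simp only [hij, if_true, Fin.sum_univ_three]; ring
    · simp only [hij, if_false]; ring
  have i6 : Integrable (fun x => a * (ρ s x ^ γ * pd i ψ x)
      - (μ + lam) * ∑ k, Du s x (k, k) * pd i ψ x) (vol Ω) :=
    (i5.const_mul a).sub ((integrable_finsetSum _ fun k _ => i4 k k i).const_mul _)
  have i7 : ∀ j, Integrable (fun x => if i = j then a * (ρ s x ^ γ * pd i ψ x)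
      - (μ + lam) * ∑ k, Du s x (k, k) * pd i ψ x else 0) (vol Ω) := fun j => by
    by_cases hij : i = j
    · simpa only [hij, if_true] using i6
    · simp only [hij, if_false]; exact integrable_zero _ _ _
  simp_rw [hl, hr]
  have c1 := integrable_finsetSum (μ := vol Ω) Finset.univ fun j _ => i2 j
  have c2 := (integrable_finsetSum (μ := vol Ω) Finset.univ fun j _ => i3 i j j).const_mul μ
  have c3 := (integrable_finsetSum (μ := vol Ω) Finset.univ fun j _ => i3 j j i).const_mul (μ + lam)
  have c4 : Integrable (fun x => μ * (∑ j, D2u s x (i, j, j) * ψ x)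
      + (μ + lam) * ∑ j, D2u s x (j, j, i) * ψ x) (vol Ω) := c2.add c3
  have c5 : Integrable (fun x => ∑ j, ρ s x * u s x i * u s x j * pd j ψ x
      + (μ * (∑ j, D2u s x (i, j, j) * ψ x) + (μ + lam) * ∑ j, D2u s x (j, j, i) * ψ x))
      (vol Ω) := c1.add c4
  have c6 : Integrable (fun x => ∑ j, ρ s x * u s x i * u s x j * pd j ψ x
      + (μ * (∑ j, D2u s x (i, j, j) * ψ x) + (μ + lam) * ∑ j, D2u s x (j, j, i) * ψ x)
      + a * (ρ s x ^ γ * pd i ψ x)) (vol Ω) := c5.add (i5.const_mul a)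
  rw [integral_add (i1.const_mul _) (c6.const_mul _),
    integral_const_mul, integral_const_mul,
    integral_add c5 (i5.const_mul a), integral_add c1 c4,
    integral_add c2 c3, integral_const_mul, integral_const_mul, integral_const_mul,
    integral_finsetSum _ fun j _ => i2 j, integral_finsetSum _ fun j _ => i3 i j j,
    integral_finsetSum _ fun j _ => i3 j j i]
  have e : ∀ j, ∫ x in Ω, ((ρ s x * u s x i * u s x j * pd j ψ x - μ * (Du s x (i, j) * pd j ψ x)) +
      if i = j then a * (ρ s x ^ γ * pd i ψ x) - (μ + lam) * ∑ k, Du s x (k, k) * pd i ψ x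
        else 0) = (∫ x in Ω, ρ s x * u s x i * u s x j * pd j ψ x)
        - μ * (∫ x in Ω, Du s x (i, j) * pd j ψ x) + if i = j then
        a * (∫ x in Ω, ρ s x ^ γ * pd i ψ x) - (μ + lam) * ∑ k, ∫ x in Ω, Du s x (k, k) * pd i ψ x
        else 0 := by
    intro j
    rw [integral_add (f := fun x => ρ s x * u s x i * u s x j * pd j ψ x
        - μ * (Du s x (i, j) * pd j ψ x)) ((i2 j).sub ((i4 i j j).const_mul μ)) (i7 j),
      integral_sub (i2 j) ((i4 i j j).const_mul μ), integral_const_mul]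
    congr 1
    by_cases hij : i = j
    · simp only [hij, if_true] at i5 i4 ⊢
      rw [integral_sub (i5.const_mul a) ((integrable_finsetSum _ fun k _ => i4 k k j).const_mul _),
        integral_const_mul, integral_const_mul, integral_finsetSum _ fun k _ => i4 k k j]
    · simp [hij]
  simp_rw [e, parts]
  rw [Finset.sum_add_distrib, Finset.sum_ite_eq]
  simp only [Finset.mem_univ, if_true, Fin.sum_univ_three]
  ring

end WeakTimeDerivative

/-! ### The bounded weight replacing a power of the speed -/

section Weight

/-- The bounded weight `((1 + z) / (1 + εz))^β`, which approximates `(1 + z)^β`. -/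
noncomputable def weight (β ε z : ℝ) : ℝ := ((1 + z) / (1 + ε * z)) ^ β

/-- The derivative of `weight`. -/
noncomputable def weightDeriv (β ε z : ℝ) : ℝ :=
  β * (1 - ε) / ((1 + z) * (1 + ε * z)) * weight β ε z

/-- The primitive of `weight`. -/
noncomputable def weightPrim (β ε z : ℝ) : ℝ := ∫ s in (0 : ℝ)..z, weight β ε s

variable {β ε y z : ℝ}

theorem one_add_mul_pos (hε : 0 < ε) (hε1 : ε ≤ 1) (hz : -1 < z) : 0 < 1 + ε * z := by
  nlinarith

/-- The open half-line is chosen to contain `[0, ∞)` in its interior, so that composition with the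
squared norm is smooth everywhere, including at zero velocity. -/
theorem contDiffOn_weight (hε : 0 < ε) (hε1 : ε ≤ 1) :
    ContDiffOn ℝ ∞ (weight β ε) (Ioi (-1)) := by
  unfold weight
  refine ContDiffOn.rpow_const_of_ne ?_ fun z hz => ?_
  · refine ContDiffOn.div (by fun_prop) (by fun_prop) fun z hz => ?_
    exact (one_add_mul_pos hε hε1 hz).ne'
  · have h1 : 0 < 1 + z := by linarith [mem_Ioi.1 hz]
    exact (div_pos h1 (one_add_mul_pos hε hε1 hz)).ne'

theorem hasDerivAt_weight (hε : 0 < ε) (hε1 : ε ≤ 1) (hz : -1 < z) :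
    HasDerivAt (weight β ε) (weightDeriv β ε z) z := by
  have h1 : 0 < 1 + z := by linarith
  have h2 := one_add_mul_pos hε hε1 hz
  have hd : HasDerivAt (fun z => (1 + z) / (1 + ε * z))
      ((1 * (1 + ε * z) - (1 + z) * (ε * 1)) / (1 + ε * z) ^ 2) z :=
    ((hasDerivAt_id z).const_add 1).div (((hasDerivAt_id z).const_mul ε).const_add 1) h2.ne'
  refine HasDerivAt.congr_deriv (f := weight β ε)
    (hd.rpow_const (p := β) (Or.inl (div_pos h1 h2).ne')) ?_
  simp only [weightDeriv, weight]
  rw [Real.rpow_sub_one (div_pos h1 h2).ne']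
  field_simp
  ring

theorem hasDerivAt_weightPrim (hε : 0 < ε) (hε1 : ε ≤ 1) (hz : -1 < z) :
    HasDerivAt (weightPrim β ε) (weight β ε z) z := by
  have hc : ContinuousOn (weight β ε) (Ioi (-1)) := (contDiffOn_weight hε hε1).continuousOn
  refine intervalIntegral.integral_hasDerivAt_right ?_
    (hc.stronglyMeasurableAtFilter isOpen_Ioi z hz) (hc.continuousAt (Ioi_mem_nhds hz))
  refine (hc.mono fun s hs => ?_).intervalIntegrable
  rcases le_total 0 z with h | h
  · rw [uIcc_of_le h] at hs; exact mem_Ioi.2 (by linarith [hs.1])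
  · rw [uIcc_of_ge h] at hs; exact mem_Ioi.2 (by linarith [hs.1])

theorem contDiffOn_weightPrim (hε : 0 < ε) (hε1 : ε ≤ 1) :
    ContDiffOn ℝ ∞ (weightPrim β ε) (Ioi (-1)) := by
  rw [contDiffOn_infty_iff_deriv_of_isOpen isOpen_Ioi]
  exact ⟨fun z hz => (hasDerivAt_weightPrim hε hε1 hz).differentiableAt.differentiableWithinAt,
    (contDiffOn_weight hε hε1).congr fun z hz => (hasDerivAt_weightPrim hε hε1 hz).deriv⟩

theorem weightPrim_zero : weightPrim β ε 0 = 0 := by simp [weightPrim]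

theorem weight_pos (hε : 0 < ε) (hz : 0 ≤ z) : 0 < weight β ε z := by
  unfold weight; positivity

/-- For fixed `ε` the weight is bounded, which makes `g(|u|²)u` as integrable as `u`. The bound
degenerates as `ε → 0` and must not enter the final constant. -/
theorem weight_le (hβ : 0 ≤ β) (hε : 0 < ε) (hε1 : ε ≤ 1) (hz : 0 ≤ z) :
    weight β ε z ≤ (1 / ε) ^ β := by
  refine Real.rpow_le_rpow (by positivity) ?_ hβ
  rw [div_le_div_iff₀ (by positivity) hε]
  nlinarith

theorem weight_le_one_add (hβ : 0 ≤ β) (hε : 0 < ε) (hz : 0 ≤ z) :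
    weight β ε z ≤ (1 + z) ^ β := by
  refine Real.rpow_le_rpow (by positivity) ?_ hβ
  exact div_le_self (by positivity) (by nlinarith)

theorem weight_mono (hβ : 0 ≤ β) (hε : 0 < ε) (hε1 : ε ≤ 1) (hz : 0 ≤ z) (hzy : z ≤ y) :
    weight β ε z ≤ weight β ε y := by
  have hy := hz.trans hzy
  refine Real.rpow_le_rpow (by positivity) ?_ hβ
  rw [div_le_div_iff₀ (by positivity) (by positivity)]
  nlinarith

theorem weightDeriv_nonneg (hβ : 0 ≤ β) (hε : 0 < ε) (hε1 : ε ≤ 1) (hz : 0 ≤ z) :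
    0 ≤ weightDeriv β ε z := by
  have := (weight_pos (β := β) hε hz).le
  have : 0 ≤ 1 - ε := by linarith
  unfold weightDeriv; positivity

/-- The logarithmic derivative times `z` is at most that of the pure power `z^β`. With `κ = 2β` this
is the hypothesis of `flux_pairing_le`, uniformly in `ε`. -/
theorem mul_weightDeriv_le (hβ : 0 ≤ β) (hε : 0 < ε) (hz : 0 ≤ z) :
    z * weightDeriv β ε z ≤ β * weight β ε z := by
  have hG := (weight_pos (β := β) hε hz).le
  unfold weightDeriv
  rw [← mul_assoc]
  refine mul_le_mul_of_nonneg_right ?_ hG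
  rw [mul_div_assoc', div_le_iff₀ (by positivity)]
  have : z * (1 - ε) ≤ (1 + z) * (1 + ε * z) := by nlinarith [mul_nonneg hε.le hz]
  nlinarith

theorem exists_weightPrim_sub (hε : 0 < ε) (hε1 : ε ≤ 1) (hy : 0 ≤ y) (hz : 0 ≤ z) :
    ∃ ξ, min y z ≤ ξ ∧ ξ ≤ max y z ∧
      weightPrim β ε y - weightPrim β ε z = weight β ε ξ * (y - z) := by
  have aux : ∀ {a b : ℝ}, 0 ≤ a → a < b → ∃ ξ, a ≤ ξ ∧ ξ ≤ b ∧
      weightPrim β ε b - weightPrim β ε a = weight β ε ξ * (b - a) := by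
    intro a b ha hab
    obtain ⟨ξ, hξ, he⟩ := exists_hasDerivAt_eq_slope (weightPrim β ε) (weight β ε) hab
      (fun s hs => (hasDerivAt_weightPrim hε hε1
        (by linarith [hs.1])).continuousAt.continuousWithinAt)
      (fun s hs => hasDerivAt_weightPrim hε hε1 (by linarith [hs.1]))
    refine ⟨ξ, hξ.1.le, hξ.2.le, ?_⟩
    rw [he, div_mul_cancel₀ _ (by linarith)]
  rcases lt_trichotomy y z with h | h | h
  · obtain ⟨ξ, h1, h2, h3⟩ := aux hy h
    exact ⟨ξ, by simpa [h.le] using h1, by simpa [h.le] using h2, by linarith⟩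
  · exact ⟨y, by simp [h], by simp [h], by simp [h]⟩
  · obtain ⟨ξ, h1, h2, h3⟩ := aux hz h
    exact ⟨ξ, by simpa [h.le] using h1, by simpa [h.le] using h2, h3⟩

/-- The derivative of the primitive is nondecreasing. This is the scalar half of the convexity of
the energy density. -/
theorem weightPrim_convex (hβ : 0 ≤ β) (hε : 0 < ε) (hε1 : ε ≤ 1) (hy : 0 ≤ y) (hz : 0 ≤ z) :
    weightPrim β ε z + weight β ε z * (y - z) ≤ weightPrim β ε y := by
  obtain ⟨ξ, h1, h2, h3⟩ := exists_weightPrim_sub (β := β) hε hε1 hy hz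
  have hξ : 0 ≤ ξ := (le_min hy hz).trans h1
  rcases le_total y z with h | h
  · rw [max_eq_right h] at h2
    have := weight_mono hβ hε hε1 hξ h2
    nlinarith
  · rw [min_eq_right h] at h1
    have := weight_mono hβ hε hε1 hz h1
    nlinarith

theorem abs_weightPrim_sub_le (hβ : 0 ≤ β) (hε : 0 < ε) (hε1 : ε ≤ 1) (hy : 0 ≤ y) (hz : 0 ≤ z) :
    |weightPrim β ε y - weightPrim β ε z| ≤ (1 / ε) ^ β * |y - z| := by
  obtain ⟨ξ, h1, h2, h3⟩ := exists_weightPrim_sub (β := β) hε hε1 hy hz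
  have hξ : 0 ≤ ξ := (le_min hy hz).trans h1
  rw [h3, abs_mul, abs_of_pos (weight_pos hε hξ)]
  exact mul_le_mul_of_nonneg_right (weight_le hβ hε hε1 hξ) (abs_nonneg _)

theorem weightPrim_nonneg (hβ : 0 ≤ β) (hε : 0 < ε) (hε1 : ε ≤ 1) (hz : 0 ≤ z) :
    0 ≤ weightPrim β ε z := by
  have := weightPrim_convex hβ hε hε1 hz le_rfl
  have h0 := mul_nonneg (weight_pos (β := β) hε le_rfl).le hz
  rw [weightPrim_zero] at this
  linarith

theorem weightPrim_le (hβ : 0 ≤ β) (hε : 0 < ε) (hε1 : ε ≤ 1) (hz : 0 ≤ z) :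
    weightPrim β ε z ≤ z * weight β ε z := by
  have := weightPrim_convex hβ hε hε1 le_rfl hz
  rw [weightPrim_zero] at this
  linarith

/-- The difference of the two sides vanishes at 0 and is monotone, since `z g' ≤ β g`. It recovers
the weighted power of the velocity from the energy without loss in `ε`. -/
theorem mul_weight_le_weightPrim (hβ : 0 ≤ β) (hε : 0 < ε) (hε1 : ε ≤ 1) (hz : 0 ≤ z) :
    z * weight β ε z ≤ (1 + β) * weightPrim β ε z := by
  have hd : ∀ s : ℝ, 0 ≤ s → HasDerivAt (fun s => (1 + β) * weightPrim β ε s - s * weight β ε s)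
      ((1 + β) * weight β ε s - (1 * weight β ε s + s * weightDeriv β ε s)) s := fun s hs =>
    ((hasDerivAt_weightPrim hε hε1 (by linarith)).const_mul _).sub
      ((hasDerivAt_id s).mul (hasDerivAt_weight hε hε1 (by linarith)))
  have hm := monotoneOn_of_deriv_nonneg (convex_Ici 0)
    (f := fun s => (1 + β) * weightPrim β ε s - s * weight β ε s)
    (fun s hs => (hd s hs).continuousAt.continuousWithinAt)
    (fun s hs => (hd s (interior_subset hs)).differentiableAt.differentiableWithinAt)
    (fun s hs => by
      have hs' : 0 ≤ s := interior_subset hs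
      rw [(hd s hs').deriv]
      have := mul_weightDeriv_le hβ hε hs'
      linarith)
  have := hm (mem_Ici.2 le_rfl) (mem_Ici.2 hz) hz
  simp only [weightPrim_zero] at this
  linarith

/-- For `z ≤ 1` the weight is at most 2; for `z ≥ 1` it is at most `z g`, which the primitive
controls. This lets the pressure contribution be bounded by mass plus energy. -/
theorem weight_le_weightPrim (hβ : 0 ≤ β) (hβ1 : β ≤ 1) (hε : 0 < ε) (hε1 : ε ≤ 1) (hz : 0 ≤ z) :
    weight β ε z ≤ 2 + 2 * weightPrim β ε z := by
  have hP := weightPrim_nonneg hβ hε hε1 hz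
  rcases le_total z 1 with h | h
  · have h1 := weight_le_one_add hβ hε hz
    have h2 : (1 + z) ^ β ≤ (2 : ℝ) ^ (1 : ℝ) :=
      (Real.rpow_le_rpow (by linarith) (by linarith) hβ).trans
        (Real.rpow_le_rpow_of_exponent_le (by norm_num) hβ1)
    rw [Real.rpow_one] at h2
    linarith
  · have h1 := mul_weight_le_weightPrim hβ hε hε1 hz
    have h2 := weight_pos (β := β) hε hz
    nlinarith

/-- At `z = |u|²` the cube is `|u|⁶`, which Sobolev's inequality controls at the initial time,
uniformly in `ε`. -/
theorem weightPrim_le_cube (hβ : 0 ≤ β) (hβ1 : β ≤ 1) (hε : 0 < ε) (hε1 : ε ≤ 1) (hz : 0 ≤ z) :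
    weightPrim β ε z ≤ 4 * (1 + z ^ 3) := by
  have h1 := weightPrim_le hβ hε hε1 hz
  have h2 := weight_le_one_add hβ hε hz
  have h3 : (1 + z) ^ β ≤ 1 + z := by
    simpa using Real.rpow_le_rpow_of_exponent_le (by linarith : (1 : ℝ) ≤ 1 + z) hβ1
  have h4 : z * weight β ε z ≤ z * (1 + z) := mul_le_mul_of_nonneg_left (h2.trans h3) hz
  nlinarith [mul_nonneg hz (sq_nonneg (z - 1)), sq_nonneg (z - 1), pow_nonneg hz 3]

theorem tendsto_weight (hz : 0 ≤ z) :
    Tendsto (fun n : ℕ => weight β (1 / (n + 1)) z) atTop (𝓝 ((1 + z) ^ β)) := by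
  unfold weight
  have h1 : Tendsto (fun n : ℕ => (1 + z) / (1 + 1 / ((n : ℝ) + 1) * z)) atTop (𝓝 (1 + z)) := by
    have h := (tendsto_one_div_add_atTop_nhds_zero_nat (𝕜 := ℝ)).mul_const z
    have h' := (tendsto_const_nhds (x := 1 + z)).div (h.const_add 1) (by simp)
    rw [zero_mul, add_zero, div_one] at h'
    exact h'
  exact h1.rpow_const (Or.inl (by linarith))

theorem continuousAt_weightDeriv (hε : 0 < ε) (hε1 : ε ≤ 1) (hz : -1 < z) :
    ContinuousAt (weightDeriv β ε) z := by
  have h1 : 0 < 1 + z := by linarith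
  have h2 := one_add_mul_pos hε hε1 hz
  unfold weightDeriv
  refine ContinuousAt.mul (ContinuousAt.div (by fun_prop) (by fun_prop) (by positivity)) ?_
  exact (hasDerivAt_weight hε hε1 hz).continuousAt

end Weight

/-! ### Pointwise coercivity of the viscous form -/

section Algebra

/-- The square of the Euclidean norm. -/
def nsq (v : E3) : ℝ := ∑ k, v k * v k

theorem nsq_nonneg (v : E3) : 0 ≤ nsq v := Finset.sum_nonneg fun _ _ => mul_self_nonneg _

theorem nsq_eq_norm_sq (v : E3) : nsq v = ‖v‖ ^ 2 := by
  rw [EuclideanSpace.real_norm_sq_eq, nsq]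
  exact Finset.sum_congr rfl fun _ _ => (sq _).symm

/-- The derivative of `x ↦ g(|v(x)|²) v(x)` in terms of `v` and its Jacobian `A`. -/
def weightedJac (g g' : ℝ) (v : E3) (A : Mat3) (i j : Fin 3) : ℝ :=
  g * A (i, j) + 2 * g' * (∑ k, v k * A (k, j)) * v i

/-- Here `n = |v|²`, `a2 = |A|²`, `d = tr A`, `Y = |Aᵀv|²` and `σ = v · Aᵀv`, while `L` stands for
`μ + lam` and `b` for `g'/g`. Completing the square in `d` leaves the indefinite term `L b²σ²`. The
worst case is `Y = n a2` with `2bn = κ`, where the condition on `c` says precisely that `c a2`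
survives; this remainder absorbs the pressure. -/
theorem viscous_form_le {μ L κ c g k b n a2 Y σ d p : ℝ} (hL : 0 < L) (hκ : 0 ≤ κ)
    (hc : 0 < c) (hcμ : c ≤ μ) (hck : c ≤ μ * (1 + κ) - L * κ ^ 2 / 4) (hg : 0 ≤ g) (hn : 0 ≤ n)
    (ha2 : 0 ≤ a2) (hY0 : 0 ≤ Y) (hY : Y ≤ n * a2)
    (hσ : σ ^ 2 ≤ Y * n) (hd : d ^ 2 ≤ 3 * a2) (hkb : k = b * g) (hb : 0 ≤ b) (hbn : 2 * b * n ≤ κ) :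
    -μ * (g * a2 + 2 * k * Y) - L * d * (g * d + 2 * k * σ) + p * (g * d + 2 * k * σ)
      ≤ (6 + 2 * κ ^ 2) / (4 * c) * p ^ 2 * g := by
  have hD : 0 < 6 + 2 * κ ^ 2 := by positivity
  have h1 : -L * d * (d + 2 * b * σ) ≤ L * b ^ 2 * (Y * n) := by
    have : 0 ≤ L * (d + b * σ) ^ 2 := by positivity
    have h' : L * b ^ 2 * σ ^ 2 ≤ L * b ^ 2 * (Y * n) :=
      mul_le_mul_of_nonneg_left hσ (by positivity)
    nlinarith
  -- If the bracket is nonpositive there is nothing to lose, as `c ≤ μ`. Otherwise both factors are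
  -- increased to their extreme values at `2bn = κ` and `Y = n a2`.
  have h2 : b * Y * (L * b * n - 2 * μ) ≤ (μ - c) * a2 := by
    rcases le_total (L * b * n) (2 * μ) with h | h
    · have e1 : b * Y * (L * b * n - 2 * μ) ≤ 0 :=
        mul_nonpos_of_nonneg_of_nonpos (by positivity) (by linarith)
      have e2 : 0 ≤ (μ - c) * a2 := mul_nonneg (by linarith) ha2
      linarith
    · have e1 : b * Y ≤ κ / 2 * a2 := by
        have : b * Y ≤ b * (n * a2) := mul_le_mul_of_nonneg_left hY hb
        have h3 : (2 * b * n) * a2 ≤ κ * a2 := mul_le_mul_of_nonneg_right hbn ha2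
        nlinarith
      have e2 : L * b * n - 2 * μ ≤ L * κ / 2 - 2 * μ := by nlinarith
      have e3 : b * Y * (L * b * n - 2 * μ) ≤ κ / 2 * a2 * (L * κ / 2 - 2 * μ) :=
        mul_le_mul e1 e2 (by linarith) (by positivity)
      have e4 : κ / 2 * (L * κ / 2 - 2 * μ) ≤ μ - c := by nlinarith
      have e5 := mul_le_mul_of_nonneg_right e4 ha2
      nlinarith
  have h3 : (d + 2 * b * σ) ^ 2 ≤ (6 + 2 * κ ^ 2) * a2 := by
    have e1 : (d + 2 * b * σ) ^ 2 ≤ 2 * d ^ 2 + 8 * b ^ 2 * σ ^ 2 := by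
      nlinarith [sq_nonneg (d - 2 * b * σ)]
    have e2 : 8 * b ^ 2 * σ ^ 2 ≤ 8 * b ^ 2 * (n * a2 * n) := by
      refine mul_le_mul_of_nonneg_left (hσ.trans ?_) (by positivity)
      exact mul_le_mul_of_nonneg_right hY hn
    have e3 : (2 * b * n) ^ 2 ≤ κ ^ 2 := pow_le_pow_left₀ (by positivity) hbn 2
    have e4 := mul_le_mul_of_nonneg_right e3 ha2
    nlinarith
  have h4 : p * (d + 2 * b * σ) ≤ c * a2 + (6 + 2 * κ ^ 2) / (4 * c) * p ^ 2 := by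
    set X := d + 2 * b * σ
    set D := 6 + 2 * κ ^ 2
    -- Young's inequality with the weight `c / D` chosen so that, by `h3`, the quadratic term costs
    -- exactly `c a2`.
    have e1 : p * X ≤ c / D * X ^ 2 + D / (4 * c) * p ^ 2 := by
      have : c / D * X ^ 2 + D / (4 * c) * p ^ 2 - p * X
          = (2 * c * X - D * p) ^ 2 / (4 * c * D) := by field_simp; ring
      have h' : 0 ≤ (2 * c * X - D * p) ^ 2 / (4 * c * D) := by positivity
      linarith
    have e2 : c / D * X ^ 2 ≤ c / D * (D * a2) := mul_le_mul_of_nonneg_left h3 (by positivity)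
    have e3 : c / D * (D * a2) = c * a2 := by field_simp
    linarith
  have h5 : -μ * (a2 + 2 * b * Y) - L * d * (d + 2 * b * σ) + p * (d + 2 * b * σ)
      ≤ (6 + 2 * κ ^ 2) / (4 * c) * p ^ 2 := by nlinarith
  have h6 := mul_le_mul_of_nonneg_right h5 hg
  rw [hkb]
  nlinarith

/-- The cubic terms from the mass and momentum equations cancel identically. What remains is the
viscous and pressure form, whose ingredients are bounded by Cauchy–Schwarz. -/
theorem flux_pairing_le {μ lam κ c g g' : ℝ} (hL : 0 < μ + lam) (hκ : 0 ≤ κ)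
    (hc : 0 < c) (hcμ : c ≤ μ) (hck : c ≤ μ * (1 + κ) - (μ + lam) * κ ^ 2 / 4) (hg : 0 < g)
    (hg' : 0 ≤ g') (v : E3) (A : Mat3) (hk : 2 * g' * nsq v ≤ κ * g) (r p : ℝ) :
    ∑ j, r * v j * (- ∑ i, v i * weightedJac g g' v A i j)
      + ∑ i, ∑ j, (r * v i * v j - μ * A (i, j) + if i = j then p - (μ + lam) * ∑ k, A (k, k) else 0)
        * weightedJac g g' v A i j ≤ (6 + 2 * κ ^ 2) / (4 * c) * p ^ 2 * g := by
  set y : Fin 3 → ℝ := fun j => ∑ k, v k * A (k, j) with hy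
  set a2 : ℝ := ∑ i, ∑ j, A (i, j) ^ 2 with ha2
  set Y : ℝ := ∑ j, y j ^ 2 with hYd
  have hY : Y ≤ nsq v * a2 := by
    rw [hYd, ha2, Finset.sum_comm, Finset.mul_sum]
    refine Finset.sum_le_sum fun j _ => ?_
    have := Finset.sum_mul_sq_le_sq_mul_sq Finset.univ (fun k => v k) (fun k => A (k, j))
    simpa [nsq, sq] using this
  have hσ : (∑ j, y j * v j) ^ 2 ≤ Y * nsq v := by
    have := Finset.sum_mul_sq_le_sq_mul_sq Finset.univ y (fun k => v k)
    simpa [nsq, sq, hYd] using this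
  have hd : (∑ k, A (k, k)) ^ 2 ≤ 3 * a2 := by
    simp only [ha2, Fin.sum_univ_three]
    nlinarith [sq_nonneg (A (0, 0) - A (1, 1)), sq_nonneg (A (0, 0) - A (2, 2)),
      sq_nonneg (A (1, 1) - A (2, 2)), sq_nonneg (A (0, 1)), sq_nonneg (A (0, 2)),
      sq_nonneg (A (1, 0)), sq_nonneg (A (1, 2)), sq_nonneg (A (2, 0)), sq_nonneg (A (2, 1))]
  have hb : 2 * (g' / g) * nsq v ≤ κ := by
    rw [show 2 * (g' / g) * nsq v = 2 * g' * nsq v / g by ring, div_le_iff₀ hg]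
    exact hk
  have key := viscous_form_le (p := p) (k := g') (b := g' / g) hL hκ hc hcμ hck hg.le (nsq_nonneg v)
    (by positivity) (by positivity) hY hσ hd (by field_simp) (by positivity) hb
  have e1 : ∀ w : Fin 3 → Fin 3 → ℝ, ∑ j, r * v j * (- ∑ i, v i * w i j)
      + ∑ i, ∑ j, (r * v i * v j - μ * A (i, j)
        + if i = j then p - (μ + lam) * ∑ k, A (k, k) else 0) * w i j
      = -μ * (∑ i, ∑ j, A (i, j) * w i j) + (p - (μ + lam) * ∑ k, A (k, k)) * ∑ i, w i i := by
    intro w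
    generalize p - (μ + lam) * ∑ k, A (k, k) = e
    simp only [add_mul, ite_mul, zero_mul, Finset.sum_add_distrib, Finset.sum_ite_eq,
      Finset.mem_univ, if_true, Fin.sum_univ_three]
    ring
  have e2 : ∑ i, ∑ j, A (i, j) * weightedJac g g' v A i j = g * a2 + 2 * g' * Y := by
    simp only [hYd, ha2, hy, weightedJac, Fin.sum_univ_three]
    ring
  have e3 : ∑ i, weightedJac g g' v A i i = g * (∑ k, A (k, k)) + 2 * g' * ∑ j, y j * v j := by
    simp only [hy, weightedJac, Fin.sum_univ_three]
    ring
  rw [e1, e2, e3]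
  refine le_trans (le_of_eq ?_) key
  ring

end Algebra

/-! ### Grönwall's inequality -/

section Gronwall

/-- Grönwall's inequality with a one-sided bound on the slopes from the left. -/
theorem le_mul_exp_of_left_slope {f : ℝ → ℝ} {K b : ℝ} (hb : 0 ≤ b)
    (hf : ContinuousOn f (Icc 0 b))
    (h : ∀ t ∈ Ioc 0 b, ∀ ε > 0, ∀ᶠ s in 𝓝[<] t, f t - f s ≤ (t - s) * (K * f t + ε)) :
    f b ≤ f 0 * Real.exp (K * b) := by
  have hmap : MapsTo (fun τ => b - τ) (Icc 0 b) (Icc 0 b) := fun τ hτ =>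
    ⟨by linarith [hτ.2], by linarith [hτ.1]⟩
  -- Reversing time and sign, `τ ↦ -f(b - τ)`, turns left slopes into right slopes and the rate `K`
  -- into `-K`.
  have key := le_gronwallBound_of_liminf_deriv_right_le (f := fun τ => - f (b - τ))
    (f' := fun τ => K * f (b - τ)) (δ := - f b) (K := -K) (ε := 0) (a := 0) (b := b)
    ((hf.comp (by fun_prop) hmap).neg) ?_ (by simp) (fun τ _ => by linarith) b ⟨hb, le_rfl⟩
  · rw [gronwallBound_ε0, sub_self, sub_zero] at key
    have h1 : f b * Real.exp (-K * b) ≤ f 0 := by linarith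
    calc f b = f b * Real.exp (-K * b) * Real.exp (K * b) := by
          rw [mul_assoc, ← Real.exp_add]; simp
      _ ≤ f 0 * Real.exp (K * b) := mul_le_mul_of_nonneg_right h1 (Real.exp_pos _).le
  · intro τ hτ r hr
    have ht : b - τ ∈ Ioc 0 b := ⟨by linarith [hτ.2], by linarith [hτ.1]⟩
    have he := h _ ht ((r - K * f (b - τ)) / 2) (by linarith)
    have hm : Tendsto (fun σ => b - σ) (𝓝[>] τ) (𝓝[<] (b - τ)) := by
      refine tendsto_nhdsWithin_iff.2 ⟨?_, ?_⟩
      · exact ((continuous_const.sub continuous_id).tendsto τ).mono_left nhdsWithin_le_nhds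
      · filter_upwards [self_mem_nhdsWithin] with σ hσ
        have : τ < σ := hσ
        exact mem_Iio.2 (by linarith)
    refine Eventually.frequently ?_
    filter_upwards [hm.eventually he, self_mem_nhdsWithin] with σ h1 h2
    have h3 : 0 < σ - τ := sub_pos.2 h2
    rw [inv_mul_lt_iff₀ h3]
    have h4 : (σ - τ) * (K * f (b - τ) + (r - K * f (b - τ)) / 2) < (σ - τ) * r :=
      mul_lt_mul_of_pos_left (by linarith) h3
    have h5 : b - τ - (b - σ) = σ - τ := by ring
    rw [h5] at h1
    linarith

theorem le_mul_exp_of_deriv_le {f f' : ℝ → ℝ} {K b : ℝ} (hb : 0 ≤ b)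
    (hf : ContinuousOn f (Icc 0 b)) (hd : ∀ t ∈ Ioc 0 b, HasDerivAt f (f' t) t)
    (hle : ∀ t ∈ Ioc 0 b, f' t ≤ K * f t) : f b ≤ f 0 * Real.exp (K * b) := by
  refine le_mul_exp_of_left_slope hb hf fun t ht ε hε => ?_
  have h1 := hasDerivAt_iff_tendsto_slope.1 (hd t ht)
  have h2 : ∀ᶠ s in 𝓝[<] t, slope f t s < f' t + ε :=
    (h1.mono_left (nhdsWithin_mono _ fun s hs => (ne_of_lt hs : s ≠ t))).eventually_lt_const
      (by linarith)
  filter_upwards [h2, self_mem_nhdsWithin] with s h3 h4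
  have h5 : 0 < t - s := sub_pos.2 h4
  rw [slope_comm, slope_def_field, div_lt_iff₀ h5] at h3
  have := hle t ht
  nlinarith

end Gronwall

/-! ### Control of the mass on the whole space -/

section Mass

theorem ContInLp.exists_bound {F : Type*} [NormedAddCommGroup F] {T : ℝ} {Ω : Set E3} {p : ℝ≥0∞}
    {f : ℝ → E3 → F} (hp : 1 ≤ p) (h : ContInLp T Ω p f) {b : ℝ} (hb : b < T) :
    ∃ L : ℝ, 0 ≤ L ∧ ∀ t ∈ Icc 0 b, (eLpNorm (f t) p (vol Ω)).toReal ≤ L := by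
  have hc : ContinuousOn (fun t => (eLpNorm (f t) p (vol Ω)).toReal) (Icc 0 b) := by
    have : ContinuousOn (fun t => (eLpNorm (f t) p (vol Ω)).toReal) (Ico 0 T) := fun s hs =>
      (h.lpTendsto hs).toReal hp
    exact this.mono fun t ht => ⟨ht.1, ht.2.trans_lt hb⟩
  obtain ⟨L, hL⟩ := isCompact_Icc.exists_bound_of_continuousOn hc
  exact ⟨max L 0, le_max_right _ _, fun t ht =>
    ((le_abs_self _).trans (hL t ht)).trans (le_max_left _ _)⟩

theorem integral_norm_pow_six {F : Type*} [NormedAddCommGroup F] {ν : Measure E3} {f : E3 → F}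
    (hf : MemLp f 6 ν) : ∫ x, ‖f x‖ ^ 6 ∂ν = (eLpNorm f 6 ν).toReal ^ 6 := by
  have h := hf.eLpNorm_eq_integral_rpow_norm (by simp) (by simp)
  have h0 : 0 ≤ ∫ x, ‖f x‖ ^ 6 ∂ν := integral_nonneg fun x => by positivity
  simp only [ENNReal.toReal_ofNat] at h
  norm_cast at h
  rw [h, ENNReal.toReal_ofReal (by positivity)]
  rw [← Real.rpow_natCast, ← Real.rpow_mul (by exact_mod_cast h0)]
  norm_num

/-- Cutoff functions on the whole space. -/
theorem exists_cutoff : ∃ C : ℝ, 0 ≤ C ∧ ∀ n : ℕ, ∃ χ : E3 → ℝ, IsTest univ χ ∧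
    (∀ x, 0 ≤ χ x ∧ χ x ≤ 1) ∧ (∀ x, ‖x‖ ≤ n + 1 → χ x = 1) ∧
    ∀ j x, |pd j χ x| ≤ C / (n + 1) := by
  let b : ContDiffBump (0 : E3) := ⟨1, 2, by norm_num, by norm_num⟩
  have hb : ContDiff ℝ ∞ b := b.contDiff
  have hbt : IsTest univ b := ⟨hb, b.hasCompactSupport, subset_univ _⟩
  have hex : ∀ j, ∃ C, ∀ x, ‖pd j b x‖ ≤ C := fun j =>
    (hbt.pd j).1.continuous.bounded_above_of_compact_support (hbt.pd j).2.1
  choose C hC using hex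
  refine ⟨∑ j, |C j|, by positivity, fun n => ?_⟩
  have hn : (0 : ℝ) < n + 1 := by positivity
  refine ⟨fun x => b ((n + 1 : ℝ)⁻¹ • x), ⟨?_, ?_, subset_univ _⟩, fun x => ⟨b.nonneg, b.le_one⟩,
    fun x hx => ?_, fun j x => ?_⟩
  · exact hb.comp (contDiff_const_smul _)
  · exact b.hasCompactSupport.comp_homeomorph (Homeomorph.smulOfNeZero _ (inv_pos.2 hn).ne')
  · refine b.one_of_mem_closedBall ?_
    rw [mem_closedBall_zero_iff, norm_smul, Real.norm_eq_abs, abs_of_pos (inv_pos.2 hn)]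
    change _ ≤ (1 : ℝ)
    rw [inv_mul_le_iff₀ hn]; linarith
  · have hd : pd j (fun x => b ((n + 1 : ℝ)⁻¹ • x)) x = (n + 1 : ℝ)⁻¹ * pd j b ((n + 1 : ℝ)⁻¹ • x) := by
      unfold pd
      rw [fderiv_comp_smul]; rfl
    rw [hd, abs_mul, abs_of_pos (inv_pos.2 hn), div_eq_inv_mul]
    refine mul_le_mul_of_nonneg_left ?_ (inv_pos.2 hn).le
    exact ((hC j _).trans (le_abs_self _)).trans
      (Finset.single_le_sum (f := fun j => |C j|) (fun _ _ => abs_nonneg _) (Finset.mem_univ j))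

theorem pd_comp {f : E3 → ℝ} {F : ℝ → ℝ} {F' : ℝ} {x : E3} (hf : DifferentiableAt ℝ f x)
    (hF : HasDerivAt F F' (f x)) (j : Fin 3) : pd j (fun y => F (f y)) x = F' * pd j f x := by
  unfold pd
  have := (hF.comp_hasFDerivAt x hf.hasFDerivAt).fderiv
  change fderiv ℝ (fun y => F (f y)) x = _ at this
  rw [this]
  rfl

variable {Ω : Set E3} {μ lam a γ q T M N : ℝ} {ρ : ℝ → E3 → ℝ} {u : ℝ → E3 → E3}
  {Dρ : ℝ → E3 → E3} {Du : ℝ → E3 → Mat3} {D2u : ℝ → E3 → Tens3}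

/-- The mass on the whole space does not exceed the initial mass. -/
theorem IsStrongSolution.mass_le (hN : 0 ≤ N)
    (h : IsStrongSolution univ μ lam a γ q T ρ u Dρ Du D2u)
    (hb : ∀ t ∈ Ico 0 T, ∀ᵐ x ∂(vol univ), 0 ≤ ρ t x ∧ ρ t x ≤ M)
    (h0 : eLpNorm (ρ 0) 1 (vol univ) ≤ ENNReal.ofReal N) {t : ℝ} (ht : t ∈ Ico 0 T) :
    eLpNorm (ρ t) 1 (vol univ) ≤ ENNReal.ofReal N := by
  rcases eq_or_lt_of_le ht.1 with rfl | ht0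
  · exact h0
  have h0T : (0 : ℝ) ∈ Ico 0 T := ⟨le_rfl, ht0.trans ht.2⟩
  have hM : 0 ≤ M := by
    obtain ⟨x, hx⟩ := (hb 0 h0T).exists
    exact hx.1.trans hx.2
  obtain ⟨L, hL0, hL⟩ := h.contInLp_u.exists_bound (by norm_num) ht.2
  obtain ⟨C, hC0, hC⟩ := exists_cutoff
  choose χ hχt hχ01 hχ1 hχd using hC
  -- The sixth power matches `u ∈ L⁶`: a derivative of the cutoff leaves `χ⁵|u| ≤ χ⁶ + |u|⁶`, where
  -- the first term returns to the localized mass and the second is integrable. No integrability of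
  -- `ρu` over the whole space is presupposed.
  have hψ : ∀ n, IsTest univ fun x => χ n x ^ 6 := fun n => by
    refine ⟨(hχt n).1.pow 6, ?_, subset_univ _⟩
    exact (hχt n).2.1.comp_left (g := fun s : ℝ => s ^ 6) (by norm_num)
  have hρψ : ∀ n, ∀ s ∈ Ico 0 T, Integrable (fun x => ρ s x * χ n x ^ 6) (vol univ) :=
    fun n s hs => MemLp.integrable_mul_test (p := 2) (by norm_num) (h.contρ_two.1 s hs) (hψ n)
  have hu6 : ∀ s ∈ Ico 0 T, Integrable (fun x => ‖u s x‖ ^ 6) (vol univ) := fun s hs =>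
    (h.contInLp_u.1 s hs).integrable_norm_pow (by norm_num)
  have hpd : ∀ n j x, |pd j (fun x => χ n x ^ 6) x| ≤ 6 * χ n x ^ 5 * (C / (n + 1)) := by
    intro n j x
    rw [pd_comp (F := fun s => s ^ 6) ((hχt n).1.differentiable (by simp) x) (hasDerivAt_pow 6 _),
      abs_mul]
    norm_num
    rw [abs_of_nonneg (hχ01 n x).1]
    exact mul_le_mul_of_nonneg_left (hχd n j x) (by have := (hχ01 n x).1; positivity)
  have hder : ∀ n, ∀ s ∈ Ioc 0 t, ∑ j, ∫ x in univ, (ρ s x * u s x j) * pd j (fun x => χ n x ^ 6) x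
      ≤ 18 * C / (n + 1) * ((∫ x in univ, ρ s x * χ n x ^ 6) + M * L ^ 6) := by
    intro n s hs
    have hs' : s ∈ Ico 0 T := ⟨hs.1.le, hs.2.trans_lt ht.2⟩
    have hj : ∀ j, ∫ x in univ, (ρ s x * u s x j) * pd j (fun x => χ n x ^ 6) x
        ≤ 6 * C / (n + 1) * ((∫ x in univ, ρ s x * χ n x ^ 6) + M * L ^ 6) := by
      intro j
      have e1 : ∫ x in univ, (ρ s x * u s x j) * pd j (fun x => χ n x ^ 6) x
          ≤ ∫ x in univ, 6 * C / (n + 1) * (ρ s x * χ n x ^ 6 + M * ‖u s x‖ ^ 6) := by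
        refine integral_mono_ae (MemLp.integrable_mul_test (p := 3) (by norm_num)
          ((h.contInLp_momentum hb j).1 s hs') ((hψ n).pd j))
          (((hρψ n s hs').add ((hu6 s hs').const_mul M)).const_mul _) ?_
        filter_upwards [hb s hs'] with x hx
        have a1 := (hχ01 n x).1
        have a2 : |u s x j| ≤ ‖u s x‖ := PiLp.norm_apply_le (u s x) j
        have a3 : χ n x ^ 5 * ‖u s x‖ ≤ χ n x ^ 6 + ‖u s x‖ ^ 6 := by
          have b2 := norm_nonneg (u s x)
          rcases le_total (χ n x) ‖u s x‖ with hle | hle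
          · have := mul_le_mul_of_nonneg_right (pow_le_pow_left₀ a1 hle 5) b2
            nlinarith [pow_nonneg a1 6]
          · have := mul_le_mul_of_nonneg_left hle (pow_nonneg a1 5)
            nlinarith [pow_nonneg b2 6]
        calc (ρ s x * u s x j) * pd j (fun x => χ n x ^ 6) x
            ≤ |(ρ s x * u s x j) * pd j (fun x => χ n x ^ 6) x| := le_abs_self _
          _ = ρ s x * |u s x j| * |pd j (fun x => χ n x ^ 6) x| := by
            rw [abs_mul, abs_mul, abs_of_nonneg hx.1]
          _ ≤ ρ s x * ‖u s x‖ * (6 * χ n x ^ 5 * (C / (n + 1))) :=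
            mul_le_mul (mul_le_mul_of_nonneg_left a2 hx.1) (hpd n j x) (abs_nonneg _)
              (mul_nonneg hx.1 (norm_nonneg _))
          _ = 6 * C / (n + 1) * (ρ s x * (χ n x ^ 5 * ‖u s x‖)) := by ring
          _ ≤ 6 * C / (n + 1) * (ρ s x * (χ n x ^ 6 + ‖u s x‖ ^ 6)) := by
            have := hx.1; gcongr
          _ ≤ 6 * C / (n + 1) * (ρ s x * χ n x ^ 6 + M * ‖u s x‖ ^ 6) := by
            rw [mul_add]
            have := hx.2; gcongr
      refine e1.trans ?_
      rw [integral_const_mul, integral_add (hρψ n s hs') ((hu6 s hs').const_mul M),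
        integral_const_mul, integral_norm_pow_six (h.contInLp_u.1 s hs')]
      have := hL s ⟨hs.1.le, hs.2⟩
      gcongr
    refine (Finset.sum_le_sum fun j _ => hj j).trans (le_of_eq ?_)
    simp only [Finset.sum_const, Finset.card_univ, Fintype.card_fin, nsmul_eq_mul]
    push_cast; ring
  -- The bound `L` depends on the solution and on `t`, but its contribution disappears as `n → ∞`
  -- because the exponential tends to 1.
  have hgr : ∀ n : ℕ, ∫ x in univ, ρ t x * χ n x ^ 6
      ≤ (N + M * L ^ 6) * Real.exp (18 * C / (n + 1) * t) - M * L ^ 6 := by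
    intro n
    have hc : ContinuousOn (fun s => (∫ x in univ, ρ s x * χ n x ^ 6) + M * L ^ 6) (Icc 0 t) :=
      ((h.contρ_two.continuousOn_integral_mul ((hψ n).memLp 2 _)).mono
        fun s hs => ⟨hs.1, hs.2.trans_lt ht.2⟩).add continuousOn_const
    have := le_mul_exp_of_deriv_le ht.1 hc
      (fun s hs => (h.hasDerivAt_mass hb (hψ n) ⟨hs.1, hs.2.trans_lt ht.2⟩).add_const _) (hder n)
    have hi : ∫ x in univ, ρ 0 x * χ n x ^ 6 ≤ N := by
      have i0 : Integrable (ρ 0) (vol univ) := memLp_one_iff_integrable.1 h.mass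
      have e1 : ∫ x in univ, ρ 0 x * χ n x ^ 6 ≤ ∫ x in univ, ‖ρ 0 x‖ := by
        refine integral_mono_ae (hρψ n 0 h0T) i0.norm ?_
        filter_upwards [hb 0 h0T] with x hx
        rw [Real.norm_eq_abs, abs_of_nonneg hx.1]
        exact mul_le_of_le_one_right hx.1 (pow_le_one₀ (hχ01 n x).1 (hχ01 n x).2)
      refine e1.trans ?_
      rw [integral_norm_eq_lintegral_enorm i0.1, ← eLpNorm_one_eq_lintegral_enorm]
      exact ENNReal.toReal_le_of_le_ofReal hN h0
    have h3 : ((∫ x in univ, ρ 0 x * χ n x ^ 6) + M * L ^ 6) * Real.exp (18 * C / (n + 1) * t)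
        ≤ (N + M * L ^ 6) * Real.exp (18 * C / (n + 1) * t) :=
      mul_le_mul_of_nonneg_right (by linarith) (Real.exp_pos _).le
    linarith
  have hlim : Tendsto (fun n : ℕ => (N + M * L ^ 6) * Real.exp (18 * C / (n + 1) * t) - M * L ^ 6)
      atTop (𝓝 N) := by
    have e1 := (tendsto_one_div_add_atTop_nhds_zero_nat (𝕜 := ℝ)).const_mul (18 * C)
    have e2 := (Real.continuous_exp.tendsto _).comp (e1.mul_const t)
    have e3 := (e2.const_mul (N + M * L ^ 6)).sub_const (M * L ^ 6)
    simp only [mul_zero, zero_mul, Real.exp_zero, mul_one, add_sub_cancel_right] at e3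
    refine e3.congr fun n => ?_
    simp [div_eq_mul_inv]
  refine ENNReal.le_of_forall_pos_le_add fun ε hε _ => ?_
  refine Lp.eLpNorm_le_of_ae_tendsto (u := atTop) (f := fun (n : ℕ) x => ρ t x * χ n x ^ 6) ?_
    (fun n => (hρψ n t ht).1) ?_
  · filter_upwards [hlim.eventually_lt_const (lt_add_of_pos_right N (NNReal.coe_pos.2 hε))]
      with n hn
    rw [eLpNorm_one_eq_lintegral_enorm, ← ofReal_integral_norm_eq_lintegral_enorm (hρψ n t ht),
      ← ENNReal.ofReal_coe_nnreal, ← ENNReal.ofReal_add hN ε.coe_nonneg]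
    refine ENNReal.ofReal_le_ofReal (le_trans (le_of_eq ?_) ((hgr n).trans hn.le))
    refine integral_congr_ae ?_
    filter_upwards [hb t ht] with x hx
    rw [Real.norm_eq_abs, abs_of_nonneg (mul_nonneg hx.1 (pow_nonneg (hχ01 n x).1 6))]
  · refine Eventually.of_forall fun x => ?_
    refine tendsto_const_nhds.congr' ?_
    obtain ⟨n0, hn0⟩ := exists_nat_gt ‖x‖
    filter_upwards [eventually_ge_atTop n0] with n hn
    have : (n0 : ℝ) ≤ n := by exact_mod_cast hn
    rw [hχ1 n x (by linarith)]
    simp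

end Mass

/-! ### Nonlinear test functions built from the velocity -/

section TestFields

variable {Ω : Set E3} {β ε : ℝ}

theorem contDiff_nsq : ContDiff ℝ ∞ nsq := by
  unfold nsq
  refine ContDiff.sum fun k _ => ?_
  have : ContDiff ℝ ∞ fun v : E3 => v k := by fun_prop
  exact this.mul this

theorem neg_one_lt_nsq (v : E3) : -1 < nsq v := by linarith [nsq_nonneg v]

theorem contDiff_weight_nsq (hε : 0 < ε) (hε1 : ε ≤ 1) :
    ContDiff ℝ ∞ fun v : E3 => weight β ε (nsq v) :=
  (contDiffOn_weight hε hε1).comp_contDiff contDiff_nsq neg_one_lt_nsq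

theorem contDiff_weightPrim_nsq (hε : 0 < ε) (hε1 : ε ≤ 1) :
    ContDiff ℝ ∞ fun v : E3 => weightPrim β ε (nsq v) :=
  (contDiffOn_weightPrim hε hε1).comp_contDiff contDiff_nsq neg_one_lt_nsq

theorem continuous_weightDeriv_nsq (hε : 0 < ε) (hε1 : ε ≤ 1) :
    Continuous fun v : E3 => weightDeriv β ε (nsq v) :=
  continuous_iff_continuousAt.2 fun v =>
    (continuousAt_weightDeriv hε hε1 (neg_one_lt_nsq v)).comp
      (f := nsq) contDiff_nsq.continuous.continuousAt

theorem IsTest.comp_left {φ : E3 → E3} (hφ : IsTest Ω φ) {F : E3 → ℝ} (hF : ContDiff ℝ ∞ F)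
    (h0 : F 0 = 0) : IsTest Ω fun x => F (φ x) :=
  ⟨hF.comp hφ.1, hφ.2.1.comp_left h0,
    (closure_mono (Function.support_comp_subset h0 φ)).trans hφ.2.2⟩

theorem pd_mul {f g : E3 → ℝ} {x : E3} (hf : DifferentiableAt ℝ f x) (hg : DifferentiableAt ℝ g x)
    (j : Fin 3) : pd j (fun y => f y * g y) x = f x * pd j g x + g x * pd j f x := by
  unfold pd
  rw [fderiv_fun_mul hf hg]
  rfl

theorem pd_sum {ι : Type*} (s : Finset ι) {f : ι → E3 → ℝ} {x : E3}
    (hf : ∀ i ∈ s, DifferentiableAt ℝ (f i) x) (j : Fin 3) :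
    pd j (fun y => ∑ i ∈ s, f i y) x = ∑ i ∈ s, pd j (f i) x := by
  unfold pd
  rw [fderiv_fun_sum hf]
  simp

theorem pd_nsq {φ : E3 → E3} (hφ : Differentiable ℝ φ) (j : Fin 3) (x : E3) :
    pd j (fun y => nsq (φ y)) x = 2 * ∑ k, φ x k * jac φ x (k, j) := by
  have hk := fun k => differentiable_coord hφ k x
  have hs := pd_sum Finset.univ (f := fun k y => φ y k * φ y k) (x := x)
    (fun k _ => (hk k).fun_mul (hk k)) j
  unfold nsq
  rw [hs, Finset.mul_sum]
  refine Finset.sum_congr rfl fun k _ => ?_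
  rw [pd_mul (hk k) (hk k)]
  change _ = 2 * (φ x k * pd j (fun y => φ y k) x)
  ring

theorem differentiable_nsq_comp {φ : E3 → E3} (hφ : Differentiable ℝ φ) :
    Differentiable ℝ fun y => nsq (φ y) :=
  (contDiff_nsq.differentiable (by simp)).comp hφ

theorem pd_weight_mul {φ : E3 → E3} (hε : 0 < ε) (hε1 : ε ≤ 1) (hφ : Differentiable ℝ φ)
    (i j : Fin 3) (x : E3) :
    pd j (fun y => weight β ε (nsq (φ y)) * φ y i) x
      = weightedJac (weight β ε (nsq (φ x))) (weightDeriv β ε (nsq (φ x))) (φ x) (jac φ x) i j := by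
  have hn := differentiable_nsq_comp hφ x
  have hw := hasDerivAt_weight (β := β) hε hε1 (neg_one_lt_nsq (φ x))
  have hWd : Differentiable ℝ fun y => weight β ε (nsq (φ y)) :=
    ((contDiff_weight_nsq hε hε1).differentiable (by simp)).comp hφ
  rw [pd_mul (hWd x) (differentiable_coord hφ i x),
    pd_comp hn hw, pd_nsq hφ]
  change _ * pd j (fun y => φ y i) x + _ = _
  unfold weightedJac
  change _ = _ * pd j (fun y => φ y i) x + _
  ring

/-- The function is the partial derivative of the energy density in `ρ` at fixed momentum.
Differentiating the product produces a term `g Σ φᵢ ∂ⱼφᵢ` that cancels the derivative of half the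
primitive. -/
theorem pd_weightPrim_sub {φ : E3 → E3} (hε : 0 < ε) (hε1 : ε ≤ 1) (hφ : Differentiable ℝ φ)
    (j : Fin 3) (x : E3) :
    pd j (fun y => 1 / 2 * weightPrim β ε (nsq (φ y))
        + -1 * ∑ i, φ y i * (weight β ε (nsq (φ y)) * φ y i)) x
      = - ∑ i, φ x i * weightedJac (weight β ε (nsq (φ x))) (weightDeriv β ε (nsq (φ x)))
          (φ x) (jac φ x) i j := by
  have hn := differentiable_nsq_comp hφ
  have hP : ∀ y, HasDerivAt (weightPrim β ε) (weight β ε (nsq (φ y))) (nsq (φ y)) := fun y =>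
    hasDerivAt_weightPrim hε hε1 (neg_one_lt_nsq (φ y))
  have hPd : Differentiable ℝ fun y => weightPrim β ε (nsq (φ y)) :=
    ((contDiff_weightPrim_nsq hε hε1).differentiable (by simp)).comp hφ
  have hWd : Differentiable ℝ fun y => weight β ε (nsq (φ y)) :=
    ((contDiff_weight_nsq hε hε1).differentiable (by simp)).comp hφ
  have hk := fun k => differentiable_coord hφ k
  have hψ : ∀ i, Differentiable ℝ fun y => weight β ε (nsq (φ y)) * φ y i := fun i =>
    hWd.mul (hk i)
  have hs : Differentiable ℝ fun y => ∑ i, φ y i * (weight β ε (nsq (φ y)) * φ y i) :=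
    Differentiable.fun_sum fun i _ => (hk i).mul (hψ i)
  have hadd : pd j (fun y => 1 / 2 * weightPrim β ε (nsq (φ y))
        + -1 * ∑ i, φ y i * (weight β ε (nsq (φ y)) * φ y i)) x
      = pd j (fun y => 1 / 2 * weightPrim β ε (nsq (φ y))) x
        + pd j (fun y => -1 * ∑ i, φ y i * (weight β ε (nsq (φ y)) * φ y i)) x := by
    unfold pd
    rw [fderiv_fun_add ((hPd x).const_mul _) ((hs x).const_mul _)]
    rfl
  have hsum := pd_sum Finset.univ (f := fun i y => φ y i * (weight β ε (nsq (φ y)) * φ y i)) (x := x)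
    (fun i _ => ((hk i).fun_mul (hψ i)) x) j
  rw [hadd, pd_const_mul hPd, pd_const_mul hs, pd_comp (hn x) (hP x), pd_nsq hφ, hsum]
  have : ∀ i, pd j (fun y => φ y i * (weight β ε (nsq (φ y)) * φ y i)) x
      = φ x i * weightedJac (weight β ε (nsq (φ x))) (weightDeriv β ε (nsq (φ x)))
          (φ x) (jac φ x) i j + weight β ε (nsq (φ x)) * (φ x i * jac φ x (i, j)) := fun i => by
    rw [pd_mul (hk i x) (hψ i x), pd_weight_mul hε hε1 hφ]
    change _ + _ * pd j (fun y => φ y i) x = _ + _ * (_ * pd j (fun y => φ y i) x)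
    ring
  simp_rw [this]
  rw [Finset.sum_add_distrib, ← Finset.mul_sum]
  ring

theorem LpTendsto.nsq {κ : Type*} {ν : Measure E3} {l : Filter κ} {f : κ → E3 → E3} {g : E3 → E3}
    (h : LpTendsto 6 ν l f g) : LpTendsto 3 ν l (fun n x => nsq (f n x)) fun x => nsq (g x) :=
  LpTendsto.sum _ (by norm_num) fun k _ => (h.coord k).mul (by norm_num) (h.coord k)

/-- For fixed `ε` the primitive is Lipschitz with constant `ε^{-β}`, so it preserves the `L³`
convergence of the squared speed. -/
theorem LpTendsto.weightPrim_nsq (hβ : 0 ≤ β) (hε : 0 < ε) (hε1 : ε ≤ 1) {κ : Type*}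
    {ν : Measure E3} {l : Filter κ} {f : κ → E3 → E3} {g : E3 → E3}
    (h : LpTendsto 6 ν l f g) :
    LpTendsto 3 ν l (fun n x => weightPrim β ε (_root_.nsq (f n x)))
      fun x => weightPrim β ε (_root_.nsq (g x)) := by
  have hc := (contDiff_weightPrim_nsq (β := β) hε hε1).continuous
  refine h.nsq.of_le ?_ (h.ev.mono fun n hn => hc.comp_aestronglyMeasurable hn.1) ((1 / ε) ^ β)
    (Eventually.of_forall fun n => Eventually.of_forall fun x =>
      abs_weightPrim_sub_le hβ hε hε1 (nsq_nonneg _) (nsq_nonneg _))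
  refine h.nsq.lim_mem.of_le_mul (c := (1 / ε) ^ β) (hc.comp_aestronglyMeasurable h.lim_mem.1)
    (Eventually.of_forall fun x => ?_)
  simpa [weightPrim_zero] using
    abs_weightPrim_sub_le (y := _root_.nsq (g x)) hβ hε hε1 (nsq_nonneg _) le_rfl

theorem abs_mul_coord_le_nsq (v : E3) (k i : Fin 3) : |v k * v i| ≤ nsq v := by
  rw [abs_mul, nsq_eq_norm_sq, sq]
  exact mul_le_mul (PiLp.norm_apply_le v k) (PiLp.norm_apply_le v i) (abs_nonneg _) (norm_nonneg _)

/-- The nonlinear test functions built from a velocity field vanishing on the boundary are limits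
of test functions, together with their derivatives. -/
theorem MemD10.exists_weighted_tests (hβ : 0 ≤ β) (hε : 0 < ε) (hε1 : ε ≤ 1) {v : E3 → E3}
    {A : E3 → Mat3} (h : MemD10 Ω v A) :
    ∃ (χ : ℕ → E3 → ℝ) (ψ : ℕ → Fin 3 → E3 → ℝ), (∀ n, IsTest Ω (χ n)) ∧
      (∀ n i, IsTest Ω (ψ n i)) ∧
      LpTendsto 3 (vol Ω) atTop χ (fun x => 1 / 2 * weightPrim β ε (nsq (v x))
        + -1 * ∑ i, v x i * (weight β ε (nsq (v x)) * v x i)) ∧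
      (∀ i, LpTendsto 6 (vol Ω) atTop (fun n => ψ n i)
        fun x => weight β ε (nsq (v x)) * v x i) ∧
      (∀ i j, LpTendsto 2 (vol Ω) atTop (fun n => pd j (ψ n i)) fun x =>
        weightedJac (weight β ε (nsq (v x))) (weightDeriv β ε (nsq (v x))) (v x) (A x) i j) ∧
      ∀ j, LpTendsto (3 / 2) (vol Ω) atTop (fun n => pd j (χ n)) fun x =>
        - ∑ i, v x i *
          weightedJac (weight β ε (nsq (v x))) (weightDeriv β ε (nsq (v x))) (v x) (A x) i j := by
  obtain ⟨φ', ht', h6', h2'⟩ := memD10_lpTendsto h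
  -- Almost everywhere convergence along a subsequence is needed for the nonlinear coefficients,
  -- which multiply the `L²` convergent Jacobians.
  obtain ⟨ns, hns, hae'⟩ := h6'.exists_seq_ae (by norm_num)
    fun n => (ht' n).aestronglyMeasurable _
  set φ : ℕ → E3 → E3 := fun n => φ' (ns n) with hφ
  have ht : ∀ n, IsTest Ω (φ n) := fun n => ht' _
  have h6 : LpTendsto 6 (vol Ω) atTop φ v := h6'.comp_tendsto hns.tendsto_atTop
  have h2 : LpTendsto 2 (vol Ω) atTop (fun n => jac (φ n)) A := h2'.comp_tendsto hns.tendsto_atTop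
  have hae : ∀ᵐ x ∂(vol Ω), Tendsto (fun n => φ n x) atTop (𝓝 (v x)) := hae'
  have hd : ∀ n, Differentiable ℝ (φ n) := fun n => (ht n).1.differentiable (by simp)
  have hcW := (contDiff_weight_nsq (β := β) hε hε1)
  have hcP := (contDiff_weightPrim_nsq (β := β) hε hε1)
  have hcD := (continuous_weightDeriv_nsq (β := β) hε hε1)
  have hcoord : ∀ i : Fin 3, ContDiff ℝ ∞ fun w : E3 => w i := fun i => by fun_prop
  have hone : (1 : ℝ≥0∞) ≤ 3 / 2 := by
    rw [ENNReal.le_div_iff_mul_le (by simp) (by simp)]; norm_num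
  have t6 : ∀ i, LpTendsto 6 (vol Ω) atTop (fun n x => weight β ε (nsq (φ n x)) * φ n x i)
      fun x => weight β ε (nsq (v x)) * v x i := by
    intro i
    refine (h6.coord i).bdd_mul ((1 / ε) ^ β) (by norm_num) (by simp)
      (fun n => (hcW.continuous.comp (ht n).1.continuous).aestronglyMeasurable)
      (fun n => Eventually.of_forall fun x => ?_) ?_
    · rw [abs_of_pos (weight_pos hε (nsq_nonneg _))]
      exact weight_le hβ hε hε1 (nsq_nonneg _)
    · filter_upwards [hae] with x hx using (hcW.continuous.tendsto _).comp hx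
  have t2 : ∀ i j, LpTendsto 2 (vol Ω) atTop
      (fun n x => weightedJac (weight β ε (nsq (φ n x))) (weightDeriv β ε (nsq (φ n x)))
        (φ n x) (jac (φ n) x) i j) fun x =>
      weightedJac (weight β ε (nsq (v x))) (weightDeriv β ε (nsq (v x))) (v x) (A x) i j := by
    intro i j
    have e1 : LpTendsto 2 (vol Ω) atTop (fun n x => weight β ε (nsq (φ n x)) * jac (φ n) x (i, j))
        fun x => weight β ε (nsq (v x)) * A x (i, j) := by
      refine (h2.coord (i, j)).bdd_mul ((1 / ε) ^ β) (by norm_num) (by simp)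
        (fun n => (hcW.continuous.comp (ht n).1.continuous).aestronglyMeasurable)
        (fun n => Eventually.of_forall fun x => ?_) ?_
      · rw [abs_of_pos (weight_pos hε (nsq_nonneg _))]
        exact weight_le hβ hε hε1 (nsq_nonneg _)
      · filter_upwards [hae] with x hx using (hcW.continuous.tendsto _).comp hx
    -- The coefficient is quadratic in the velocity yet bounded, since `|wₖwᵢ| ≤ |w|²` and `z g' ≤ β
    -- g ≤ β ε^{-β}`.
    have e2 : ∀ k, LpTendsto 2 (vol Ω) atTop
        (fun n x => (2 * weightDeriv β ε (nsq (φ n x)) * (φ n x k * φ n x i)) * jac (φ n) x (k, j))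
        fun x => (2 * weightDeriv β ε (nsq (v x)) * (v x k * v x i)) * A x (k, j) := by
      intro k
      have hcc : Continuous fun w : E3 => 2 * weightDeriv β ε (nsq w) * (w k * w i) :=
        (continuous_const.mul hcD).mul ((hcoord k).continuous.mul (hcoord i).continuous)
      refine (h2.coord (k, j)).bdd_mul (2 * β * (1 / ε) ^ β) (by norm_num) (by simp)
        (fun n => (hcc.comp (ht n).1.continuous).aestronglyMeasurable)
        (fun n => Eventually.of_forall fun x => ?_) ?_
      · have h0 := weightDeriv_nonneg hβ hε hε1 (nsq_nonneg (φ n x))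
        rw [abs_mul, abs_of_nonneg (by positivity)]
        have a1 := mul_le_mul_of_nonneg_left (abs_mul_coord_le_nsq (φ n x) k i) h0
        have a2 := mul_weightDeriv_le hβ hε (nsq_nonneg (φ n x))
        have a3 := mul_le_mul_of_nonneg_left (weight_le hβ hε hε1 (nsq_nonneg (φ n x))) hβ
        linarith
      · filter_upwards [hae] with x hx using (hcc.tendsto _).comp hx
    refine (e1.add (by norm_num) (LpTendsto.sum Finset.univ (by norm_num) fun k _ => e2 k)).congr
      (Eventually.of_forall fun n => Eventually.of_forall fun x => ?_)
      (Eventually.of_forall fun x => ?_)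
    · simp only [weightedJac, Fin.sum_univ_three]; ring
    · simp only [weightedJac, Fin.sum_univ_three]; ring
  refine ⟨fun n x => 1 / 2 * weightPrim β ε (nsq (φ n x))
      + -1 * ∑ i, φ n x i * (weight β ε (nsq (φ n x)) * φ n x i),
    fun n i x => weight β ε (nsq (φ n x)) * φ n x i, fun n => ?_, fun n i => ?_, ?_, t6,
    fun i j => ?_, fun j => ?_⟩
  · refine (ht n).comp_left (F := fun w => 1 / 2 * weightPrim β ε (nsq w)
      + -1 * ∑ i, w i * (weight β ε (nsq w) * w i)) ?_ (by simp [nsq, weightPrim_zero])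
    exact (contDiff_const.mul hcP).add (contDiff_const.mul (ContDiff.sum fun i _ =>
      (hcoord i).mul (hcW.mul (hcoord i))))
  · exact (ht n).comp_left (F := fun w => weight β ε (nsq w) * w i) (hcW.mul (hcoord i)) (by simp)
  · exact ((h6.weightPrim_nsq hβ hε hε1).const_mul (1 / 2)).add (by norm_num)
      ((LpTendsto.sum Finset.univ (by norm_num) fun i _ =>
        (h6.coord i).mul (by norm_num) (t6 i)).const_mul (-1))
  · refine (t2 i j).congr (Eventually.of_forall fun n => Eventually.of_forall fun x => ?_)
      (Eventually.of_forall fun x => rfl)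
    exact (pd_weight_mul hε hε1 (hd n) i j x).symm
  · refine (LpTendsto.sum Finset.univ hone fun i _ =>
      (h6.coord i).mul hone (t2 i j)).neg.congr
      (Eventually.of_forall fun n => Eventually.of_forall fun x => ?_)
      (Eventually.of_forall fun x => rfl)
    exact (pd_weightPrim_sub hε hε1 (hd n) j x).symm

end TestFields

/-! ### The regularized energy inequality -/

section Energy

variable {Ω : Set E3} {μ lam a γ q T M m β ε : ℝ} {ρ : ℝ → E3 → ℝ} {u : ℝ → E3 → E3}
  {Dρ : ℝ → E3 → E3} {Du : ℝ → E3 → Mat3} {D2u : ℝ → E3 → Tens3}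

/-- Only a uniform bound in `L¹` is available, not continuity; interpolating with continuity in `L²`
reaches the exponent dual to that of `|u|²`. -/
theorem ContInLp.density_three_halves (h : ContInLp T Ω 2 ρ)
    (hm : ∀ t ∈ Ico 0 T, eLpNorm (ρ t) 1 (vol Ω) ≤ ENNReal.ofReal m) :
    ContInLp T Ω (3 / 2) ρ :=
  contInLp_of_lpTendsto fun s hs => (h.lpTendsto hs).three_halves_of_two (ENNReal.ofReal m)
    ENNReal.ofReal_ne_top (eventually_ico hm) (hm s hs)

/-- The regularized energy, which approximates a multiple of `∫ ρ |u|^(2β + 2)`. -/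
noncomputable def energy (Ω : Set E3) (β ε : ℝ) (ρ : ℝ → E3 → ℝ) (u : ℝ → E3 → E3) (t : ℝ) : ℝ :=
  ∫ x in Ω, ρ t x * (1 / 2 * weightPrim β ε (nsq (u t x)))

/-- The rate of change of `energy`. -/
noncomputable def energyRate (Ω : Set E3) (μ lam a γ β ε : ℝ) (ρ : ℝ → E3 → ℝ) (u : ℝ → E3 → E3)
    (Du : ℝ → E3 → Mat3) (t : ℝ) : ℝ :=
  ∑ j, (∫ x in Ω, (ρ t x * u t x j) * (- ∑ i, u t x i * weightedJac (weight β ε (nsq (u t x)))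
      (weightDeriv β ε (nsq (u t x))) (u t x) (Du t x) i j))
    + ∑ i, ∑ j, ∫ x in Ω, flux μ lam a γ ρ u Du i j t x * weightedJac (weight β ε (nsq (u t x)))
      (weightDeriv β ε (nsq (u t x))) (u t x) (Du t x) i j

theorem IsStrongSolution.contInLp_energyDensity (hβ : 0 ≤ β) (hε : 0 < ε) (hε1 : ε ≤ 1)
    (h : IsStrongSolution Ω μ lam a γ q T ρ u Dρ Du D2u) :
    ContInLp T Ω 3 fun t x => 1 / 2 * weightPrim β ε (nsq (u t x)) :=
  contInLp_of_lpTendsto fun _ hs =>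
    ((h.contInLp_u.lpTendsto hs).weightPrim_nsq hβ hε hε1).const_mul (1 / 2)

theorem IsStrongSolution.continuousOn_energy (hβ : 0 ≤ β) (hε : 0 < ε) (hε1 : ε ≤ 1)
    (h : IsStrongSolution Ω μ lam a γ q T ρ u Dρ Du D2u)
    (hm : ∀ t ∈ Ico 0 T, eLpNorm (ρ t) 1 (vol Ω) ≤ ENNReal.ofReal m) :
    ContinuousOn (energy Ω β ε ρ u) (Ico 0 T) := fun _ hs =>
  ((h.contρ_two.density_three_halves hm).lpTendsto hs).integral_mul
    ((h.contInLp_energyDensity hβ hε hε1).lpTendsto hs)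

/-- By convexity of the density `(ρ, ρu) ↦ ρ Φ(u)`, the backward slopes of the energy are
controlled without any time derivative of the velocity. -/
theorem IsStrongSolution.energy_slope_le (hγ : 1 < γ) (hβ : 0 ≤ β) (hε : 0 < ε) (hε1 : ε ≤ 1)
    (h : IsStrongSolution Ω μ lam a γ q T ρ u Dρ Du D2u)
    (hb : ∀ t ∈ Ico 0 T, ∀ᵐ x ∂(vol Ω), 0 ≤ ρ t x ∧ ρ t x ≤ M)
    (hm : ∀ t ∈ Ico 0 T, eLpNorm (ρ t) 1 (vol Ω) ≤ ENNReal.ofReal m)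
    {t : ℝ} (ht : t ∈ Ioo 0 T) {δ : ℝ} (hδ : 0 < δ) :
    ∀ᶠ s in 𝓝[<] t, energy Ω β ε ρ u t - energy Ω β ε ρ u s
      ≤ (t - s) * (energyRate Ω μ lam a γ β ε ρ u Du t + δ) := by
  have htI := Ioo_subset_Ico_self ht
  have hρ := h.contρ_two.density_three_halves hm
  obtain ⟨χ, ψ, hχ, hψ, lχ, lψ, lw, lz⟩ := (h.memD10 t htI).exists_weighted_tests hβ hε hε1
  set χ0 : E3 → ℝ := fun x => 1 / 2 * weightPrim β ε (nsq (u t x))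
        + -1 * ∑ i, u t x i * (weight β ε (nsq (u t x)) * u t x i) with hχ0
  set ψ0 : Fin 3 → E3 → ℝ := fun i x => weight β ε (nsq (u t x)) * u t x i with hψ0
  set R := energyRate Ω μ lam a γ β ε ρ u Du t with hR
  -- the pairing with the test functions, and its time derivative
  set A : ℕ → ℝ → ℝ := fun n s => (∫ x in Ω, ρ s x * χ n x)
    + ∑ i, ∫ x in Ω, (ρ s x * u s x i) * ψ n i x with hA
  set A' : ℕ → ℝ → ℝ := fun n s => (∑ j, ∫ x in Ω, (ρ s x * u s x j) * pd j (χ n) x)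
    + ∑ i, ∑ j, ∫ x in Ω, flux μ lam a γ ρ u Du i j s x * pd j (ψ n i) x with hA'
  have hAd : ∀ n, ∀ s ∈ Ioo 0 T, HasDerivAt (A n) (A' n s) s := fun n s hs =>
    (h.hasDerivAt_mass hb (hχ n) hs).add
      (HasDerivAt.fun_sum fun i _ => h.hasDerivAt_momentum hγ hb i (hψ n i) hs)
  -- Convergence is joint in `n → ∞` and `s → t`, because each integral pairs a factor depending
  -- only on `s` with one depending only on `n`. Hence a single neighbourhood of `t` serves all
  -- large `n`.
  have hjoint : Tendsto (fun p : ℕ × ℝ => A' p.1 p.2) (atTop ×ˢ 𝓝[Ico 0 T] t) (𝓝 R) := by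
    refine Tendsto.add (tendsto_finsetSum _ fun j _ => ?_)
      (tendsto_finsetSum _ fun i _ => tendsto_finsetSum _ fun j _ => ?_)
    · exact (((h.contInLp_momentum hb j).lpTendsto htI).comp_tendsto tendsto_snd).integral_mul
        ((lz j).comp_tendsto tendsto_fst)
    · exact (((h.contInLp_flux hγ hb i j).lpTendsto htI).comp_tendsto tendsto_snd).integral_mul
        ((lw i j).comp_tendsto tendsto_fst)
  obtain ⟨pa, hpa, pb, hpb, hab⟩ := Filter.eventually_prod_iff.1
    (hjoint.eventually_lt_const (lt_add_of_pos_right R hδ))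
  rw [nhdsWithin_eq_nhds.2 (Ico_mem_nhds ht.1 ht.2)] at hpb
  obtain ⟨η, hη, hball⟩ := Metric.eventually_nhds_iff.1 hpb
  have hlt : max 0 (t - η) < t := max_lt ht.1 (by linarith)
  filter_upwards [Ioo_mem_nhdsLT hlt] with s hs
  have hs0 : 0 < s := (le_max_left _ _).trans_lt hs.1
  have hsη : t - η < s := (le_max_right _ _).trans_lt hs.1
  have hsI : s ∈ Ico 0 T := ⟨hs0.le, hs.2.trans ht.2⟩
  -- The mean value theorem is applied before the limit in `n`: the limiting pairing is not claimed
  -- to be differentiable.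
  have hmvt : ∀ᶠ n in atTop, A n t - A n s ≤ (t - s) * (R + δ) := by
    filter_upwards [hpa] with n hn
    have hsub : ∀ τ ∈ Icc s t, τ ∈ Ioo 0 T := fun τ hτ =>
      ⟨hs0.trans_le hτ.1, hτ.2.trans_lt ht.2⟩
    obtain ⟨ξ, hξ, he⟩ := exists_hasDerivAt_eq_slope (A n) (A' n) hs.2
      (fun τ hτ => (hAd n τ (hsub τ hτ)).continuousAt.continuousWithinAt)
      (fun τ hτ => hAd n τ (hsub τ (Ioo_subset_Icc_self hτ)))
    have hlt' : A' n ξ < R + δ := hab hn (hball (by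
      rw [Real.dist_eq, abs_lt]; constructor <;> linarith [hξ.1, hξ.2]))
    have hts : 0 < t - s := sub_pos.2 hs.2
    rw [he, div_lt_iff₀ hts] at hlt'
    linarith
  set A0 : ℝ → ℝ := fun s => (∫ x in Ω, ρ s x * χ0 x)
    + ∑ i, ∫ x in Ω, ρ s x * (u s x i * ψ0 i x) with hA0
  have hAlim : ∀ τ ∈ Ico 0 T, Tendsto (fun n => A n τ) atTop (𝓝 (A0 τ)) := fun τ hτ => by
    refine Tendsto.add ((LpTendsto.const (hρ.1 τ hτ)).integral_mul lχ)
      (tendsto_finsetSum _ fun i _ => ?_)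
    have := (LpTendsto.const (l := atTop (α := ℕ)) (hρ.1 τ hτ)).integral_mul
      ((LpTendsto.const (l := atTop (α := ℕ)) ((h.contInLp_u.coord i).1 τ hτ)).mul
        (r := 3) (by norm_num) (lψ i))
    simpa only [mul_assoc] using this
  have hslope : A0 t - A0 s ≤ (t - s) * (R + δ) :=
    le_of_tendsto ((hAlim t htI).sub (hAlim s hsI)) hmvt
  have iχ : ∀ τ ∈ Ico 0 T, Integrable (fun x => ρ τ x * χ0 x) (vol Ω) := fun τ hτ =>
    memLp_one_iff_integrable.1 (lχ.lim_mem.mul' (hρ.1 τ hτ))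
  have iψ : ∀ τ ∈ Ico 0 T, ∀ i, Integrable (fun x => ρ τ x * (u τ x i * ψ0 i x)) (vol Ω) :=
    fun τ hτ i => by
      have h3 : MemLp (fun x => u τ x i * ψ0 i x) 3 (vol Ω) :=
        (lψ i).lim_mem.mul' ((h.contInLp_u.coord i).1 τ hτ)
      exact memLp_one_iff_integrable.1 (h3.mul' (hρ.1 τ hτ))
  have hA0eq : ∀ τ ∈ Ico 0 T, A0 τ = ∫ x in Ω, (ρ τ x * χ0 x + ∑ i, ρ τ x * (u τ x i * ψ0 i x)) :=
    fun τ hτ => by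
      rw [integral_add (iχ τ hτ) (integrable_finsetSum _ fun i _ => iψ τ hτ i),
        integral_finsetSum _ fun i _ => iψ τ hτ i]
  have hEt : energy Ω β ε ρ u t = A0 t := by
    rw [hA0eq t htI]
    refine integral_congr_ae (Eventually.of_forall fun x => ?_)
    simp only [hχ0, hψ0, ← Finset.mul_sum]
    ring
  -- The supporting hyperplane at `u t` lies below the energy density at `u s`. This combines
  -- convexity of the primitive with `|u s - u t|² ≥ 0`, and the nonnegative factor `ρ s` preserves
  -- the inequality.
  have hEs : A0 s ≤ energy Ω β ε ρ u s := by
    rw [hA0eq s hsI]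
    refine integral_mono_ae ((iχ s hsI).add (integrable_finsetSum _ fun i _ => iψ s hsI i))
      (memLp_one_iff_integrable.1
        (((h.contInLp_energyDensity hβ hε hε1).1 s hsI).mul' (hρ.1 s hsI))) ?_
    filter_upwards [hb s hsI] with x hx
    simp only [hχ0, hψ0, ← Finset.mul_sum]
    rw [← mul_add]
    refine mul_le_mul_of_nonneg_left ?_ hx.1
    have hcv := weightPrim_convex hβ hε hε1 (nsq_nonneg (u s x)) (nsq_nonneg (u t x))
    have hw := (weight_pos (β := β) hε (nsq_nonneg (u t x))).le
    have hpol : 0 ≤ weight β ε (nsq (u t x)) * ∑ i, (u s x i - u t x i) ^ 2 :=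
      mul_nonneg hw (Finset.sum_nonneg fun i _ => sq_nonneg _)
    have hexp : ∑ i, (u s x i - u t x i) ^ 2
        = nsq (u s x) + nsq (u t x) - 2 * ∑ i, u s x i * u t x i := by
      simp only [nsq, Fin.sum_univ_three]; ring
    have e1 : ∑ i, u t x i * (weight β ε (nsq (u t x)) * u t x i)
        = weight β ε (nsq (u t x)) * nsq (u t x) := by
      simp only [nsq, Finset.mul_sum]
      exact Finset.sum_congr rfl fun i _ => by ring
    have e2 : ∑ i, u s x i * (weight β ε (nsq (u t x)) * u t x i)
        = weight β ε (nsq (u t x)) * ∑ i, u s x i * u t x i := by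
      simp only [Finset.mul_sum]
      exact Finset.sum_congr rfl fun i _ => by ring
    rw [e1, e2]
    rw [hexp] at hpol
    nlinarith
  linarith

/-- The viscous terms are coercive, so only the pressure contributes to the growth. -/
theorem IsStrongSolution.energyRate_le {κ c : ℝ} (hL : 0 < μ + lam) (hc : 0 < c)
    (hcμ : c ≤ μ) (hκ : κ = 2 * β)
    (hck : c ≤ μ * (1 + κ) - (μ + lam) * κ ^ 2 / 4) (ha : 0 < a) (hγ : 1 < γ) (hβ : 0 ≤ β)
    (hβ1 : β ≤ 1) (hε : 0 < ε) (hε1 : ε ≤ 1) (hm0 : 0 ≤ m)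
    (h : IsStrongSolution Ω μ lam a γ q T ρ u Dρ Du D2u)
    (hb : ∀ t ∈ Ico 0 T, ∀ᵐ x ∂(vol Ω), 0 ≤ ρ t x ∧ ρ t x ≤ M) (hM : 0 ≤ M)
    (hm : ∀ t ∈ Ico 0 T, eLpNorm (ρ t) 1 (vol Ω) ≤ ENNReal.ofReal m)
    {t : ℝ} (ht : t ∈ Ioo 0 T) :
    energyRate Ω μ lam a γ β ε ρ u Du t ≤
      (6 + 2 * κ ^ 2) / (4 * c) * a ^ 2 * M ^ (2 * γ - 1) * 4 * (energy Ω β ε ρ u t + m) := by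
  have htI := Ioo_subset_Ico_self ht
  have hρ := h.contρ_two.density_three_halves hm
  obtain ⟨_, _, _, _, _, _, lw, lz⟩ := (h.memD10 t htI).exists_weighted_tests hβ hε hε1
  set K := (6 + 2 * κ ^ 2) / (4 * c) * a ^ 2 * M ^ (2 * γ - 1) with hK
  have hK0 : 0 ≤ K := by positivity
  have hi1 : Integrable (ρ t) (vol Ω) :=
    memLp_one_iff_integrable.1 ⟨(hρ.1 t htI).1, (hm t htI).trans_lt ENNReal.ofReal_lt_top⟩
  have hi2 : Integrable (fun x => ρ t x * (1 / 2 * weightPrim β ε (nsq (u t x)))) (vol Ω) :=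
    memLp_one_iff_integrable.1
      (((h.contInLp_energyDensity hβ hε hε1).1 t htI).mul' (hρ.1 t htI))
  have hmass : ∫ x in Ω, ρ t x ≤ m := by
    have : ∫ x in Ω, ρ t x ≤ ∫ x in Ω, ‖ρ t x‖ :=
      integral_mono hi1 hi1.norm fun x => le_abs_self _
    refine this.trans ?_
    rw [integral_norm_eq_lintegral_enorm hi1.1, ← eLpNorm_one_eq_lintegral_enorm]
    exact ENNReal.toReal_le_of_le_ofReal hm0 (hm t htI)
  have j1 : ∀ j, Integrable (fun x => (ρ t x * u t x j) * (- ∑ i, u t x i * weightedJac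
      (weight β ε (nsq (u t x))) (weightDeriv β ε (nsq (u t x))) (u t x) (Du t x) i j)) (vol Ω) :=
    fun j => memLp_one_iff_integrable.1
      ((lz j).lim_mem.mul' ((h.contInLp_momentum hb j).1 t htI))
  have j2 : ∀ i j, Integrable (fun x => flux μ lam a γ ρ u Du i j t x * weightedJac
      (weight β ε (nsq (u t x))) (weightDeriv β ε (nsq (u t x))) (u t x) (Du t x) i j) (vol Ω) :=
    fun i j => memLp_one_iff_integrable.1
      ((lw i j).lim_mem.mul' ((h.contInLp_flux hγ hb i j).1 t htI))
  have j3 := fun i => integrable_finsetSum (μ := vol Ω) Finset.univ fun j _ => j2 i j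
  have hrate : energyRate Ω μ lam a γ β ε ρ u Du t ≤
      ∫ x in Ω, K * (2 * ρ t x + 4 * (ρ t x * (1 / 2 * weightPrim β ε (nsq (u t x))))) := by
    unfold energyRate
    rw [← integral_finsetSum _ fun j _ => j1 j]
    simp_rw [← integral_finsetSum Finset.univ fun j _ => j2 _ j]
    rw [← integral_finsetSum _ fun i _ => j3 i, ← integral_add
      (integrable_finsetSum _ fun j _ => j1 j) (integrable_finsetSum _ fun i _ => j3 i)]
    refine integral_mono_ae ((integrable_finsetSum _ fun j _ => j1 j).add
      (integrable_finsetSum _ fun i _ => j3 i))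
      (((hi1.const_mul 2).add (hi2.const_mul 4)).const_mul K) ?_
    filter_upwards [hb t htI] with x hx
    have hn := nsq_nonneg (u t x)
    have hkk : 2 * weightDeriv β ε (nsq (u t x)) * nsq (u t x)
        ≤ κ * weight β ε (nsq (u t x)) := by
      have := mul_weightDeriv_le hβ hε hn
      rw [hκ]; linarith
    have key := flux_pairing_le (g := weight β ε (nsq (u t x))) hL (by rw [hκ]; positivity)
      hc hcμ hck (weight_pos hε hn) (weightDeriv_nonneg hβ hε hε1 hn) (u t x) (Du t x) hkk (ρ t x)
      (a * ρ t x ^ γ)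
    refine key.trans ?_
    -- One power of the density is kept, so that the pressure term is controlled by mass and energy;
    -- the others are bounded by `M`.
    have hpow : (ρ t x ^ γ) ^ 2 ≤ M ^ (2 * γ - 1) * ρ t x := by
      have e1 : (ρ t x ^ γ) ^ 2 = ρ t x ^ (2 * γ - 1) * ρ t x := by
        rw [← Real.rpow_natCast, ← Real.rpow_mul hx.1]
        nth_rewrite 3 [← Real.rpow_one (ρ t x)]
        rw [← Real.rpow_add_of_nonneg hx.1 (by linarith) (by norm_num)]
        congr 1; push_cast; ring
      rw [e1]
      exact mul_le_mul_of_nonneg_right (Real.rpow_le_rpow hx.1 hx.2 (by linarith)) hx.1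
    have hwl := weight_le_weightPrim hβ hβ1 hε hε1 hn
    have hw := (weight_pos (β := β) hε hn).le
    have hMx : 0 ≤ M ^ (2 * γ - 1) * ρ t x := mul_nonneg (by positivity) hx.1
    calc (6 + 2 * κ ^ 2) / (4 * c) * (a * ρ t x ^ γ) ^ 2 * weight β ε (nsq (u t x))
        = (6 + 2 * κ ^ 2) / (4 * c) * a ^ 2 * ((ρ t x ^ γ) ^ 2 * weight β ε (nsq (u t x))) := by
          ring
      _ ≤ (6 + 2 * κ ^ 2) / (4 * c) * a ^ 2 * ((M ^ (2 * γ - 1) * ρ t x) *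
          (2 + 2 * weightPrim β ε (nsq (u t x)))) :=
        mul_le_mul_of_nonneg_left (mul_le_mul hpow hwl hw hMx) (by positivity)
      _ = _ := by rw [hK]; ring
  refine hrate.trans ?_
  rw [integral_const_mul, integral_add (hi1.const_mul 2) (hi2.const_mul 4), integral_const_mul,
    integral_const_mul, mul_assoc K 4]
  refine mul_le_mul_of_nonneg_left ?_ hK0
  change 2 * (∫ x in Ω, ρ t x) + 4 * energy Ω β ε ρ u t ≤ _
  linarith

/-- Sixth-power growth of the regularized density suffices, since only `u(0) ∈ L⁶`, finite mass and
bounded density are used. The bound is independent of `ε`. -/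
theorem IsStrongSolution.energy_zero_le (hT : 0 < T) (hβ : 0 ≤ β)
    (hβ1 : β ≤ 1) (hε : 0 < ε) (hε1 : ε ≤ 1) (hm0 : 0 ≤ m)
    (h : IsStrongSolution Ω μ lam a γ q T ρ u Dρ Du D2u)
    (hb : ∀ t ∈ Ico 0 T, ∀ᵐ x ∂(vol Ω), 0 ≤ ρ t x ∧ ρ t x ≤ M) (hM : 0 ≤ M)
    (hm : ∀ t ∈ Ico 0 T, eLpNorm (ρ t) 1 (vol Ω) ≤ ENNReal.ofReal m) {S : ℝ} (hS : 0 ≤ S)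
    (hu : eLpNorm (u 0) 6 (vol Ω) ≤ ENNReal.ofReal S) :
    energy Ω β ε ρ u 0 ≤ 2 * (m + M * S ^ 6) := by
  have h0 : (0 : ℝ) ∈ Ico 0 T := ⟨le_rfl, hT⟩
  have hρ := h.contρ_two.density_three_halves hm
  have hi1 : Integrable (ρ 0) (vol Ω) := memLp_one_iff_integrable.1 h.mass
  have hi2 : Integrable (fun x => ρ 0 x * (1 / 2 * weightPrim β ε (nsq (u 0 x)))) (vol Ω) :=
    memLp_one_iff_integrable.1
      (((h.contInLp_energyDensity hβ hε hε1).1 0 h0).mul' (hρ.1 0 h0))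
  have hi3 : Integrable (fun x => ‖u 0 x‖ ^ 6) (vol Ω) :=
    (h.contInLp_u.1 0 h0).integrable_norm_pow (by norm_num)
  have e1 : energy Ω β ε ρ u 0 ≤ ∫ x in Ω, 2 * (‖ρ 0 x‖ + M * ‖u 0 x‖ ^ 6) := by
    refine integral_mono_ae hi2 ((hi1.norm.add (hi3.const_mul M)).const_mul 2) ?_
    filter_upwards [hb 0 h0] with x hx
    have e2 := weightPrim_le_cube hβ hβ1 hε hε1 (nsq_nonneg (u 0 x))
    have e3 : nsq (u 0 x) ^ 3 = ‖u 0 x‖ ^ 6 := by rw [nsq_eq_norm_sq]; ring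
    rw [e3] at e2
    have e4 : ρ 0 x * (1 / 2 * weightPrim β ε (nsq (u 0 x)))
        ≤ ρ 0 x * (2 * (1 + ‖u 0 x‖ ^ 6)) := mul_le_mul_of_nonneg_left (by linarith) hx.1
    have e5 : ρ 0 x * ‖u 0 x‖ ^ 6 ≤ M * ‖u 0 x‖ ^ 6 :=
      mul_le_mul_of_nonneg_right hx.2 (by positivity)
    rw [Real.norm_eq_abs, abs_of_nonneg hx.1]
    linarith
  refine e1.trans ?_
  rw [integral_const_mul, integral_add hi1.norm (hi3.const_mul M), integral_const_mul,
    integral_norm_pow_six (h.contInLp_u.1 0 h0), integral_norm_eq_lintegral_enorm hi1.1,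
    ← eLpNorm_one_eq_lintegral_enorm]
  have e6 := ENNReal.toReal_le_of_le_ofReal hm0 (hm 0 h0)
  have e7 := ENNReal.toReal_le_of_le_ofReal hS hu
  gcongr

end Energy

/-! ### Strong measurability in time with values in `L¹` -/

section StrongMeasurability

variable {T : ℝ} {Ω : Set E3}

open Classical in
/-- The class of `f` in `L¹`, or zero if `f` is not integrable. -/
noncomputable def toL1 (Ω : Set E3) (f : E3 → ℝ) : Lp ℝ 1 (vol Ω) :=
  if h : MemLp f 1 (vol Ω) then h.toLp f else 0

theorem toL1_of_memLp {f : E3 → ℝ} (h : MemLp f 1 (vol Ω)) : toL1 Ω f = h.toLp f := dif_pos h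

theorem tendsto_toL1 {κ : Type*} {l : Filter κ} {f : κ → E3 → ℝ} {g : E3 → ℝ}
    (h : LpTendsto 1 (vol Ω) l f g) : Tendsto (fun n => toL1 Ω (f n)) l (𝓝 (toL1 Ω g)) := by
  rw [Lp.tendsto_Lp_iff_tendsto_eLpNorm']
  refine h.lim.congr' ?_
  filter_upwards [h.ev] with n hn
  rw [toL1_of_memLp hn, toL1_of_memLp h.lim_mem]
  exact (eLpNorm_congr_ae (hn.coeFn_toLp.sub h.lim_mem.coeFn_toLp)).symm

theorem ContInLp.aestronglyMeasurable_toL1 {f : ℝ → E3 → ℝ} (h : ContInLp T Ω 1 f) :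
    AEStronglyMeasurable (fun t => toL1 Ω (f t)) (volume.restrict (Ioo 0 T)) := by
  have : ContinuousOn (fun t => toL1 Ω (f t)) (Ico 0 T) := fun s hs => tendsto_toL1 (h.lpTendsto hs)
  exact (this.mono Ioo_subset_Ico_self).aestronglyMeasurable measurableSet_Ioo

theorem abs_min_rpow_sub_le {s x y : ℝ} (n : ℕ) (hs : 1 ≤ s) (hx : 0 ≤ x) (hy : 0 ≤ y) :
    |(min x n) ^ s - (min y n) ^ s| ≤ s * (n : ℝ) ^ (s - 1) * |x - y| := by
  have hn : (0 : ℝ) ≤ n := n.cast_nonneg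
  refine (abs_rpow_sub_rpow_le hs ⟨le_min hx hn, min_le_right _ _⟩
    ⟨le_min hy hn, min_le_right _ _⟩).trans ?_
  refine mul_le_mul_of_nonneg_left ?_ (by positivity)
  simpa using abs_min_sub_min_le_max x n y n

/-- If the integrals of `ρ |u|^r` are finite then `t ↦ ρ |u|^r` is strongly measurable. -/
theorem aestronglyMeasurable_density_mul_rpow {ρ : ℝ → E3 → ℝ} {u : ℝ → E3 → E3} {r : ℝ}
    (hr : 2 ≤ r) (hρ : ContInLp T Ω (3 / 2) ρ) (hu : ContInLp T Ω 6 u)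
    (hi : ∀ t ∈ Ioo 0 T, MemLp (fun x => ρ t x * ‖u t x‖ ^ r) 1 (vol Ω)) :
    AEStronglyMeasurable (fun t => toL1 Ω fun x => ρ t x * ‖u t x‖ ^ r)
      (volume.restrict (Ioo 0 T)) := by
  have hs : (1 : ℝ) ≤ r / 2 := by linarith
  have hsq : ∀ v : E3, nsq v ^ (r / 2) = ‖v‖ ^ r := fun v => by
    rw [nsq_eq_norm_sq, ← Real.rpow_natCast, ← Real.rpow_mul (norm_nonneg _)]
    congr 1; push_cast; ring
  have hc : ∀ n : ℕ, Continuous fun v : E3 => (min (nsq v) n) ^ (r / 2) := fun n =>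
    (Real.continuous_rpow_const (by linarith)).comp
      (contDiff_nsq.continuous.min continuous_const)
  -- Truncating the squared speed at height `n` makes the power Lipschitz in it, so the truncated
  -- density is continuous in time with values in `L¹`. The full density is its pointwise-in-time
  -- `L¹` limit by domination.
  have htr : ∀ n : ℕ, ContInLp T Ω 1 fun t x => ρ t x * (min (nsq (u t x)) n) ^ (r / 2) := by
    intro n
    refine ContInLp.mul (q := 3) le_rfl hρ (contInLp_of_lpTendsto fun s hs' => ?_)
    have h6 := hu.lpTendsto hs'
    refine h6.nsq.of_le ?_ (h6.ev.mono fun t ht => (hc n).comp_aestronglyMeasurable ht.1)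
      (r / 2 * (n : ℝ) ^ (r / 2 - 1)) (Eventually.of_forall fun t => Eventually.of_forall fun x =>
        abs_min_rpow_sub_le n hs (nsq_nonneg _) (nsq_nonneg _))
    refine h6.nsq.lim_mem.of_le_mul (c := r / 2 * (n : ℝ) ^ (r / 2 - 1))
      ((hc n).comp_aestronglyMeasurable h6.lim_mem.1) (Eventually.of_forall fun x => ?_)
    have := abs_min_rpow_sub_le n hs (nsq_nonneg (u s x)) le_rfl
    rwa [min_eq_left n.cast_nonneg, Real.zero_rpow (by linarith), sub_zero, sub_zero] at this
  refine aestronglyMeasurable_of_tendsto_ae atTop (fun n => (htr n).aestronglyMeasurable_toL1) ?_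
  refine (ae_restrict_iff' measurableSet_Ioo).2 (Eventually.of_forall fun t ht => tendsto_toL1 ?_)
  refine ⟨Eventually.of_forall fun n => (htr n).1 t (Ioo_subset_Ico_self ht), hi t ht, ?_⟩
  have key := tendsto_lintegral_norm_of_dominated_convergence (μ := vol Ω)
    (F := fun (n : ℕ) x => ρ t x * (min (nsq (u t x)) n) ^ (r / 2))
    (f := fun x => ρ t x * ‖u t x‖ ^ r) (bound := fun x => ‖ρ t x * ‖u t x‖ ^ r‖)
    (fun n => ((htr n).1 t (Ioo_subset_Ico_self ht)).1)
    (memLp_one_iff_integrable.1 (hi t ht)).norm.2 (fun n => Eventually.of_forall fun x => ?_)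
    (Eventually.of_forall fun x => ?_)
  · simpa only [eLpNorm_one_eq_lintegral_enorm, ofReal_norm] using key
  · have h0 : 0 ≤ min (nsq (u t x)) n := le_min (nsq_nonneg _) n.cast_nonneg
    rw [norm_mul, norm_mul, ← hsq, Real.norm_of_nonneg (Real.rpow_nonneg h0 _),
      Real.norm_of_nonneg (Real.rpow_nonneg (nsq_nonneg _) _)]
    exact mul_le_mul_of_nonneg_left (Real.rpow_le_rpow h0 (min_le_left _ _) (by linarith))
      (norm_nonneg _)
  · refine tendsto_const_nhds.congr' ?_
    obtain ⟨n0, hn0⟩ := exists_nat_gt (nsq (u t x))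
    filter_upwards [eventually_ge_atTop n0] with n hn
    have : (n0 : ℝ) ≤ n := by exact_mod_cast hn
    rw [min_eq_left (by linarith), hsq]

end StrongMeasurability

/-! ### Choice of the exponent and conclusion -/

section Main

variable {Ω : Set E3} {μ lam a γ q T M m β : ℝ} {ρ : ℝ → E3 → ℝ} {u : ℝ → E3 → E3}
  {Dρ : ℝ → E3 → E3} {Du : ℝ → E3 → Mat3} {D2u : ℝ → E3 → Tens3}

/-- At `β = 1/2` the coercivity constant is `(7μ - lam)/4 > 0`; the slack allows `β` slightly
larger, which pushes the final exponent `2 + 2β` beyond 3. -/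
theorem exists_exponent (hμ : 0 < μ) (hL : 0 < μ + lam) (h7 : lam < 7 * μ) :
    ∃ β c : ℝ, 1 / 2 < β ∧ β ≤ 1 ∧ 0 < c ∧ c ≤ μ ∧
      c ≤ μ * (1 + 2 * β) - (μ + lam) * (2 * β) ^ 2 / 4 := by
  have hd : 0 < 7 * μ - lam := by linarith
  -- With `κ = 1 + δ` and `δ² ≤ δ`, the loss is at most `3δ(μ + lam)/4`. The second entry of the
  -- minimum makes this at most half of the available `(7μ - lam)/4`.
  set δ := min (1 / 2) ((7 * μ - lam) / (6 * (μ + lam))) with hδ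
  have h0 : 0 < δ := lt_min (by norm_num) (by positivity)
  have h1 : δ ≤ 1 / 2 := min_le_left _ _
  have h2 : δ * (6 * (μ + lam)) ≤ 7 * μ - lam := by
    rw [← le_div_iff₀ (by positivity)]; exact min_le_right _ _
  have hpos : 0 < μ * (1 + 2 * ((1 + δ) / 2)) - (μ + lam) * (2 * ((1 + δ) / 2)) ^ 2 / 4 := by
    have e1 : δ ^ 2 ≤ δ := by nlinarith
    have e2 := mul_le_mul_of_nonneg_left e1 hL.le
    have e3 := mul_pos hμ h0
    nlinarith
  exact ⟨(1 + δ) / 2, min μ _, by linarith, by linarith, lt_min hμ hpos, min_le_left _ _,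
    min_le_right _ _⟩

theorem eLpNorm_one_le_of_bounded (hΩ : Bornology.IsBounded Ω) (hM : 0 ≤ M) {f : E3 → ℝ}
    (hf : ∀ᵐ x ∂(vol Ω), 0 ≤ f x ∧ f x ≤ M) :
    eLpNorm f 1 (vol Ω) ≤ ENNReal.ofReal (M * (volume Ω).toReal) := by
  have h := eLpNorm_le_of_ae_bound (p := 1) (C := M) (f := f) (μ := vol Ω) (by
    filter_upwards [hf] with x hx
    rw [Real.norm_of_nonneg hx.1]; exact hx.2)
  refine h.trans (le_of_eq ?_)
  rw [ENNReal.ofReal_mul hM, ENNReal.ofReal_toReal hΩ.measure_lt_top.ne]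
  simp [mul_comm]

/-- The a priori bound for `∫ ρ |u|^(2β + 2)`. -/
theorem IsStrongSolution.eLpNorm_density_mul_rpow_le {c S : ℝ} (hL : 0 < μ + lam)
    (hc : 0 < c) (hcμ : c ≤ μ)
    (hck : c ≤ μ * (1 + 2 * β) - (μ + lam) * (2 * β) ^ 2 / 4) (ha : 0 < a) (hγ : 1 < γ)
    (hβ : 0 ≤ β) (hβ1 : β ≤ 1) (hm0 : 0 ≤ m) (hT : 0 < T)
    (h : IsStrongSolution Ω μ lam a γ q T ρ u Dρ Du D2u)
    (hb : ∀ t ∈ Ico 0 T, ∀ᵐ x ∂(vol Ω), 0 ≤ ρ t x ∧ ρ t x ≤ M) (hM : 0 ≤ M)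
    (hm : ∀ t ∈ Ico 0 T, eLpNorm (ρ t) 1 (vol Ω) ≤ ENNReal.ofReal m) (hS : 0 ≤ S)
    (hu : eLpNorm (u 0) 6 (vol Ω) ≤ ENNReal.ofReal S) {t : ℝ} (ht : t ∈ Ico 0 T) :
    eLpNorm (fun x => ρ t x * ‖u t x‖ ^ (2 + 2 * β)) 1 (vol Ω) ≤ ENNReal.ofReal
      ((1 + β) * (2 * ((2 * (m + M * S ^ 6) + m) * Real.exp
        ((6 + 2 * (2 * β) ^ 2) / (4 * c) * a ^ 2 * M ^ (2 * γ - 1) * 4 * T)))) := by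
  set K := (6 + 2 * (2 * β) ^ 2) / (4 * c) * a ^ 2 * M ^ (2 * γ - 1) * 4 with hK
  have hK0 : 0 ≤ K := by positivity
  set Q := (2 * (m + M * S ^ 6) + m) * Real.exp (K * T) with hQ
  have hρ := h.contρ_two.density_three_halves hm
  have hε : ∀ n : ℕ, (0 : ℝ) < 1 / (n + 1) := fun n => by positivity
  have hε1 : ∀ n : ℕ, (1 : ℝ) / (n + 1) ≤ 1 := fun n => by
    rw [div_le_one (by positivity)]; linarith [n.cast_nonneg (α := ℝ)]
  have hE : ∀ n : ℕ, energy Ω β (1 / (n + 1)) ρ u t ≤ Q := by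
    intro n
    have hcont : ContinuousOn (fun s => energy Ω β (1 / (n + 1)) ρ u s + m) (Icc 0 t) :=
      ((h.continuousOn_energy hβ (hε n) (hε1 n) hm).mono
        fun s hs => ⟨hs.1, hs.2.trans_lt ht.2⟩).add continuousOn_const
    -- Adding `m` to the energy makes the rate bound homogeneous, so the growth is purely
    -- exponential.
    have key := le_mul_exp_of_left_slope (K := K) ht.1 hcont fun s hs δ hδ => by
      have hs' : s ∈ Ioo 0 T := ⟨hs.1, hs.2.trans_lt ht.2⟩
      have hrate := h.energyRate_le hL hc hcμ rfl hck ha hγ hβ hβ1 (hε n) (hε1 n) hm0 hb hM hm hs'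
      filter_upwards [h.energy_slope_le hγ hβ (hε n) (hε1 n) hb hm hs' hδ, self_mem_nhdsWithin]
        with s' h1 h2
      have h3 : 0 ≤ s - s' := sub_nonneg.2 (le_of_lt h2)
      have h4 := mul_le_mul_of_nonneg_left (add_le_add_left hrate δ) h3
      linarith
    have hz := h.energy_zero_le hT hβ hβ1 (hε n) (hε1 n) hm0 hb hM hm hS hu
    have e1 : (energy Ω β (1 / (n + 1)) ρ u 0 + m) * Real.exp (K * t) ≤ Q := by
      refine mul_le_mul (by linarith) (Real.exp_le_exp.2 ?_) (Real.exp_pos _).le (by positivity)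
      exact mul_le_mul_of_nonneg_left ht.2.le hK0
    linarith
  have hstep : ∀ n : ℕ, eLpNorm (fun x => ρ t x * (nsq (u t x) *
      weight β (1 / (n + 1)) (nsq (u t x)))) 1 (vol Ω) ≤ ENNReal.ofReal ((1 + β) * (2 * Q)) := by
    intro n
    have hi : MemLp (fun x => ρ t x * (1 / 2 * weightPrim β (1 / (n + 1)) (nsq (u t x)))) 1
        (vol Ω) := ((h.contInLp_energyDensity hβ (hε n) (hε1 n)).1 t ht).mul' (hρ.1 t ht)
    have e1 : eLpNorm (fun x => ρ t x * (nsq (u t x) * weight β (1 / (n + 1)) (nsq (u t x)))) 1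
        (vol Ω) ≤ ENNReal.ofReal ((1 + β) * 2) * eLpNorm
          (fun x => ρ t x * (1 / 2 * weightPrim β (1 / (n + 1)) (nsq (u t x)))) 1 (vol Ω) := by
      refine eLpNorm_le_mul_eLpNorm_of_ae_le_mul ?_ 1
      filter_upwards [hb t ht] with x hx
      have hz := nsq_nonneg (u t x)
      have hw := (weight_pos (β := β) (hε n) hz).le
      have hP := weightPrim_nonneg hβ (hε n) (hε1 n) hz
      rw [Real.norm_of_nonneg (mul_nonneg hx.1 (mul_nonneg hz hw)),
        Real.norm_of_nonneg (mul_nonneg hx.1 (mul_nonneg (by norm_num) hP))]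
      have := mul_le_mul_of_nonneg_left (mul_weight_le_weightPrim hβ (hε n) (hε1 n) hz) hx.1
      linarith
    refine e1.trans ?_
    rw [eLpNorm_one_eq_lintegral_enorm, ← ofReal_integral_norm_eq_lintegral_enorm
      (memLp_one_iff_integrable.1 hi), ← ENNReal.ofReal_mul (by positivity), ← mul_assoc]
    refine ENNReal.ofReal_le_ofReal (mul_le_mul_of_nonneg_left ?_ (by positivity))
    refine le_trans (le_of_eq (integral_congr_ae ?_)) (hE n)
    filter_upwards [hb t ht] with x hx
    exact Real.norm_of_nonneg (mul_nonneg hx.1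
      (mul_nonneg (by norm_num) (weightPrim_nonneg hβ (hε n) (hε1 n) (nsq_nonneg _))))
  have hmeas : ∀ n : ℕ, AEStronglyMeasurable (fun x => ρ t x * (nsq (u t x) *
      weight β (1 / (n + 1)) (nsq (u t x)))) (vol Ω) := fun n =>
    (hρ.1 t ht).1.mul ((contDiff_nsq.mul (contDiff_weight_nsq (hε n)
      (hε1 n))).continuous.comp_aestronglyMeasurable (h.contInLp_u.1 t ht).1)
  -- Fatou's lemma along `ε = 1/(n + 1)`: the limiting integrand has weight `(1 + |u|²)^β`, which
  -- dominates `|u|^(2β)`.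
  have hfatou := Lp.eLpNorm_le_of_ae_tendsto (u := atTop)
    (g := fun x => ρ t x * (nsq (u t x) * (1 + nsq (u t x)) ^ β)) (Eventually.of_forall hstep) hmeas
    (Eventually.of_forall fun x =>
      ((tendsto_weight (nsq_nonneg _)).const_mul (nsq (u t x))).const_mul (ρ t x))
  refine le_trans (eLpNorm_mono_ae ?_) hfatou
  filter_upwards [hb t ht] with x hx
  have hz := nsq_nonneg (u t x)
  have e1 : ‖u t x‖ ^ (2 + 2 * β) = nsq (u t x) * nsq (u t x) ^ β := by
    rw [nsq_eq_norm_sq, ← Real.rpow_natCast, ← Real.rpow_mul (norm_nonneg _),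
      ← Real.rpow_add_of_nonneg (norm_nonneg _) (by norm_num) (by positivity)]
    norm_num
  rw [e1, Real.norm_of_nonneg (by have := hx.1; positivity),
    Real.norm_of_nonneg (by have := hx.1; positivity)]
  have := hx.1
  gcongr
  linarith

end Main

theorem lemma3p1 (μ lam : ℝ) (hμ : 0 < μ) (hlam : 0 ≤ 3 * lam + 2 * μ) (h7 : lam < 7 * μ) :
    ∃ r ∈ Ioo (3 : ℝ) 6,
      ∀ (Ω : Set E3) (a γ : ℝ), IsOpen Ω → (Ω = univ ∨ Bornology.IsBounded Ω) →
      0 < a → 1 < γ →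
      -- the constant depends only on `T` and on the bounds `R` for `‖ρ₀‖_∞`, `B` for `‖∇u₀‖₂`,
      -- `M` for the density and, if `Ω` is the whole space, `N` for the initial mass
      ∀ T R B M N : ℝ, 0 < T →
      ∃ C : ℝ,
        ∀ q ∈ Ioc (3 : ℝ) 6,
        ∀ (ρ : ℝ → E3 → ℝ) (u : ℝ → E3 → E3)
          (Dρ : ℝ → E3 → E3) (Du : ℝ → E3 → Mat3) (D2u : ℝ → E3 → Tens3),
        IsStrongSolution Ω μ lam a γ q T ρ u Dρ Du D2u →
        eLpNorm (ρ 0) ⊤ (vol Ω) ≤ ENNReal.ofReal R →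
        eLpNorm (Du 0) 2 (vol Ω) ≤ ENNReal.ofReal B →
        normLinfLp T Ω ⊤ ρ ≤ ENNReal.ofReal M →
        (Ω = univ → eLpNorm (ρ 0) 1 (vol Ω) ≤ ENNReal.ofReal N) →
        MemLinfL1 T Ω (fun t x => ρ t x * ‖u t x‖ ^ r) ∧
          normLinfLp T Ω 1 (fun t x => ρ t x * ‖u t x‖ ^ r) ≤ ENNReal.ofReal C := by
  classical
  -- The two sign conditions give `μ + lam ≥ μ/3`.
  have hL : 0 < μ + lam := by linarith
  obtain ⟨β, c, hβ2, hβ1, hc, hcμ, hck⟩ := exists_exponent hμ hL h7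
  have hβ : 0 ≤ β := by linarith
  refine ⟨2 + 2 * β, ⟨by linarith, by linarith⟩, fun Ω a γ _ hΩ ha hγ T R B M N hT => ?_⟩
  obtain ⟨Cs, hCs0, hCs⟩ := exists_sobolev
  set M0 := max M 0 with hM0
  have hM0' : 0 ≤ M0 := le_max_right _ _
  set S := Cs * max B 0 with hSd
  have hS : 0 ≤ S := mul_nonneg hCs0 (le_max_right _ _)
  -- A uniform mass bound: on the whole space it comes from the initial mass, on a bounded set from
  -- the density bound times the volume. Positive parts make the prescribed bounds usable whatever
  -- their sign.
  set m := if Ω = univ then max N 0 else M0 * (volume Ω).toReal with hmd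
  have hm0 : 0 ≤ m := by
    rw [hmd]; split_ifs
    · exact le_max_right _ _
    · positivity
  refine ⟨(1 + β) * (2 * ((2 * (m + M0 * S ^ 6) + m) * Real.exp
    ((6 + 2 * (2 * β) ^ 2) / (4 * c) * a ^ 2 * M0 ^ (2 * γ - 1) * 4 * T))), fun q _ ρ u Dρ Du D2u h _ hB hM hN => ?_⟩
  have h0 : (0 : ℝ) ∈ Ico 0 T := ⟨le_rfl, hT⟩
  have hb : ∀ t ∈ Ico 0 T, ∀ᵐ x ∂(vol Ω), 0 ≤ ρ t x ∧ ρ t x ≤ M0 := fun t ht =>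
    (h.nonneg t ht).and (h.contρ_two.ae_le_of_normLinfLp hM0'
      (hM.trans (ENNReal.ofReal_le_ofReal (le_max_left _ _))) ht)
  have hm : ∀ t ∈ Ico 0 T, eLpNorm (ρ t) 1 (vol Ω) ≤ ENNReal.ofReal m := by
    intro t ht
    by_cases hu : Ω = univ
    · rw [hmd, if_pos hu]
      subst hu
      exact h.mass_le (le_max_right _ _) hb
        ((hN rfl).trans (ENNReal.ofReal_le_ofReal (le_max_left _ _))) ht
    · rw [hmd, if_neg hu]
      exact eLpNorm_one_le_of_bounded (hΩ.resolve_left hu) hM0' (hb t ht)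
  have hu0 : eLpNorm (u 0) 6 (vol Ω) ≤ ENNReal.ofReal S := by
    refine (hCs Ω _ _ _ _ (h.memD10 0 h0) (h.memD10 0 h0)).1.trans ?_
    rw [hSd, ENNReal.ofReal_mul hCs0]
    gcongr
    exact hB.trans (ENNReal.ofReal_le_ofReal (le_max_left _ _))
  have hbound := fun t (ht : t ∈ Ico 0 T) => h.eLpNorm_density_mul_rpow_le hL hc hcμ hck ha hγ
    hβ hβ1 hm0 hT hb hM0' hm hS hu0 ht
  have hess := essSup_le_of_ae_le (μ := volume.restrict (Ioo 0 T)) _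
    ((ae_restrict_iff' measurableSet_Ioo).2
      (Eventually.of_forall fun t ht => hbound t (Ioo_subset_Ico_self ht)))
  have hmem : ∀ t ∈ Ioo 0 T, MemLp (fun x => ρ t x * ‖u t x‖ ^ (2 + 2 * β)) 1 (vol Ω) :=
    fun t ht => by
      have htI := Ioo_subset_Ico_self ht
      refine ⟨(h.contρ_two.1 t htI).1.mul ?_, (hbound t htI).trans_lt ENNReal.ofReal_lt_top⟩
      exact (Real.continuous_rpow_const (by linarith)).comp_aestronglyMeasurable
        (h.contInLp_u.1 t htI).1.norm
  refine ⟨⟨⟨fun t => toL1 Ω fun x => ρ t x * ‖u t x‖ ^ (2 + 2 * β),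
    aestronglyMeasurable_density_mul_rpow (by linarith) (h.contρ_two.density_three_halves hm)
      h.contInLp_u hmem, ?_⟩, lt_of_le_of_lt hess ENNReal.ofReal_lt_top⟩, hess⟩
  refine (ae_restrict_iff' measurableSet_Ioo).2 (Eventually.of_forall fun t ht => ?_)
  beta_reduce
  rw [toL1_of_memLp (hmem t ht)]
  exact (hmem t ht).coeFn_toLp
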